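/- Let $n\ge 1$. Let $\mathfrak g$ be a finite-dimensional real Lie algebra and $\langle\cdots\rangle:\mathfrak g^{\,n+1}\to V$ a symmetric multilinear map with values in a finite-dimensional real vector space $V$ (e.g. $V=\mathbb R$) that is invariant: $\sum_i\langle z_0\cdots[x,z_i]\cdots z_n\rangle=0$. For $\mathfrak g$-valued forms $Z_i=Z_i^{A}T_A$ put $\langle Z_0\cdots Z_n\rangle=Z_0^{A_0}\wedge\dots\wedge Z_n^{A_n}\langle T_{A_0}\cdots T_{A_n}\rangle$. Let $M$ be a smooth manifold (boundary and corners allowed) of dimension $2n+1$, $k\in\mathbb R$, and let $A,\bar A$ be arbitrary smooth $\mathfrak g$-valued 1-forms on $M$ (gauge connections in a fixed gauge; no field equations are imposed). Put $\Theta=A-\bar A$, $A_t=\bar A+t\Theta$, $F_t=dA_t+\tfrac12[A_t,A_t]$, $F=F_1$, $\bar F=F_0$, $D_A\lambda=d\lambda+[A,\lambda]$, and $$L_T(A,\bar A)=k(n+1)\int_0^1dt\,\langle\Theta F_t^n\rangle .$$ 1. (Variation.) For all smooth variations $\delta A,\delta\bar A$, with $\delta A_t=\delta\bar A+t(\delta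 A-\delta\bar A)$, one has $\delta L_T=E(\delta A,\delta\bar A)+dB(\delta A,\delta\bar A)$, where $$E=k(n+1)\big(\langle\delta A\,F^n\rangle-\langle\delta\bar A\,\bar F^n\rangle\big),\qquad B=kn(n+1)\int_0^1dt\,\langle\delta A_t\,\Theta F_t^{n-1}\rangle .$$ 2. (Gauge current.) For every smooth $\lambda:M\to\mathfrak g$ let $*J^{\rm on}_{\rm gauge}=B(D_A\lambda,D_{\bar A}\lambda)$ and $Y=k(n+1)(\langle\lambda F^n\rangle-\langle\lambda\bar F^n\rangle)$. Then $d{*J^{\rm on}_{\rm gauge}}+E(D_A\lambda,D_{\bar A}\lambda)=0$ and $E(D_A\lambda,D_{\bar A}\lambda)=dY$. The corrected current $*J_{\rm gauge}=*J^{\rm on}_{\rm gauge}+Y$ is exact and conserved off-shell: $$*J_{\rm gauge}=kn(n+1)\,d\int_0^1dt\,\langle\lambda\,\Theta F_t^{n-1}\rangle,\qquad d{*J_{\rm gauge}}=0 .$$ 3. (Diffeomorphism current.) For every smooth vector field $\xi$, with contraction $I_\xi$ and $\pounds_\xi=dI_\xi+I_\xi d$, let $*J^{\rm on}_{\rm dif}=B(\pounds_\xi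 A,\pounds_\xi\bar A)-I_\xi L_T$ and $X=k(n+1)(\langle I_\xi A\,F^n\rangle-\langle I_\xi\bar A\,\bar F^n\rangle)$. Then $d{*J^{\rm on}_{\rm dif}}+E(\pounds_\xi A,\pounds_\xi\bar A)=0$ and $E(\pounds_\xi A,\pounds_\xi\bar A)=dX$. The corrected current $*J_{\rm dif}=*J^{\rm on}_{\rm dif}+X$ is exact and conserved off-shell: $$*J_{\rm dif}=kn(n+1)\,d\int_0^1dt\,\langle I_\xi A_t\,\Theta F_t^{n-1}\rangle,\qquad d{*J_{\rm dif}}=0 .$$ The primitives $\int_0^1dt\,\langle\cdots\rangle$ in 2 and 3 are smooth $(2n-1)$-forms. 4. (Charges.) Let $S$ be a compact oriented smooth $2n$-manifold with boundary and $\iota:S\to M$ a smooth map (e.g. a slice of $M=\mathbb R\times S$). Put $Q_{\rm gauge}(\lambda)=\int_S\iota^*{*J_{\rm gauge}}$ and $Q_{\rm dif}(\xi)=\int_S\iota^*{*J_{\rm dif}}$. These are boundary charges: $$Q_{\rm gauge}(\lambda)=kn(n+1)\int_{\partial S}\iota^*\!\int_0^1dt\,\langle\lambda\,\Theta F_t^{n-1}\rangle,\qquad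 Q_{\rm dif}(\xi)=kn(n+1)\int_{\partial S}\iota^*\!\int_0^1dt\,\langle I_\xi A_t\,\Theta F_t^{n-1}\rangle .$$ Let $\delta_\eta$ denote the derivative along the infinitesimal gauge transformation $\delta A=D_A\eta$, $\delta\bar A=D_{\bar A}\eta$, with $\eta:M\to\mathfrak g$ smooth and with $\lambda$ and $\xi$ held fixed. With $\{Q_{\rm gauge}(\eta),Q_{\rm gauge}(\lambda)\}:=\delta_\eta Q_{\rm gauge}(\lambda)$ the charges reproduce the Lie algebra without central extension, $$\{Q_{\rm gauge}(\eta),Q_{\rm gauge}(\lambda)\}=Q_{\rm gauge}([\eta,\lambda]),$$ and moreover $\delta_\eta Q_{\rm dif}(\xi)=Q_{\rm gauge}(\pounds_\xi\eta)$. -/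

import Mathlib

open Set MeasureTheory
open scoped Manifold ContDiff

/-- A real Lie algebra structure on a normed space (in the theorem the space is finite-dimensional,
so the choice of norm is immaterial and only serves to make sense of derivatives of
`𝔤`-valued functions). The axioms are exactly those of Mathlib's `LieRing` and `LieAlgebra ℝ`. -/
class NormedLieAlg (𝔤 : Type*) [NormedAddCommGroup 𝔤] [NormedSpace ℝ 𝔤] extends Bracket 𝔤 𝔤 where
  protected add_lie : ∀ x y z : 𝔤, ⁅x + y, z⁆ = ⁅x, z⁆ + ⁅y, z⁆
  protected lie_add : ∀ x y z : 𝔤, ⁅x, y + z⁆ = ⁅x, y⁆ + ⁅x, z⁆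
  protected lie_self : ∀ x : 𝔤, ⁅x, x⁆ = 0
  protected leibniz_lie : ∀ x y z : 𝔤, ⁅x, ⁅y, z⁆⁆ = ⁅⁅x, y⁆, z⁆ + ⁅y, ⁅x, z⁆⁆
  protected lie_smul : ∀ (t : ℝ) (x y : 𝔤), ⁅x, t • y⁆ = t • ⁅x, y⁆

namespace NormedLieAlg

variable {𝔤 : Type*} [NormedAddCommGroup 𝔤] [NormedSpace ℝ 𝔤] [NormedLieAlg 𝔤]

instance instLieRing : LieRing 𝔤 where
  add_lie := NormedLieAlg.add_lie
  lie_add := NormedLieAlg.lie_add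
  lie_self := NormedLieAlg.lie_self
  leibniz_lie := NormedLieAlg.leibniz_lie

instance instLieAlgebra : LieAlgebra ℝ 𝔤 where
  lie_smul := NormedLieAlg.lie_smul

end NormedLieAlg

noncomputable section

namespace Transgression

/-! ### Multilinear maps applied to vector-valued alternating forms -/

section Wedge

variable {E : Type*} [NormedAddCommGroup E] [NormedSpace ℝ E]
variable {𝔤 : Type*} [NormedAddCommGroup 𝔤] [NormedSpace ℝ 𝔤]
variable {V : Type*} [NormedAddCommGroup V] [NormedSpace ℝ V]

/-- The (not alternating) multilinear map `v ↦ P (Z₀ (v ⟨0, ·⟩), …, Z_{r-1} (v ⟨r-1, ·⟩))`. -/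
def tensorForm {r : ℕ} (P : ContinuousMultilinearMap ℝ (fun _ : Fin r => 𝔤) V)
    {d : Fin r → ℕ} (Z : ∀ i, E [⋀^Fin (d i)]→L[ℝ] 𝔤) :
    ContinuousMultilinearMap ℝ (fun _ : (Σ i, Fin (d i)) => E) V where
  toMultilinearMap :=
    P.toMultilinearMap.compMultilinearMap (fun i => (Z i).toContinuousMultilinearMap.toMultilinearMap)
  cont := P.cont.comp (continuous_pi fun i => (Z i).cont.comp
    (continuous_pi fun j => continuous_apply (⟨i, j⟩ : Σ i, Fin (d i))))

/-- The form `⟨Z₀ Z₁ ⋯ Z_{r-1}⟩ = Z₀^{A₀} ∧ ⋯ ∧ Z_{r-1}^{A_{r-1}} P(T_{A₀}, …, T_{A_{r-1}})` of degree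
`N = ∑ dᵢ` obtained by applying an `r`-linear map `P` to `𝔤`-valued forms `Zᵢ` of degree `dᵢ`:
`v ↦ (∏ dᵢ!)⁻¹ ∑_σ sign σ P(Z₀(v_{σ(0)}, …), Z₁(…), …)`. -/
def polyForm {r N : ℕ} (P : ContinuousMultilinearMap ℝ (fun _ : Fin r => 𝔤) V)
    {d : Fin r → ℕ} (h : ∑ i, d i = N) (Z : ∀ i, E [⋀^Fin (d i)]→L[ℝ] 𝔤) :
    E [⋀^Fin N]→L[ℝ] V :=
  ((∏ i, ((d i).factorial : ℝ))⁻¹) • ContinuousMultilinearMap.alternatization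
    ((tensorForm P Z).domDomCongr (finSigmaFinEquiv.trans (finCongr h)))

/-- The degrees `(p, q, 2, …, 2)`. -/
def degs (p q m : ℕ) : Fin (m + 2) → ℕ :=
  Fin.cons p (Fin.cons q (fun _ : Fin m => 2) : Fin (m + 1) → ℕ)

theorem sum_degs {p q m N : ℕ} (h : p + q + 2 * m = N) : ∑ i, degs p q m i = N := by
  subst h
  simp [degs, Fin.sum_univ_succ]
  ring

/-- The family `(a, b, F, …, F)`. -/
def triple {p q : ℕ} (m : ℕ) (a : E [⋀^Fin p]→L[ℝ] 𝔤) (b : E [⋀^Fin q]→L[ℝ] 𝔤)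
    (F : E [⋀^Fin 2]→L[ℝ] 𝔤) (i : Fin (m + 2)) : E [⋀^Fin (degs p q m i)]→L[ℝ] 𝔤 :=
  Fin.cases (motive := fun i => E [⋀^Fin (degs p q m i)]→L[ℝ] 𝔤) a
    (fun j => Fin.cases (motive := fun j => E [⋀^Fin (degs p q m j.succ)]→L[ℝ] 𝔤) b
      (fun _ => F) j) i

/-- `⟨a b F^m⟩` for an `(m+2)`-linear map `⟨⋯⟩ = P`, a `p`-form `a`, a `q`-form `b` and a
2-form `F`. -/
def angle {p q m N : ℕ} (P : ContinuousMultilinearMap ℝ (fun _ : Fin (m + 2) => 𝔤) V)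
    (h : p + q + 2 * m = N) (a : E [⋀^Fin p]→L[ℝ] 𝔤) (b : E [⋀^Fin q]→L[ℝ] 𝔤)
    (F : E [⋀^Fin 2]→L[ℝ] 𝔤) : E [⋀^Fin N]→L[ℝ] V :=
  polyForm P (sum_degs h) (triple m a b F)

/-- Symmetric multilinear maps `⟨⋯⟩ : 𝔤 × ⋯ × 𝔤 → V` that are invariant under the adjoint action:
`∑ᵢ ⟨z₁ ⋯ [x, zᵢ] ⋯ z_r⟩ = 0`. -/
structure IsInvariantPolynomial [NormedLieAlg 𝔤] {r : ℕ}
    (P : ContinuousMultilinearMap ℝ (fun _ : Fin r => 𝔤) V) : Prop where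
  symm : ∀ (σ : Equiv.Perm (Fin r)) (z : Fin r → 𝔤), P (z ∘ σ) = P z
  invariant : ∀ (x : 𝔤) (z : Fin r → 𝔤), ∑ i, P (Function.update z i ⁅x, z i⁆) = 0

/-- The Lie bracket as a continuous bilinear map. -/
def lieMap (𝔤 : Type*) [NormedAddCommGroup 𝔤] [NormedSpace ℝ 𝔤] [FiniteDimensional ℝ 𝔤]
    [NormedLieAlg 𝔤] : ContinuousMultilinearMap ℝ (fun _ : Fin (0 + 2) => 𝔤) 𝔤 where
  toFun z := ⁅z 0, z 1⁆
  map_update_add' := by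
    intro _ z i x y
    have : i = 0 ∨ i = 1 := by fin_cases i <;> simp
    rcases this with rfl | rfl <;> simp [Function.update]
  map_update_smul' := by
    intro _ z i c x
    have : i = 0 ∨ i = 1 := by fin_cases i <;> simp
    rcases this with rfl | rfl <;> simp [Function.update]
  cont := by
    let B : 𝔤 →L[ℝ] 𝔤 →L[ℝ] 𝔤 := LinearMap.toContinuousBilinearMap
      (LinearMap.mk₂ ℝ (fun x y : 𝔤 => ⁅x, y⁆) (by simp) (by simp) (by simp) (by simp))
    exact (B.continuous.comp (continuous_apply 0)).clm_apply (continuous_apply 1)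

/-- The bracket `[α, β]` of a `p`-form and a `q`-form with values in `𝔤`. -/
def lieWedge [FiniteDimensional ℝ 𝔤] [NormedLieAlg 𝔤] {p q N : ℕ} (h : p + q = N)
    (α : E [⋀^Fin p]→L[ℝ] 𝔤) (β : E [⋀^Fin q]→L[ℝ] 𝔤) : E [⋀^Fin N]→L[ℝ] 𝔤 :=
  angle (m := 0) (lieMap 𝔤) (by omega) α β 0

end Wedge

/-! ### Differential forms on manifolds

A `W`-valued `k`-form on `M` is a map assigning to `x : M` an alternating map on
`TangentSpace I x`, which is by definition the model vector space `E`. -/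

section Forms

variable {E : Type*} [NormedAddCommGroup E] [NormedSpace ℝ E]
variable {H : Type*} [TopologicalSpace H] (I : ModelWithCorners ℝ E H)
variable {M : Type*} [TopologicalSpace M] [ChartedSpace H M]
variable {W : Type*} [NormedAddCommGroup W] [NormedSpace ℝ W]

/-- The local expression of the form `α` in the preferred chart `φ` at `x`, that is, the pullback of
`α` by `φ⁻¹`. -/
def chartRep {k : ℕ} (α : M → E [⋀^Fin k]→L[ℝ] W) (x : M) (y : E) : E [⋀^Fin k]→L[ℝ] W :=
  (α ((extChartAt I x).symm y)).compContinuousLinearMap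
    (mfderivWithin 𝓘(ℝ, E) I (extChartAt I x).symm (range I) y : E →L[ℝ] E)

/-- Smoothness of a differential form: all its local expressions are smooth. -/
def IsSmoothForm {k : ℕ} (α : M → E [⋀^Fin k]→L[ℝ] W) : Prop :=
  ∀ x : M, ContDiffOn ℝ ∞ (chartRep I α x) (extChartAt I x).target

/-- The exterior derivative, computed at `x` in the preferred chart at `x`. -/
def extD {k : ℕ} (α : M → E [⋀^Fin k]→L[ℝ] W) (x : M) : E [⋀^Fin (k + 1)]→L[ℝ] W :=
  (extDerivWithin (chartRep I α x) (range I) (extChartAt I x x)).compContinuousLinearMap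
    (mfderiv I 𝓘(ℝ, E) (extChartAt I x) x : E →L[ℝ] E)

/-- The pullback `f^* α` of a form by a map between manifolds. -/
def pullback {E' : Type*} [NormedAddCommGroup E'] [NormedSpace ℝ E']
    {H' : Type*} [TopologicalSpace H'] (J : ModelWithCorners ℝ E' H')
    {S : Type*} [TopologicalSpace S] [ChartedSpace H' S] (f : S → M) {k : ℕ}
    (α : M → E [⋀^Fin k]→L[ℝ] W) (p : S) : E' [⋀^Fin k]→L[ℝ] W :=
  (α (f p)).compContinuousLinearMap (mfderiv J I f p : E' →L[ℝ] E)

/-- A function regarded as a 0-form. -/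
def zeroForm (f : M → W) (x : M) : E [⋀^Fin 0]→L[ℝ] W :=
  ContinuousAlternatingMap.constOfIsEmpty ℝ E (Fin 0) (f x)

/-- The contraction `I_ξ α = α(ξ, ⋯)`. -/
def contract {k : ℕ} (ξ : ∀ x : M, TangentSpace I x) (α : M → E [⋀^Fin (k + 1)]→L[ℝ] W) (x : M) :
    E [⋀^Fin k]→L[ℝ] W :=
  (α x).curryLeft (ξ x : E)

/-- The Lie derivative `£_ξ = d I_ξ + I_ξ d` on forms of positive degree. -/
def lieD {k : ℕ} (ξ : ∀ x : M, TangentSpace I x) (α : M → E [⋀^Fin (k + 1)]→L[ℝ] W) :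
    M → E [⋀^Fin (k + 1)]→L[ℝ] W :=
  extD I (contract I ξ α) + contract I ξ (extD I α)

/-- The derivative `£_ξ f = df(ξ)` of a function along a vector field. -/
def lieD₀ (ξ : ∀ x : M, TangentSpace I x) (f : M → W) (x : M) : W :=
  (mfderiv I 𝓘(ℝ, W) f x : E →L[ℝ] W) (ξ x : E)

end Forms

/-! ### Integration over compact oriented manifolds with boundary -/

section Integration

variable (d : ℕ) (S : Type*) [TopologicalSpace S] [ChartedSpace (EuclideanHalfSpace (d + 1)) S]
variable {V : Type*} [NormedAddCommGroup V] [NormedSpace ℝ V]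

/-- The preferred charts of `S` form an oriented atlas: all transition maps have positive
Jacobian. -/
def IsOrientedAtlas : Prop :=
  ∀ x x' : S, ∀ y ∈ (extChartAt (𝓡∂ (d + 1)) x).target,
    (extChartAt (𝓡∂ (d + 1)) x).symm y ∈ (extChartAt (𝓡∂ (d + 1)) x').source →
      0 < (fderivWithin ℝ (extChartAt (𝓡∂ (d + 1)) x' ∘ (extChartAt (𝓡∂ (d + 1)) x).symm)
        (range (𝓡∂ (d + 1))) y).det

variable [IsManifold (𝓡∂ (d + 1)) ∞ S] [T2Space S] [CompactSpace S]

/-- A smooth partition of unity subordinate to the preferred charts. -/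
def chartPartition : SmoothPartitionOfUnity S (𝓡∂ (d + 1)) S univ :=
  Classical.choose (SmoothPartitionOfUnity.exists_isSubordinate_chartAt_source (𝓡∂ (d + 1)) S)

variable {d S}

/-- The integral of a top-degree form over the compact manifold `S`, oriented by its preferred
charts: `∑ₓ ∫ (φₓ⁻¹)^*(ρₓ α)`. -/
def integrate (α : S → EuclideanSpace ℝ (Fin (d + 1)) [⋀^Fin (d + 1)]→L[ℝ] V) : V :=
  ∑ᶠ x : S, ∫ y in (extChartAt (𝓡∂ (d + 1)) x).target,
    chartPartition d S x ((extChartAt (𝓡∂ (d + 1)) x).symm y) •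
      chartRep (𝓡∂ (d + 1)) α x y (fun i => EuclideanSpace.single i 1)

/-- The inclusion `z ↦ (0, z)` of the boundary hyperplane of the half space `{y | 0 ≤ y 0}`. -/
def bdryIncl (z : EuclideanSpace ℝ (Fin d)) : EuclideanSpace ℝ (Fin (d + 1)) :=
  WithLp.toLp 2 (Fin.cons 0 (fun i => z i) : Fin (d + 1) → ℝ)

/-- The integral of a form of degree `dim S - 1` over `∂S`, with the outward-normal-first
orientation. The charts of `∂S` are the restrictions of the charts of `S` to the hyperplane
`y 0 = 0`; as `-e₀` points outward, the frame `(e₁, …, e_d)` of the boundary is negatively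
oriented, whence the sign. -/
def integrateBoundary (σ : S → EuclideanSpace ℝ (Fin (d + 1)) [⋀^Fin d]→L[ℝ] V) : V :=
  -∑ᶠ x : S, ∫ z in {z : EuclideanSpace ℝ (Fin d) | bdryIncl z ∈ (extChartAt (𝓡∂ (d + 1)) x).target},
    chartPartition d S x ((extChartAt (𝓡∂ (d + 1)) x).symm (bdryIncl z)) •
      chartRep (𝓡∂ (d + 1)) σ x (bdryIncl z) (fun i => EuclideanSpace.single i.succ 1)

end Integration

/-! ### The transgression Lagrangian and its Noether currents

Throughout `n = m + 1`, the polynomial `P = ⟨⋯⟩` has degree `n + 1 = m + 2`, and the dimension of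
the base manifold is `2 n + 1 = 2 m + 3`. -/

section Noether

variable {E : Type*} [NormedAddCommGroup E] [NormedSpace ℝ E]
variable {H : Type*} [TopologicalSpace H] (I : ModelWithCorners ℝ E H)
variable {M : Type*} [TopologicalSpace M] [ChartedSpace H M]
variable {𝔤 : Type*} [NormedAddCommGroup 𝔤] [NormedSpace ℝ 𝔤] [FiniteDimensional ℝ 𝔤]
  [NormedLieAlg 𝔤]
variable {V : Type*} [NormedAddCommGroup V] [NormedSpace ℝ V]

/-- The curvature `F = dA + A²`, where `A² = ½ [A, A]`. -/
def curvature (A : M → E [⋀^Fin 1]→L[ℝ] 𝔤) (x : M) : E [⋀^Fin 2]→L[ℝ] 𝔤 :=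
  extD I A x + (1 / 2 : ℝ) • lieWedge (by norm_num) (A x) (A x)

/-- The covariant derivative `D_A λ = dλ + [A, λ]` of a `𝔤`-valued function. -/
def covD (A : M → E [⋀^Fin 1]→L[ℝ] 𝔤) (l : M → 𝔤) (x : M) : E [⋀^Fin 1]→L[ℝ] 𝔤 :=
  extD I (zeroForm l) x + lieWedge (by norm_num) (A x) (zeroForm l x)

/-- `A_t = Ā + t (A - Ā)`. -/
def interp (A Ab : M → E [⋀^Fin 1]→L[ℝ] 𝔤) (t : ℝ) : M → E [⋀^Fin 1]→L[ℝ] 𝔤 :=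
  Ab + t • (A - Ab)

variable {m : ℕ} (k : ℝ) (P : ContinuousMultilinearMap ℝ (fun _ : Fin (m + 2) => 𝔤) V)

/-- The transgression Lagrangian `L_T = k (n+1) ∫₀¹ dt ⟨Θ F_t^n⟩`, `Θ = A - Ā`. -/
def lagrangian (A Ab : M → E [⋀^Fin 1]→L[ℝ] 𝔤) (x : M) : E [⋀^Fin (2 * m + 1 + 1 + 1)]→L[ℝ] V :=
  (k * (m + 2)) • ∫ t in (0 : ℝ)..1,
    angle P (by omega) ((A - Ab) x) (curvature I (interp A Ab t) x) (curvature I (interp A Ab t) x)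

/-- The Euler–Lagrange term `E_A δφ^A = k (n+1) (⟨δA F^n⟩ - ⟨δĀ F̄^n⟩)` of the variation. -/
def eulerLagrange (A Ab a ab : M → E [⋀^Fin 1]→L[ℝ] 𝔤) (x : M) :
    E [⋀^Fin (2 * m + 1 + 1 + 1)]→L[ℝ] V :=
  (k * (m + 2)) • (angle P (by omega) (a x) (curvature I A x) (curvature I A x)
    - angle P (by omega) (ab x) (curvature I Ab x) (curvature I Ab x))

/-- The boundary term `B_A δφ^A = k n (n+1) ∫₀¹ dt ⟨δA_t Θ F_t^{n-1}⟩` of the variation. -/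
def boundaryTerm (A Ab a ab : M → E [⋀^Fin 1]→L[ℝ] 𝔤) (x : M) :
    E [⋀^Fin (2 * m + 1 + 1)]→L[ℝ] V :=
  (k * (m + 1) * (m + 2)) • ∫ t in (0 : ℝ)..1,
    angle P (by omega) (interp a ab t x) ((A - Ab) x) (curvature I (interp A Ab t) x)

/-- The on-shell gauge current `*J = B_A ε^A` with `ε = (D_A λ, D_Ā λ)`. -/
def gaugeOn (A Ab : M → E [⋀^Fin 1]→L[ℝ] 𝔤) (l : M → 𝔤) :
    M → E [⋀^Fin (2 * m + 1 + 1)]→L[ℝ] V :=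
  boundaryTerm I k P A Ab (covD I A l) (covD I Ab l)

/-- The correction `Y = k (n+1) (⟨λ F^n⟩ - ⟨λ F̄^n⟩)`. -/
def gaugeCorrection (A Ab : M → E [⋀^Fin 1]→L[ℝ] 𝔤) (l : M → 𝔤) (x : M) :
    E [⋀^Fin (2 * m + 1 + 1)]→L[ℝ] V :=
  (k * (m + 2)) • (angle P (by omega) (zeroForm l x) (curvature I A x) (curvature I A x)
    - angle P (by omega) (zeroForm l x) (curvature I Ab x) (curvature I Ab x))

/-- The off-shell gauge current `*J_gauge`, i.e. the on-shell one plus `Y`. -/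
def gaugeOff (A Ab : M → E [⋀^Fin 1]→L[ℝ] 𝔤) (l : M → 𝔤) :
    M → E [⋀^Fin (2 * m + 1 + 1)]→L[ℝ] V :=
  gaugeOn I k P A Ab l + gaugeCorrection I k P A Ab l

/-- `∫₀¹ dt ⟨λ Θ F_t^{n-1}⟩`. -/
def gaugePotential (A Ab : M → E [⋀^Fin 1]→L[ℝ] 𝔤) (l : M → 𝔤) (x : M) :
    E [⋀^Fin (2 * m + 1)]→L[ℝ] V :=
  ∫ t in (0 : ℝ)..1,
    angle P (by omega) (zeroForm l x) ((A - Ab) x) (curvature I (interp A Ab t) x)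

/-- The on-shell diffeomorphism current `*J = B_A £_ξ φ^A - I_ξ L`. -/
def difOn (A Ab : M → E [⋀^Fin 1]→L[ℝ] 𝔤) (ξ : ∀ x : M, TangentSpace I x) :
    M → E [⋀^Fin (2 * m + 1 + 1)]→L[ℝ] V :=
  boundaryTerm I k P A Ab (lieD I ξ A) (lieD I ξ Ab) - contract I ξ (lagrangian I k P A Ab)

/-- The correction `X = k (n+1) (⟨I_ξ A F^n⟩ - ⟨I_ξ Ā F̄^n⟩)`. -/
def difCorrection (A Ab : M → E [⋀^Fin 1]→L[ℝ] 𝔤) (ξ : ∀ x : M, TangentSpace I x) (x : M) :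
    E [⋀^Fin (2 * m + 1 + 1)]→L[ℝ] V :=
  (k * (m + 2)) • (angle P (by omega) (contract I ξ A x) (curvature I A x) (curvature I A x)
    - angle P (by omega) (contract I ξ Ab x) (curvature I Ab x) (curvature I Ab x))

/-- The off-shell diffeomorphism current `*J_dif`, i.e. the on-shell one plus `X`. -/
def difOff (A Ab : M → E [⋀^Fin 1]→L[ℝ] 𝔤) (ξ : ∀ x : M, TangentSpace I x) :
    M → E [⋀^Fin (2 * m + 1 + 1)]→L[ℝ] V :=
  difOn I k P A Ab ξ + difCorrection I k P A Ab ξ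

/-- `∫₀¹ dt ⟨I_ξ A_t Θ F_t^{n-1}⟩`. -/
def difPotential (A Ab : M → E [⋀^Fin 1]→L[ℝ] 𝔤) (ξ : ∀ x : M, TangentSpace I x) (x : M) :
    E [⋀^Fin (2 * m + 1)]→L[ℝ] V :=
  ∫ t in (0 : ℝ)..1,
    angle P (by omega) (contract I ξ (interp A Ab t) x) ((A - Ab) x)
      (curvature I (interp A Ab t) x)

/-- The charge `Q = ∫_S ι^* *J` of a current `*J` along a spatial section `ι : S → M`. -/
def charge {S : Type*} [TopologicalSpace S] [ChartedSpace (EuclideanHalfSpace (2 * m + 1 + 1)) S]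
    [IsManifold (𝓡∂ (2 * m + 1 + 1)) ∞ S] [T2Space S] [CompactSpace S] (ι : S → M)
    (J : M → E [⋀^Fin (2 * m + 1 + 1)]→L[ℝ] V) : V :=
  integrate (pullback I (𝓡∂ (2 * m + 1 + 1)) ι J)

end Noether

end Transgression

end

/-! Let n = m + 1 and let D_t be the covariant derivative of A_t. One identity,
`smul_extD_integral_angle`, carries the variation and both currents. Let z_t be a family of p-forms
with t-derivative ζ_t. Invariance of P and the Bianchi identity give d⟨z_t Θ F_t^{n-1}⟩ = ⟨D_t z_t Θ
F_t^{n-1}⟩ + (-1)^p ⟨z_t D_tΘ F_t^{n-1}⟩ (`extD_angle`). Since ∂_t F_t = D_tΘ, symmetry of P gives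
n⟨z_t D_tΘ F_t^{n-1}⟩ = ∂_t⟨z_t F_t^n⟩ - ⟨ζ_t F_t^n⟩ (`integral_transgression`). Integrating over
[0,1] and eliminating the D_tΘ term leaves only end-point terms and an integral of ⟨ζ_t F_t^n⟩.

The choice z_t = δA_t yields the variation, because δF_t = D_t δA_t. The choice z_t = λ yields the
gauge current: D_{A_t}λ interpolates between D_Āλ and D_Aλ, and ζ_t = 0. The choice z_t = I_ξA_t
yields the diffeomorphism current: by Cartan's formula £_ξA_t = D_t I_ξA_t + I_ξF_t, and the I_ξF_t
terms of B and of I_ξL_T cancel. The corrected currents are therefore exact, hence closed. The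
dimension enters only in E(£_ξA, £_ξĀ) = dX and its consequences: ⟨F^{n+1}⟩ has degree 2n+2 > dim M,
and contracting it gives ⟨I_ξF F^n⟩ = 0 (`angle_lieD`). The Noether identities for the on-shell
currents are then read off from the corrected ones.

At a point, the algebra rests on one permutation argument, `sum_neg_one_pow_smul_polyForm`:
alternatizing a form-valued linear map in one slot of ⟨⋯⟩ alternatizes that slot, up to the sign of
moving past the earlier slots. It gives Leibniz rules, brackets with 1-forms and wedges with linear
forms alike. Contraction is reduced to it by viewing θ ∧ I_ξ as an infinitesimal pullback.

All families in play are finite sums ∑ f_i(s) g_i(t) c_i of fixed smooth forms (`IsSeparable`), so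
exchanging the t-integral with d, I_ξ or d/ds, or d/ds with the integral over S, is finite
linearity.

The charges are boundary integrals by Stokes' theorem (`integrate_extD`), obtained from the
divergence theorem on a box and a partition of unity. Under a gauge transformation δΘ = -[η,Θ] and
δF_t = -[η,F_t]; invariance then transfers the whole variation to the first slot, where it leaves
[η,λ] for λ and £_ξη for I_ξA_t (`hasDerivAt_potential`). -/

noncomputable section

namespace Transgression

section
-- Signed sums over permutations with one distinguished letter.
section Permutations

variable {V : Type*} [AddCommGroup V] [Module ℝ V]

/-- Reindexing by right multiplication with the inverse of `q.cycleRange` brings position `q` to the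
front and keeps the others in order; this cycle has sign (-1)^q. -/
theorem sum_perm_succAbove {X : Type*} {n : ℕ} (u : Fin (n + 1) → X) (g : X → (Fin n → X) → V)
    (q : Fin (n + 1)) :
    ∑ σ : Equiv.Perm (Fin (n + 1)), Equiv.Perm.sign σ • g (u (σ q)) (fun j => u (σ (q.succAbove j)))
      = (-1 : ℝ) ^ (q : ℕ) • ∑ σ : Equiv.Perm (Fin (n + 1)),
          Equiv.Perm.sign σ • g (u (σ 0)) (fun j => u (σ j.succ)) := by
  rw [Finset.smul_sum]
  refine Fintype.sum_equiv (Equiv.mulRight q.cycleRange⁻¹) _ _ fun σ => ?_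
  have h0 : (q.cycleRange⁻¹ : Equiv.Perm _) 0 = q := Fin.cycleRange_symm_zero q
  have h1 : ∀ j, (q.cycleRange⁻¹ : Equiv.Perm _) (Fin.succ j) = q.succAbove j :=
    fun j => Fin.cycleRange_symm_succ q j
  simp only [Equiv.coe_mulRight, Equiv.Perm.coe_mul, Function.comp_apply, h0, h1,
    Equiv.Perm.sign_mul, Equiv.Perm.sign_inv, Fin.sign_cycleRange]
  rcases Nat.even_or_odd (q : ℕ) with hq | hq <;> simp [hq.neg_one_pow]

/-- A permutation of n + 1 letters amounts to the image `q` of 0 and a permutation `τ` of the rest;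
its sign is (-1)^q sign τ. -/
theorem sum_perm_removeNth {X : Type*} {n : ℕ} (u : Fin (n + 1) → X) (g : X → (Fin n → X) → V) :
    ∑ q : Fin (n + 1), (-1 : ℝ) ^ (q : ℕ) • ∑ τ : Equiv.Perm (Fin n),
        Equiv.Perm.sign τ • g (u q) (fun j => q.removeNth u (τ j))
      = ∑ σ : Equiv.Perm (Fin (n + 1)),
          Equiv.Perm.sign σ • g (u (σ 0)) (fun j => u (σ j.succ)) := by
  simp_rw [Finset.smul_sum]
  rw [← Fintype.sum_prod_type']
  let f : Fin (n + 1) × Equiv.Perm (Fin n) → Equiv.Perm (Fin (n + 1)) :=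
    fun p => p.1.cycleRange⁻¹ * Equiv.Perm.decomposeFin.symm (0, p.2)
  have f0 : ∀ p, f p 0 = p.1 := by
    intro p
    simp only [f, Equiv.Perm.coe_mul, Function.comp_apply, Equiv.Perm.decomposeFin_symm_apply_zero]
    exact Fin.cycleRange_symm_zero _
  have f1 : ∀ p j, f p (Fin.succ j) = p.1.succAbove (p.2 j) := by
    intro p j
    simp only [f, Equiv.Perm.coe_mul, Function.comp_apply, Equiv.Perm.decomposeFin_symm_apply_succ,
      Equiv.swap_self, Equiv.refl_apply]
    exact Fin.cycleRange_symm_succ _ _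
  have hf : Function.Bijective f := by
    rw [Fintype.bijective_iff_injective_and_card]
    refine ⟨fun p p' h => ?_, ?_⟩
    · have h0 : p.1 = p'.1 := by rw [← f0, ← f0, h]
      refine Prod.ext h0 (Equiv.ext fun j => ?_)
      have := congrArg (fun σ => σ (Fin.succ j)) h
      simp only [f1, h0] at this
      exact Fin.succAbove_right_injective this
    · simp [Fintype.card_perm, Nat.factorial_succ]
  refine Fintype.sum_bijective f hf _ _ fun p => ?_
  have hs : Equiv.Perm.sign (f p) = (-1) ^ (p.1 : ℕ) * Equiv.Perm.sign p.2 := by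
    simp [f, Fin.sign_cycleRange, Equiv.Perm.decomposeFin.symm_sign]
  simp only [f0, f1, hs, Fin.removeNth]
  rcases Nat.even_or_odd (p.1 : ℕ) with hq | hq <;> simp [hq.neg_one_pow]

end Permutations

/-! ### Blocks of arguments and alternatization in one slot of `polyForm`. -/

section PolyForm

variable {E : Type*} [NormedAddCommGroup E] [NormedSpace ℝ E]
variable {𝔤 : Type*} [NormedAddCommGroup 𝔤] [NormedSpace ℝ 𝔤]
variable {V : Type*} [NormedAddCommGroup V] [NormedSpace ℝ V]
variable {r N : ℕ} {d : Fin r → ℕ}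

/-- The total degree of the blocks that precede block `i`. -/
def blockStart (d : Fin r → ℕ) (i : Fin r) : ℕ := ∑ j, if j < i then d j else 0

/-- The position of the `j`-th argument of block `i` among all arguments. -/
def blockPos (h : ∑ i, d i = N) (i : Fin r) (j : Fin (d i)) : Fin N :=
  finCongr h (finSigmaFinEquiv ⟨i, j⟩)

theorem val_blockPos (h : ∑ i, d i = N) (i : Fin r) (j : Fin (d i)) :
    (blockPos h i j : ℕ) = blockStart d i + j := by
  simp only [blockPos, finCongr_apply, Fin.val_cast, finSigmaFinEquiv_apply, blockStart]
  congr 1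
  rw [← Finset.sum_filter]
  refine Finset.sum_bij (fun a _ => Fin.castLE i.2.le a) ?_ ?_ ?_ ?_
  · intro a _
    simpa using Fin.lt_def.2 a.2
  · intro a _ b _ hab
    simpa [Fin.ext_iff] using hab
  · intro b hb
    simp only [Finset.mem_filter, Finset.mem_univ, true_and] at hb
    exact ⟨⟨b, hb⟩, Finset.mem_univ _, rfl⟩
  · intro a _
    rfl

theorem polyForm_apply (P : ContinuousMultilinearMap ℝ (fun _ : Fin r => 𝔤) V)
    (h : ∑ i, d i = N) (Z : ∀ i, E [⋀^Fin (d i)]→L[ℝ] 𝔤) (v : Fin N → E) :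
    polyForm P h Z v = ((∏ i, ((d i).factorial : ℝ))⁻¹) •
      ∑ σ : Equiv.Perm (Fin N), Equiv.Perm.sign σ •
        P (fun i => Z i (fun j => v (σ (blockPos h i j)))) := by
  rw [polyForm, ContinuousAlternatingMap.smul_apply,
    ContinuousMultilinearMap.alternatization_apply_apply]
  rfl

theorem blockStart_add_le {i j : Fin r} (hij : i < j) :
    blockStart d i + d i ≤ blockStart d j := by
  have : blockStart d i + d i = ∑ k, if k ≤ i then d k else 0 := by
    have h1 : ∀ k, (if k ≤ i then d k else 0) = (if k < i then d k else 0)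
        + (if k = i then d k else 0) := by
      intro k
      rcases lt_trichotomy k i with h | h | h
      · simp [h, h.le, h.ne]
      · simp [h]
      · simp [h.not_ge, h.not_gt, h.ne']
    simp [blockStart, h1, Finset.sum_add_distrib]
  rw [this, blockStart]
  refine Finset.sum_le_sum fun k _ => ?_
  by_cases hk : k ≤ i
  · simp [hk, hk.trans_lt hij]
  · simp [hk]

theorem blockStart_of_le {d' : Fin r → ℕ} {i : Fin r} (hj : ∀ j, j ≠ i → d' j = d j) {j : Fin r}
    (hji : j ≤ i) : blockStart d' j = blockStart d j := by
  refine Finset.sum_congr rfl fun k _ => ?_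
  by_cases hk : k < j
  · simp [hk, hj k (hk.trans_le hji).ne]
  · simp [hk]

theorem blockStart_of_lt {d' : Fin r → ℕ} {i : Fin r} (hi : d' i = d i + 1)
    (hj : ∀ j, j ≠ i → d' j = d j) {j : Fin r} (hij : i < j) :
    blockStart d' j = blockStart d j + 1 := by
  have h1 : ∀ k, (if k < j then d' k else 0) = (if k < j then d k else 0)
      + (if k = i then 1 else 0) := by
    intro k
    by_cases hk : k = i
    · subst hk; simp [hij, hi]
    · simp [hk, hj k hk]
  simp [blockStart, h1, Finset.sum_add_distrib]

/-- Alternatizing in a vector on which one of the forms depends linearly. -/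
theorem sum_neg_one_pow_smul_polyForm (P : ContinuousMultilinearMap ℝ (fun _ : Fin r => 𝔤) V)
    {d' : Fin r → ℕ} (h : ∑ i, d i = N) (h' : ∑ i, d' i = N + 1) (i : Fin r)
    (Z : E → ∀ j, E [⋀^Fin (d j)]→L[ℝ] 𝔤) (Z' : ∀ j, E [⋀^Fin (d' j)]→L[ℝ] 𝔤)
    (hi : d' i = d i + 1)
    (hZi : ∀ w : Fin (d i + 1) → E, Z' i (w ∘ Fin.cast hi)
      = ∑ l : Fin (d i + 1), (-1 : ℝ) ^ (l : ℕ) • Z (w l) i (l.removeNth w))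
    (hj : ∀ j, j ≠ i → d' j = d j)
    (hZj : ∀ j (hji : j ≠ i) (v : E) (w : Fin (d j) → E),
      Z' j (w ∘ Fin.cast (hj j hji)) = Z v j w)
    (u : Fin (N + 1) → E) :
    ∑ q : Fin (N + 1), (-1 : ℝ) ^ (q : ℕ) • polyForm P h (Z (u q)) (q.removeNth u)
      = (-1 : ℝ) ^ blockStart d i • polyForm P h' Z' u := by
  classical
  -- Both sides turn out to be multiples of the sum `S` in which the distinguished vector stands
  -- first.
  set g : E → (Fin N → E) → V := fun v w => P (fun j => Z v j (fun x => w (blockPos h j x))) with hg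
  set S : V := ∑ σ : Equiv.Perm (Fin (N + 1)),
          Equiv.Perm.sign σ • g (u (σ 0)) (fun j => u (σ j.succ)) with hS
  have hprod : ∏ j, ((d' j).factorial : ℝ) = (d i + 1) * ∏ j, ((d j).factorial : ℝ) := by
    rw [← Finset.mul_prod_erase _ _ (Finset.mem_univ i),
      ← Finset.mul_prod_erase (a := i) _ (fun j => ((d j).factorial : ℝ)) (Finset.mem_univ i), hi,
      Nat.factorial_succ]
    rw [Finset.prod_congr rfl fun j hj' => by rw [hj j (Finset.ne_of_mem_erase hj')]]
    push_cast
    ring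
  have hl : ∑ q : Fin (N + 1), (-1 : ℝ) ^ (q : ℕ) • polyForm P h (Z (u q)) (q.removeNth u)
      = (∏ j, ((d j).factorial : ℝ))⁻¹ • S := by
    rw [hS, ← sum_perm_removeNth u g, Finset.smul_sum]
    refine Finset.sum_congr rfl fun q _ => ?_
    rw [polyForm_apply, smul_comm]
  -- Expanding block `i` of `Z'` selects which of its `d i + 1` arguments is the distinguished one;
  -- once that position is deleted, the remaining positions are exactly the blocks of the degrees
  -- `d`.
  have key : ∀ σ : Equiv.Perm (Fin (N + 1)),
      P (fun j => Z' j (fun x => u (σ (blockPos h' j x)))) =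
        ∑ l : Fin (d i + 1), (-1 : ℝ) ^ (l : ℕ) •
          g (u (σ (blockPos h' i (Fin.cast hi.symm l))))
            (fun j => u (σ ((blockPos h' i (Fin.cast hi.symm l)).succAbove j))) := by
    intro σ
    have e1 : (fun j => Z' j (fun x => u (σ (blockPos h' j x)))) =
        Function.update (fun j => Z' j (fun x => u (σ (blockPos h' j x)))) i
          (∑ l : Fin (d i + 1), (-1 : ℝ) ^ (l : ℕ) • Z (u (σ (blockPos h' i (Fin.cast hi.symm l)))) i
            (fun x => u (σ (blockPos h' i (Fin.cast hi.symm (l.succAbove x)))))) := by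
      rw [eq_comm, Function.update_eq_self_iff]
      exact (hZi (fun l => u (σ (blockPos h' i (Fin.cast hi.symm l))))).symm
    rw [e1]
    refine (P.toMultilinearMap.map_update_sum _ _ _ _).trans ?_
    refine Finset.sum_congr rfl fun l _ => ?_
    refine (P.map_update_smul _ _ _ _).trans ?_
    congr 2
    funext j
    by_cases hji : j = i
    · subst hji
      rw [Function.update_self]
      congr 1
      funext x
      congr 2
      apply Fin.ext
      have e2 : (blockPos h' j (Fin.cast hi.symm (l.succAbove x)) : ℕ)
          = blockStart d j + (l.succAbove x : ℕ) := by
        rw [val_blockPos, blockStart_of_le hj le_rfl]; rfl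
      have e3 : (blockPos h' j (Fin.cast hi.symm l) : ℕ) = blockStart d j + l := by
        rw [val_blockPos, blockStart_of_le hj le_rfl]; rfl
      have e4 := val_blockPos h j x
      rw [e2]
      simp only [Fin.succAbove, Fin.lt_def, Fin.val_castSucc, e3, e4]
      split_ifs <;> simp [e4] <;> omega
    · rw [Function.update_of_ne hji]
      rw [← hZj j hji]
      congr 1
      funext x
      simp only [Function.comp_apply]
      congr 2
      apply Fin.ext
      have e3 : (blockPos h' i (Fin.cast hi.symm l) : ℕ) = blockStart d i + l := by
        rw [val_blockPos, blockStart_of_le hj le_rfl]; rfl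
      have e4 := val_blockPos h j (Fin.cast (hj j hji) x)
      have hx := (Fin.cast (hj j hji) x).2
      have hl := l.2
      rcases lt_or_gt_of_ne hji with hlt | hgt
      · have e2 := val_blockPos h' j x
        rw [blockStart_of_le hj hlt.le] at e2
        have := blockStart_add_le (d := d) hlt
        simp only [Fin.succAbove, Fin.lt_def, Fin.val_castSucc, e3, e4, e2]
        rw [if_pos (by omega)]
        simp [e4]
      · have e2 := val_blockPos h' j x
        rw [blockStart_of_lt hi hj hgt] at e2
        have := blockStart_add_le (d := d) hgt
        simp only [Fin.succAbove, Fin.lt_def, Fin.val_castSucc, e3, e4, e2]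
        rw [if_neg (by omega)]
        simp [e4]; omega
  have hr : polyForm P h' Z' u = (∏ j, ((d' j).factorial : ℝ))⁻¹ •
      ((d i + 1 : ℝ) • (-1 : ℝ) ^ blockStart d i • S) := by
    rw [polyForm_apply]
    congr 1
    simp_rw [key, Finset.smul_sum]
    rw [Finset.sum_comm]
    -- Moving position `blockStart d i + l` to the front costs that power of -1, and its `l` part
    -- cancels the (-1)^l of the expansion. Hence all choices of `l` contribute equally.
    have : ∀ l : Fin (d i + 1), ∑ σ : Equiv.Perm (Fin (N + 1)), Equiv.Perm.sign σ •
        (-1 : ℝ) ^ (l : ℕ) • g (u (σ (blockPos h' i (Fin.cast hi.symm l))))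
            (fun j => u (σ ((blockPos h' i (Fin.cast hi.symm l)).succAbove j)))
        = (-1 : ℝ) ^ blockStart d i • S := by
      intro l
      simp_rw [smul_comm _ ((-1 : ℝ) ^ (l : ℕ))]
      rw [← Finset.smul_sum, sum_perm_succAbove, smul_smul, ← pow_add, val_blockPos,
        blockStart_of_le hj le_rfl, Fin.val_cast]
      congr 1
      rw [show (l : ℕ) + (blockStart d i + l) = blockStart d i + 2 * l by ring, pow_add, pow_mul]
      simp
    rw [Finset.sum_congr rfl fun l _ => this l]
    simp [← Nat.cast_smul_eq_nsmul ℝ]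
  -- The `d i + 1` equal contributions are absorbed by the normalization, as (d_i + 1)! = (d_i + 1)
  -- d_i!.
  rw [hl, hr, hprod, smul_smul, smul_smul, smul_smul]
  congr 1
  have h1 : (d i + 1 : ℝ) ≠ 0 := by positivity
  have h3 : ((-1 : ℝ) ^ blockStart d i) * (-1 : ℝ) ^ blockStart d i = 1 := by
    rw [← pow_add, ← two_mul, pow_mul]; simp
  have h2 : (∏ j, ((d j).factorial : ℝ)) ≠ 0 :=
    Finset.prod_ne_zero_iff.2 fun j _ => by positivity
  field_simp
  rw [sq, h3]

end PolyForm

end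

section
open ContinuousAlternatingMap

/-! ### `polyForm` as a continuous multilinear map; naturality and exchange of 2-forms. -/

section Multilinear

variable {E : Type*} [NormedAddCommGroup E] [NormedSpace ℝ E]
variable {𝔤 : Type*} [NormedAddCommGroup 𝔤] [NormedSpace ℝ 𝔤]
variable {V : Type*} [NormedAddCommGroup V] [NormedSpace ℝ V]
variable {r N : ℕ} {d : Fin r → ℕ}

theorem apply_update_form (Z : ∀ i, E [⋀^Fin (d i)]→L[ℝ] 𝔤) (i : Fin r)
    (z : E [⋀^Fin (d i)]→L[ℝ] 𝔤) (w : ∀ i, Fin (d i) → E) :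
    (fun j => Function.update Z i z j (w j))
      = Function.update (fun j => Z j (w j)) i (z (w i)) := by
  funext j
  exact Function.apply_update (fun j (y : E [⋀^Fin (d j)]→L[ℝ] 𝔤) => y (w j)) Z i z j

/-- `polyForm` as a continuous multilinear map of the forms. -/
def polyFormCMM (P : ContinuousMultilinearMap ℝ (fun _ : Fin r => 𝔤) V) (h : ∑ i, d i = N) :
    ContinuousMultilinearMap ℝ (fun i => E [⋀^Fin (d i)]→L[ℝ] 𝔤) (E [⋀^Fin N]→L[ℝ] V) :=
  MultilinearMap.mkContinuous
    { toFun := polyForm P h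
      map_update_add' := by
        intro inst Z i x y
        -- The field quantifies over every decidable equality on the index type; it is replaced by
        -- the canonical one so that `Function.update` matches `apply_update_form`.
        obtain rfl := Subsingleton.elim inst (instDecidableEqFin r)
        ext v
        simp only [polyForm_apply, ContinuousAlternatingMap.add_apply, apply_update_form,
          P.map_update_add, smul_add, Finset.sum_add_distrib]
      map_update_smul' := by
        intro inst Z i c x
        obtain rfl := Subsingleton.elim inst (instDecidableEqFin r)
        ext v
        simp only [polyForm_apply, ContinuousAlternatingMap.smul_apply, apply_update_form,
          P.map_update_smul, Finset.smul_sum]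
        refine Finset.sum_congr rfl fun σ _ => ?_
        rw [smul_comm _ c, smul_comm _ c] }
    -- Triangle inequality over the N! permutations; any finite bound would do.
    ((∏ i, ((d i).factorial : ℝ))⁻¹ * (Fintype.card (Equiv.Perm (Fin N)) * ‖P‖)) (by
      intro Z
      refine opNorm_le_bound _ (by positivity) fun v => ?_
      change ‖polyForm P h Z v‖ ≤ _
      rw [polyForm_apply, norm_smul, Real.norm_of_nonneg (by positivity)]
      rw [mul_assoc, mul_assoc]
      refine mul_le_mul_of_nonneg_left ?_ (by positivity)
      have : ∀ σ : Equiv.Perm (Fin N), ‖Equiv.Perm.sign σ •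
          P (fun i => Z i (fun j => v (σ (blockPos h i j))))‖
          ≤ ‖P‖ * ((∏ i, ‖Z i‖) * ∏ i, ‖v i‖) := by
        intro σ
        have h1 : ‖Equiv.Perm.sign σ • P (fun i => Z i (fun j => v (σ (blockPos h i j))))‖
            = ‖P (fun i => Z i (fun j => v (σ (blockPos h i j))))‖ := by
          rcases Int.units_eq_one_or (Equiv.Perm.sign σ) with h | h <;> simp [h]
        rw [h1]
        refine (P.le_opNorm _).trans (mul_le_mul_of_nonneg_left ?_ (norm_nonneg _))
        have h2 : ∏ i, ‖v i‖ = ∏ i, ∏ j, ‖v (σ (blockPos h i j))‖ := by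
          rw [← Fintype.prod_sigma']
          exact (Fintype.prod_equiv ((finSigmaFinEquiv.trans (finCongr h)).trans σ) _ _
            fun x => rfl).symm
        rw [h2, ← Finset.prod_mul_distrib]
        exact Finset.prod_le_prod (fun _ _ => norm_nonneg _) fun i _ => (Z i).le_opNorm _
      refine (norm_sum_le _ _).trans ((Finset.sum_le_sum fun σ _ => this σ).trans ?_)
      simp [Finset.card_univ, mul_assoc])

@[simp]
theorem polyFormCMM_apply (P : ContinuousMultilinearMap ℝ (fun _ : Fin r => 𝔤) V)
    (h : ∑ i, d i = N) (Z : ∀ i, E [⋀^Fin (d i)]→L[ℝ] 𝔤) :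
    polyFormCMM P h Z = polyForm P h Z := rfl

theorem polyForm_compContinuousLinearMap {E' : Type*} [NormedAddCommGroup E'] [NormedSpace ℝ E']
    (P : ContinuousMultilinearMap ℝ (fun _ : Fin r => 𝔤) V) (h : ∑ i, d i = N)
    (Z : ∀ i, E [⋀^Fin (d i)]→L[ℝ] 𝔤) (L : E' →L[ℝ] E) :
    (polyForm P h Z).compContinuousLinearMap L
      = polyForm P h (fun i => (Z i).compContinuousLinearMap L) := by
  ext v
  simp only [compContinuousLinearMap_apply, polyForm_apply]
  rfl

/-- Two blocks of degree two commute in `⟨⋯⟩`. -/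
theorem polyForm_swap_two {P : ContinuousMultilinearMap ℝ (fun _ : Fin r => 𝔤) V}
    (hP : ∀ (σ : Equiv.Perm (Fin r)) (z : Fin r → 𝔤), P (z ∘ σ) = P z)
    (h : ∑ i, d i = N) {i j : Fin r} (hij : i ≠ j) (hi : d i = 2) (hj : d j = 2)
    (Z Z' : ∀ k, E [⋀^Fin (d k)]→L[ℝ] 𝔤)
    (hZi : ∀ w : Fin 2 → E, Z' i (w ∘ Fin.cast hi) = Z j (w ∘ Fin.cast hj))
    (hZj : ∀ w : Fin 2 → E, Z' j (w ∘ Fin.cast hj) = Z i (w ∘ Fin.cast hi))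
    (hZ : ∀ k, k ≠ i → k ≠ j → Z' k = Z k) :
    polyForm P h Z' = polyForm P h Z := by
  ext v
  rw [polyForm_apply, polyForm_apply]
  congr 1
  let p : Fin 2 → Fin N := fun x => blockPos h i (Fin.cast hi.symm x)
  let q : Fin 2 → Fin N := fun x => blockPos h j (Fin.cast hj.symm x)
  have inj : ∀ k l x y, k ≠ l → blockPos h k x ≠ blockPos h l y := by
    intro k l x y hkl e
    have := (finSigmaFinEquiv.trans (finCongr h)).injective
      (a₁ := ⟨k, x⟩) (a₂ := ⟨l, y⟩) e
    exact hkl (congrArg Sigma.fst this)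
  have hp : ∀ x y, p x = p y → x = y := by
    intro x y e
    have := congrArg Fin.val e
    simp only [p, val_blockPos, Fin.val_cast] at this
    exact Fin.ext (by omega)
  have hq : ∀ x y, q x = q y → x = y := by
    intro x y e
    have := congrArg Fin.val e
    simp only [q, val_blockPos, Fin.val_cast] at this
    exact Fin.ext (by omega)
  have hpq : ∀ x y, p x ≠ q y := fun x y => inj _ _ _ _ hij
  -- The positions of the two blocks are exchanged pairwise. Degree two makes this a product of two
  -- transpositions, so it is even and no sign appears.
  let π : Equiv.Perm (Fin N) := Equiv.swap (p 0) (q 0) * Equiv.swap (p 1) (q 1)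
  have h01 : p 0 ≠ p 1 := fun e => by simpa using hp _ _ e
  have h01' : q 0 ≠ q 1 := fun e => by simpa using hq _ _ e
  have πp : ∀ x, π (p x) = q x := by
    intro x
    fin_cases x
    · simp only [π, Equiv.Perm.coe_mul, Function.comp_apply, Fin.zero_eta]
      rw [Equiv.swap_apply_of_ne_of_ne h01 (hpq _ _), Equiv.swap_apply_left]
    · simp only [π, Equiv.Perm.coe_mul, Function.comp_apply, Fin.mk_one]
      rw [Equiv.swap_apply_left, Equiv.swap_apply_of_ne_of_ne (hpq _ _).symm h01'.symm]
  have πq : ∀ x, π (q x) = p x := by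
    intro x
    fin_cases x
    · simp only [π, Equiv.Perm.coe_mul, Function.comp_apply, Fin.zero_eta]
      rw [Equiv.swap_apply_of_ne_of_ne (hpq _ _).symm h01', Equiv.swap_apply_right]
    · simp only [π, Equiv.Perm.coe_mul, Function.comp_apply, Fin.mk_one]
      rw [Equiv.swap_apply_right, Equiv.swap_apply_of_ne_of_ne h01.symm (hpq _ _)]
  have πk : ∀ k x, k ≠ i → k ≠ j → π (blockPos h k x) = blockPos h k x := by
    intro k x hki hkj
    simp only [π, Equiv.Perm.coe_mul, Function.comp_apply]
    rw [Equiv.swap_apply_of_ne_of_ne (inj _ _ _ _ hki) (inj _ _ _ _ hkj),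
      Equiv.swap_apply_of_ne_of_ne (inj _ _ _ _ hki) (inj _ _ _ _ hkj)]
  have hsign : Equiv.Perm.sign π = 1 := by
    simp only [π, Equiv.Perm.sign_mul, Equiv.Perm.sign_swap (hpq _ _)]
    rfl
  refine Fintype.sum_equiv (Equiv.mulRight π) _ _ fun σ => ?_
  simp only [Equiv.coe_mulRight, Equiv.Perm.sign_mul, hsign, mul_one, Equiv.Perm.coe_mul,
    Function.comp_apply]
  congr 1
  rw [← hP (Equiv.swap i j)]
  congr 1
  funext k
  simp only [Function.comp_apply]
  by_cases hki : k = i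
  · subst hki
    rw [Equiv.swap_apply_left]
    have e1 := hZj (fun x => v (σ (q x)))
    refine e1.trans ?_
    simp only [← πp]
    rfl
  by_cases hkj : k = j
  · subst hkj
    rw [Equiv.swap_apply_right]
    have e1 := hZi (fun x => v (σ (p x)))
    refine e1.trans ?_
    simp only [← πq]
    rfl
  rw [Equiv.swap_apply_of_ne_of_ne hki hkj, hZ k hki hkj]
  simp only [πk k _ hki hkj]

end Multilinear

/-! ### The product ⟨a b F^m⟩: its variations and derivatives. -/

section Angle

variable {E : Type*} [NormedAddCommGroup E] [NormedSpace ℝ E]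
variable {𝔤 : Type*} [NormedAddCommGroup 𝔤] [NormedSpace ℝ 𝔤]
variable {V : Type*} [NormedAddCommGroup V] [NormedSpace ℝ V]
variable {p q m N : ℕ} (P : ContinuousMultilinearMap ℝ (fun _ : Fin (m + 2) => 𝔤) V)

theorem update_triple_zero (a a' : E [⋀^Fin p]→L[ℝ] 𝔤) (b : E [⋀^Fin q]→L[ℝ] 𝔤)
    (F : E [⋀^Fin 2]→L[ℝ] 𝔤) :
    Function.update (triple m a b F) 0 a' = triple m a' b F := by
  refine funext (Fin.cases ?_ fun i => ?_)
  · exact Function.update_self _ _ _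
  · exact Function.update_of_ne (Fin.succ_ne_zero i) _ _

theorem update_triple_one (a : E [⋀^Fin p]→L[ℝ] 𝔤) (b b' : E [⋀^Fin q]→L[ℝ] 𝔤)
    (F : E [⋀^Fin 2]→L[ℝ] 𝔤) :
    Function.update (triple m a b F) (Fin.succ 0) b' = triple m a b' F := by
  refine funext (Fin.cases ?_ (Fin.cases ?_ fun i => ?_))
  · exact Function.update_of_ne (Fin.succ_ne_zero 0).symm _ _
  · exact Function.update_self _ _ _
  · exact Function.update_of_ne (fun h => Fin.succ_ne_zero i (Fin.succ_injective _ h)) _ _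

/-- `∑ⱼ ⟨a b F ⋯ F' ⋯ F⟩`, the derivative of `⟨a b F^m⟩` in `F` along `F'`. -/
def angleVar (h : p + q + 2 * m = N) (a : E [⋀^Fin p]→L[ℝ] 𝔤) (b : E [⋀^Fin q]→L[ℝ] 𝔤)
    (F F' : E [⋀^Fin 2]→L[ℝ] 𝔤) : E [⋀^Fin N]→L[ℝ] V :=
  ∑ j : Fin m, polyForm P (sum_degs h) (Function.update (triple m a b F) j.succ.succ F')

/-- The same splitting into first slot, second slot and the m remaining ones serves two purposes:
the total derivative of ⟨a b F^m⟩ and the infinitesimal invariance. -/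
theorem sum_polyForm_update_triple (h : p + q + 2 * m = N) (a a' : E [⋀^Fin p]→L[ℝ] 𝔤)
    (b b' : E [⋀^Fin q]→L[ℝ] 𝔤) (F F' : E [⋀^Fin 2]→L[ℝ] 𝔤) :
    ∑ i, polyForm P (sum_degs h) (Function.update (triple m a b F) i (triple m a' b' F' i))
      = angle P h a' b F + angle P h a b' F + angleVar P h a b F F' := by
  rw [Fin.sum_univ_succ, Fin.sum_univ_succ, ← add_assoc]
  congr 2
  · exact congrArg _ (update_triple_zero a a' b F)
  · exact congrArg _ (update_triple_one a b b' F)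

theorem angle_compContinuousLinearMap {E' : Type*} [NormedAddCommGroup E'] [NormedSpace ℝ E']
    (h : p + q + 2 * m = N) (a : E [⋀^Fin p]→L[ℝ] 𝔤) (b : E [⋀^Fin q]→L[ℝ] 𝔤)
    (F : E [⋀^Fin 2]→L[ℝ] 𝔤) (L : E' →L[ℝ] E) :
    (angle P h a b F).compContinuousLinearMap L
      = angle P h (a.compContinuousLinearMap L) (b.compContinuousLinearMap L)
          (F.compContinuousLinearMap L) := by
  rw [angle, polyForm_compContinuousLinearMap, angle]
  congr 1
  exact funext (Fin.cases rfl (Fin.cases rfl fun i => rfl))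

section Derivative

variable {G : Type*} [NormedAddCommGroup G] [NormedSpace ℝ G]

/-- The family `(a', b', F', …, F')` of derivatives. -/
def tripleCLM (m : ℕ) (a' : G →L[ℝ] E [⋀^Fin p]→L[ℝ] 𝔤) (b' : G →L[ℝ] E [⋀^Fin q]→L[ℝ] 𝔤)
    (F' : G →L[ℝ] E [⋀^Fin 2]→L[ℝ] 𝔤) (i : Fin (m + 2)) :
    G →L[ℝ] E [⋀^Fin (degs p q m i)]→L[ℝ] 𝔤 :=
  Fin.cases (motive := fun i => G →L[ℝ] E [⋀^Fin (degs p q m i)]→L[ℝ] 𝔤) a'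
    (fun j => Fin.cases (motive := fun j => G →L[ℝ] E [⋀^Fin (degs p q m j.succ)]→L[ℝ] 𝔤) b'
      (fun _ => F') j) i

theorem tripleCLM_apply (a' : G →L[ℝ] E [⋀^Fin p]→L[ℝ] 𝔤) (b' : G →L[ℝ] E [⋀^Fin q]→L[ℝ] 𝔤)
    (F' : G →L[ℝ] E [⋀^Fin 2]→L[ℝ] 𝔤) (i : Fin (m + 2)) (v : G) :
    tripleCLM m a' b' F' i v = triple m (a' v) (b' v) (F' v) i := by
  revert i
  exact Fin.cases rfl (Fin.cases rfl fun i => rfl)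

/-- The derivative of `⟨a b F^m⟩`. -/
def angleDeriv (h : p + q + 2 * m = N) (a : E [⋀^Fin p]→L[ℝ] 𝔤) (b : E [⋀^Fin q]→L[ℝ] 𝔤)
    (F : E [⋀^Fin 2]→L[ℝ] 𝔤)
    (a' : G →L[ℝ] E [⋀^Fin p]→L[ℝ] 𝔤) (b' : G →L[ℝ] E [⋀^Fin q]→L[ℝ] 𝔤)
    (F' : G →L[ℝ] E [⋀^Fin 2]→L[ℝ] 𝔤) : G →L[ℝ] E [⋀^Fin N]→L[ℝ] V :=
  ((polyFormCMM P (sum_degs h)).linearDeriv (triple m a b F)).comp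
    (ContinuousLinearMap.pi (tripleCLM m a' b' F'))

theorem angleDeriv_apply (h : p + q + 2 * m = N) (a : E [⋀^Fin p]→L[ℝ] 𝔤)
    (b : E [⋀^Fin q]→L[ℝ] 𝔤) (F : E [⋀^Fin 2]→L[ℝ] 𝔤)
    (a' : G →L[ℝ] E [⋀^Fin p]→L[ℝ] 𝔤) (b' : G →L[ℝ] E [⋀^Fin q]→L[ℝ] 𝔤)
    (F' : G →L[ℝ] E [⋀^Fin 2]→L[ℝ] 𝔤) (v : G) :
    angleDeriv P h a b F a' b' F' v
      = angle P h (a' v) b F + angle P h a (b' v) F + angleVar P h a b F (F' v) := by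
  rw [← sum_polyForm_update_triple]
  simp [angleDeriv, ContinuousMultilinearMap.linearDeriv_apply, tripleCLM_apply]

theorem hasFDerivWithinAt_triple {a : G → E [⋀^Fin p]→L[ℝ] 𝔤} {b : G → E [⋀^Fin q]→L[ℝ] 𝔤}
    {F : G → E [⋀^Fin 2]→L[ℝ] 𝔤} {a' : G →L[ℝ] E [⋀^Fin p]→L[ℝ] 𝔤}
    {b' : G →L[ℝ] E [⋀^Fin q]→L[ℝ] 𝔤} {F' : G →L[ℝ] E [⋀^Fin 2]→L[ℝ] 𝔤} {s : Set G} {x : G}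
    (ha : HasFDerivWithinAt a a' s x) (hb : HasFDerivWithinAt b b' s x)
    (hF : HasFDerivWithinAt F F' s x) :
    HasFDerivWithinAt (fun y => triple m (a y) (b y) (F y))
      (ContinuousLinearMap.pi (tripleCLM m a' b' F')) s x := by
  rw [hasFDerivWithinAt_pi]
  exact Fin.cases ha (Fin.cases hb fun i => hF)

/-- Differentiability is taken within a set because the range of a model with corners need not be
open. -/
theorem hasFDerivWithinAt_angle (h : p + q + 2 * m = N) {a : G → E [⋀^Fin p]→L[ℝ] 𝔤}
    {b : G → E [⋀^Fin q]→L[ℝ] 𝔤}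
    {F : G → E [⋀^Fin 2]→L[ℝ] 𝔤} {a' : G →L[ℝ] E [⋀^Fin p]→L[ℝ] 𝔤}
    {b' : G →L[ℝ] E [⋀^Fin q]→L[ℝ] 𝔤} {F' : G →L[ℝ] E [⋀^Fin 2]→L[ℝ] 𝔤} {s : Set G} {x : G}
    (ha : HasFDerivWithinAt a a' s x) (hb : HasFDerivWithinAt b b' s x)
    (hF : HasFDerivWithinAt F F' s x) :
    HasFDerivWithinAt (fun y => angle P h (a y) (b y) (F y))
      (angleDeriv P h (a x) (b x) (F x) a' b' F') s x := by
  have h1 := (polyFormCMM (E := E) P (sum_degs h)).hasFDerivAt (triple m (a x) (b x) (F x))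
  exact h1.comp_hasFDerivWithinAt x (hasFDerivWithinAt_triple ha hb hF)

theorem hasDerivAt_angle (h : p + q + 2 * m = N) {a : ℝ → E [⋀^Fin p]→L[ℝ] 𝔤}
    {b : ℝ → E [⋀^Fin q]→L[ℝ] 𝔤} {F : ℝ → E [⋀^Fin 2]→L[ℝ] 𝔤} {a' : E [⋀^Fin p]→L[ℝ] 𝔤}
    {b' : E [⋀^Fin q]→L[ℝ] 𝔤} {F' : E [⋀^Fin 2]→L[ℝ] 𝔤} {t : ℝ}
    (ha : HasDerivAt a a' t) (hb : HasDerivAt b b' t) (hF : HasDerivAt F F' t) :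
    HasDerivAt (fun y => angle P h (a y) (b y) (F y))
      (angle P h a' (b t) (F t) + angle P h (a t) b' (F t) + angleVar P h (a t) (b t) (F t) F')
      t := by
  have := (hasFDerivWithinAt_univ.1 (hasFDerivWithinAt_angle P h ha.hasFDerivAt.hasFDerivWithinAt
    hb.hasFDerivAt.hasFDerivWithinAt hF.hasFDerivAt.hasFDerivWithinAt)).hasDerivAt
  simpa [angleDeriv_apply] using this

end Derivative

end Angle

end

section
open ContinuousAlternatingMap

/-! ### Alternatization in a single slot of ⟨a b F^m⟩. -/

section Auxiliary

variable {E : Type*} [NormedAddCommGroup E] [NormedSpace ℝ E]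
variable {W : Type*} [NormedAddCommGroup W] [NormedSpace ℝ W]

theorem alternatizeUncurryFin_apply_real {n : ℕ} (f : E →L[ℝ] E [⋀^Fin n]→L[ℝ] W)
    (v : Fin (n + 1) → E) :
    alternatizeUncurryFin f v = ∑ i : Fin (n + 1), (-1 : ℝ) ^ (i : ℕ) • f (v i) (i.removeNth v) := by
  rw [alternatizeUncurryFin_apply]
  refine Finset.sum_congr rfl fun i _ => ?_
  rcases Nat.even_or_odd (i : ℕ) with h | h <;> simp [h.neg_one_pow]

/-- A form of degree `k` regarded as a form of degree `l = k`. -/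
def castForm {k l : ℕ} (h : l = k) (Z : E [⋀^Fin k]→L[ℝ] W) : E [⋀^Fin l]→L[ℝ] W := h ▸ Z

theorem castForm_apply {k l : ℕ} (h : l = k) (Z : E [⋀^Fin k]→L[ℝ] W) (w : Fin k → E) :
    castForm h Z (w ∘ Fin.cast h) = Z w := by
  subst h
  rfl

/-- In general the right side carries the degree as a factor, which is 1 here. A 1-form is thus the
alternatization of a family of 0-forms, and this reduces statements about a 1-form in a slot to
0-forms. -/
theorem alternatizeUncurryFin_curryLeft_one (α : E [⋀^Fin 1]→L[ℝ] W) :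
    alternatizeUncurryFin α.curryLeft = α := by
  rw [alternatizeUncurryFin_curryLeft]
  simp

end Auxiliary

section AngleAlgebra

variable {E : Type*} [NormedAddCommGroup E] [NormedSpace ℝ E]
variable {𝔤 : Type*} [NormedAddCommGroup 𝔤] [NormedSpace ℝ 𝔤]
variable {V : Type*} [NormedAddCommGroup V] [NormedSpace ℝ V]
variable {p q m N : ℕ} (P : ContinuousMultilinearMap ℝ (fun _ : Fin (m + 2) => 𝔤) V)

/-- `a ↦ ⟨a b F^m⟩`. -/
def angleLeft (h : p + q + 2 * m = N) (b : E [⋀^Fin q]→L[ℝ] 𝔤) (F : E [⋀^Fin 2]→L[ℝ] 𝔤) :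
    E [⋀^Fin p]→L[ℝ] 𝔤 →L[ℝ] E [⋀^Fin N]→L[ℝ] V :=
  (polyFormCMM (E := E) P (sum_degs h)).toContinuousLinearMap (triple m 0 b F) 0

theorem angleLeft_apply (h : p + q + 2 * m = N) (a : E [⋀^Fin p]→L[ℝ] 𝔤)
    (b : E [⋀^Fin q]→L[ℝ] 𝔤) (F : E [⋀^Fin 2]→L[ℝ] 𝔤) :
    angleLeft P h b F a = angle P h a b F :=
  congrArg (polyForm P (sum_degs h)) (update_triple_zero 0 a b F)

/-- `b ↦ ⟨a b F^m⟩`. -/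
def angleMid (h : p + q + 2 * m = N) (a : E [⋀^Fin p]→L[ℝ] 𝔤) (F : E [⋀^Fin 2]→L[ℝ] 𝔤) :
    E [⋀^Fin q]→L[ℝ] 𝔤 →L[ℝ] E [⋀^Fin N]→L[ℝ] V :=
  (polyFormCMM (E := E) P (sum_degs h)).toContinuousLinearMap (triple m a 0 F) (Fin.succ 0)

theorem angleMid_apply (h : p + q + 2 * m = N) (a : E [⋀^Fin p]→L[ℝ] 𝔤)
    (b : E [⋀^Fin q]→L[ℝ] 𝔤) (F : E [⋀^Fin 2]→L[ℝ] 𝔤) :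
    angleMid P h a F b = angle P h a b F :=
  congrArg (polyForm P (sum_degs h)) (update_triple_one a 0 b F)

/-- `F' ↦ ⟨a b F ⋯ F' ⋯ F⟩` with `F'` in the `j`-th place among the 2-forms. -/
def angleVarTerm (h : p + q + 2 * m = N) (a : E [⋀^Fin p]→L[ℝ] 𝔤) (b : E [⋀^Fin q]→L[ℝ] 𝔤)
    (F : E [⋀^Fin 2]→L[ℝ] 𝔤) (j : Fin m) : E [⋀^Fin 2]→L[ℝ] 𝔤 →L[ℝ] E [⋀^Fin N]→L[ℝ] V :=
  (polyFormCMM (E := E) P (sum_degs h)).toContinuousLinearMap (triple m a b F) j.succ.succ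

/-- `F' ↦ ∑ⱼ ⟨a b F ⋯ F' ⋯ F⟩`. -/
def angleVarCLM (h : p + q + 2 * m = N) (a : E [⋀^Fin p]→L[ℝ] 𝔤) (b : E [⋀^Fin q]→L[ℝ] 𝔤)
    (F : E [⋀^Fin 2]→L[ℝ] 𝔤) : E [⋀^Fin 2]→L[ℝ] 𝔤 →L[ℝ] E [⋀^Fin N]→L[ℝ] V :=
  ∑ j : Fin m, angleVarTerm P h a b F j

theorem angleVarCLM_apply (h : p + q + 2 * m = N) (a : E [⋀^Fin p]→L[ℝ] 𝔤)
    (b : E [⋀^Fin q]→L[ℝ] 𝔤) (F F' : E [⋀^Fin 2]→L[ℝ] 𝔤) :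
    angleVarCLM P h a b F F' = angleVar P h a b F F' := by
  rw [angleVarCLM, _root_.sum_apply]
  rfl

/-- The first block starts at position 0, so there is no sign. In the applications `S` is a
derivative, a map v ↦ [α v, a], the currying of a 1-form, or θ ⊗ a. -/
theorem alternatizeUncurryFin_angle_left (h : p + q + 2 * m = N) (h' : p + 1 + q + 2 * m = N + 1)
    (S : E →L[ℝ] E [⋀^Fin p]→L[ℝ] 𝔤) (b : E [⋀^Fin q]→L[ℝ] 𝔤) (F : E [⋀^Fin 2]→L[ℝ] 𝔤) :
    alternatizeUncurryFin ((angleLeft P h b F).comp S)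
      = angle P h' (alternatizeUncurryFin S) b F := by
  ext u
  rw [alternatizeUncurryFin_apply_real]
  simp only [ContinuousLinearMap.comp_apply, angleLeft_apply]
  refine (sum_neg_one_pow_smul_polyForm (d' := degs (p + 1) q m) P (sum_degs h) (sum_degs h') 0
    (fun v => triple m (S v) b F) (triple m (alternatizeUncurryFin S) b F) rfl ?_ ?_ ?_ u).trans ?_
  · exact fun w => alternatizeUncurryFin_apply_real S w
  · exact Fin.cases (fun h => absurd rfl h) fun j _ => rfl
  · exact Fin.cases (fun h => absurd rfl h) fun j _ _ _ => rfl
  · simp [blockStart, angle]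

theorem blockStart_degs_one : blockStart (degs p q m) (Fin.succ 0) = p := by
  simp only [blockStart, Fin.sum_univ_succ]
  simp [degs]

/-- The second block starts at position p, which produces the sign. -/
theorem alternatizeUncurryFin_angle_mid (h : p + q + 2 * m = N) (h' : p + (q + 1) + 2 * m = N + 1)
    (a : E [⋀^Fin p]→L[ℝ] 𝔤) (S : E →L[ℝ] E [⋀^Fin q]→L[ℝ] 𝔤) (F : E [⋀^Fin 2]→L[ℝ] 𝔤) :
    alternatizeUncurryFin ((angleMid P h a F).comp S)
      = (-1 : ℝ) ^ p • angle P h' a (alternatizeUncurryFin S) F := by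
  ext u
  rw [alternatizeUncurryFin_apply_real]
  simp only [ContinuousLinearMap.comp_apply, angleMid_apply]
  refine (sum_neg_one_pow_smul_polyForm (d' := degs p (q + 1) m) P (sum_degs h) (sum_degs h')
    (Fin.succ 0)
    (fun v => triple m a (S v) F) (triple m a (alternatizeUncurryFin S) F) rfl ?_ ?_ ?_ u).trans ?_
  · exact fun w => alternatizeUncurryFin_apply_real S w
  · exact Fin.cases (fun _ => rfl) (Fin.cases (fun h => absurd rfl h) fun j _ => rfl)
  · exact Fin.cases (fun _ _ _ => rfl) (Fin.cases (fun h => absurd rfl h) fun j _ _ _ => rfl)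
  · rw [blockStart_degs_one]
    rfl

/-- Each summand becomes a product with the 3-form `alternatizeUncurryFin S` in one slot, and that
3-form is zero. With S = F' + [α, F] this is how the Bianchi identity will enter. -/
theorem alternatizeUncurryFin_angleVar (h : p + q + 2 * m = N) (a : E [⋀^Fin p]→L[ℝ] 𝔤)
    (b : E [⋀^Fin q]→L[ℝ] 𝔤) (F : E [⋀^Fin 2]→L[ℝ] 𝔤) (S : E →L[ℝ] E [⋀^Fin 2]→L[ℝ] 𝔤)
    (hS : alternatizeUncurryFin S = 0) :
    alternatizeUncurryFin ((angleVarCLM P h a b F).comp S) = 0 := by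
  ext u
  rw [alternatizeUncurryFin_apply_real]
  simp only [ContinuousLinearMap.comp_apply, angleVarCLM_apply, angleVar,
    ContinuousAlternatingMap.sum_apply, Finset.smul_sum]
  rw [Finset.sum_comm]
  refine Finset.sum_eq_zero fun j _ => ?_
  -- A 3-form among the 2-forms leaves the pattern `degs`, so the unchanged forms must be
  -- transported along equalities of degrees by `castForm`.
  let d' : Fin (m + 2) → ℕ := Function.update (degs p q m) j.succ.succ 3
  have hd' : ∀ i, i ≠ j.succ.succ → d' i = degs p q m i := fun i hi => Function.update_of_ne hi _ _
  have hd : d' j.succ.succ = 3 := Function.update_self _ _ _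
  have hsum : ∑ i, d' i = N + 1 := by
    have e1 := Finset.add_sum_erase _ d' (Finset.mem_univ j.succ.succ)
    have e2 := Finset.add_sum_erase _ (degs p q m) (Finset.mem_univ j.succ.succ)
    rw [Finset.sum_congr rfl fun i hi => hd' i (Finset.ne_of_mem_erase hi), hd] at e1
    rw [sum_degs h, show degs p q m j.succ.succ = 2 from rfl] at e2
    linarith
  let Z' : ∀ i, E [⋀^Fin (d' i)]→L[ℝ] 𝔤 := fun i =>
    if hi : i = j.succ.succ then 0 else
      castForm (hd' i hi) (triple m a b F i)
  have hZ' : Z' j.succ.succ = 0 := dif_pos rfl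
  let Y : E → ∀ i, E [⋀^Fin (degs p q m i)]→L[ℝ] 𝔤 :=
    fun v => Function.update (triple m a b F) j.succ.succ (S v)
  have hY : ∀ v, Y v j.succ.succ = S v := fun v => Function.update_self _ _ _
  have hY' : ∀ v i, i ≠ j.succ.succ → Y v i = triple m a b F i :=
    fun v i hi => Function.update_of_ne hi _ _
  have e : ∀ w : Fin 3 → E, (0 : 𝔤) = ∑ i : Fin 3, (-1 : ℝ) ^ (i : ℕ) • S (w i) (i.removeNth w) := by
    intro w
    rw [← alternatizeUncurryFin_apply_real S w, hS]
    rfl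
  refine (sum_neg_one_pow_smul_polyForm (d' := d') P (sum_degs h) hsum j.succ.succ
    Y Z' hd ?_ hd' ?_ u).trans ?_
  · intro w
    rw [hZ']
    refine (e w).trans (Finset.sum_congr rfl fun l _ => ?_)
    exact congrArg (fun G : E [⋀^Fin 2]→L[ℝ] 𝔤 => (-1 : ℝ) ^ (l : ℕ) • G (l.removeNth w))
      (hY (w l)).symm
  · intro i hi v w
    rw [hY' v i hi]
    simp only [Z', dif_neg hi]
    exact castForm_apply (hd' i hi) _ w
  · have : polyForm P hsum Z' = 0 :=
      (polyFormCMM (E := E) P hsum).map_coord_zero j.succ.succ hZ'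
    rw [this]
    simp

end AngleAlgebra

/-! ### Brackets of forms, invariance, and the covariant Leibniz rule at a point. -/

section Bracket

variable {E : Type*} [NormedAddCommGroup E] [NormedSpace ℝ E]
variable (𝔤 : Type*) [NormedAddCommGroup 𝔤] [NormedSpace ℝ 𝔤] [FiniteDimensional ℝ 𝔤]
  [NormedLieAlg 𝔤]
variable {V : Type*} [NormedAddCommGroup V] [NormedSpace ℝ V]
variable {p q m N : ℕ} {P : ContinuousMultilinearMap ℝ (fun _ : Fin (m + 2) => 𝔤) V}

/-- The Lie bracket as a continuous bilinear map. -/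
def bracketCLM : 𝔤 →L[ℝ] 𝔤 →L[ℝ] 𝔤 :=
  LinearMap.toContinuousBilinearMap
      (LinearMap.mk₂ ℝ (fun x y : 𝔤 => ⁅x, y⁆) (by simp) (by simp) (by simp) (by simp))

variable {𝔤}

/-- The form `[x, Z]` for an element `x` of the Lie algebra. -/
def adj (x : 𝔤) (Z : E [⋀^Fin p]→L[ℝ] 𝔤) : E [⋀^Fin p]→L[ℝ] 𝔤 :=
  (bracketCLM 𝔤 x).compContinuousAlternatingMap Z

@[simp]
theorem adj_apply (x : 𝔤) (Z : E [⋀^Fin p]→L[ℝ] 𝔤) (v : Fin p → E) : adj x Z v = ⁅x, Z v⁆ := rfl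

/-- The map `v ↦ [α v, Z]` for a 1-form `α`. -/
def adForm (α : E [⋀^Fin 1]→L[ℝ] 𝔤) (Z : E [⋀^Fin p]→L[ℝ] 𝔤) : E →L[ℝ] E [⋀^Fin p]→L[ℝ] 𝔤 :=
  (((ContinuousLinearMap.compContinuousAlternatingMapCLM ℝ E 𝔤 𝔤 (Fin p)).flip Z).comp
    (bracketCLM 𝔤)).comp ((ofSubsingletonLIE (𝕜 := ℝ) (E := E) (F := 𝔤) (0 : Fin 1)).symm α :)

theorem adForm_apply (α : E [⋀^Fin 1]→L[ℝ] 𝔤) (Z : E [⋀^Fin p]→L[ℝ] 𝔤) (v : E) :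
    adForm α Z v = adj (α fun _ => v) Z := rfl

/-- The 0-form takes no arguments, so the permutations act on those of `Z` alone; their signs cancel
by antisymmetry and the q! equal terms cancel the normalization. -/
theorem lieWedge_zero_left (z : E [⋀^Fin 0]→L[ℝ] 𝔤) (Z : E [⋀^Fin q]→L[ℝ] 𝔤) (h : 0 + q = q) :
    lieWedge h z Z = adj (z 0) Z := by
  ext v
  rw [lieWedge, angle, polyForm_apply]
  have hterm : ∀ σ : Equiv.Perm (Fin q), Equiv.Perm.sign σ • lieMap 𝔤 (fun i =>
      triple 0 z Z 0 i (fun j => v (σ (blockPos (sum_degs (m := 0) (p := 0) (q := q) (N := q) (by omega)) i j))))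
      = ⁅z 0, Z v⁆ := by
    intro σ
    have h1 : triple 0 z Z 0 (Fin.succ 0) (fun j => v (σ (blockPos
        (sum_degs (m := 0) (p := 0) (q := q) (N := q) (by omega)) (Fin.succ 0) j)))
        = Equiv.Perm.sign σ • Z v := by
      refine Eq.trans ?_ (Z.toAlternatingMap.map_perm v σ)
      refine congrArg Z (funext fun j => congrArg v (congrArg σ (Fin.ext ?_)))
      refine (val_blockPos (sum_degs (m := 0) (p := 0) (q := q) (N := q) (by omega))
        (Fin.succ 0) j).trans ?_
      rw [blockStart_degs_one]
      simp
    have h2 : triple 0 z Z 0 0 (fun j => v (σ (blockPos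
        (sum_degs (m := 0) (p := 0) (q := q) (N := q) (by omega)) 0 j))) = z 0 :=
      congrArg z (Subsingleton.elim _ _)
    refine (congrArg₂ (fun x y => Equiv.Perm.sign σ • ⁅x, y⁆) h2 h1).trans ?_
    rcases Int.units_eq_one_or (Equiv.Perm.sign σ) with h | h <;> simp [h]
  rw [Finset.sum_congr rfl fun σ _ => hterm σ]
  simp only [Fin.prod_univ_succ, degs, Finset.sum_const, Finset.card_univ, Fintype.card_perm,
    Fintype.card_fin, adj_apply]
  rw [← Nat.cast_smul_eq_nsmul ℝ, smul_smul]
  simp only [Fin.cons_zero, Fin.cons_succ, Nat.factorial_zero, Nat.cast_one, one_mul,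
    Finset.univ_eq_empty, Finset.prod_empty, mul_one]
  rw [inv_mul_cancel₀ (by positivity), one_smul]

/-- Writing α as the alternatization of its values reduces the claim to brackets with a 0-form. The
result has the shape of an exterior derivative, so d and [A, ·] can be added before alternatizing.
-/
theorem lieWedge_one_left (α : E [⋀^Fin 1]→L[ℝ] 𝔤) (Z : E [⋀^Fin q]→L[ℝ] 𝔤) (h : 1 + q = q + 1) :
    lieWedge h α Z = alternatizeUncurryFin (adForm α Z) := by
  conv_lhs => rw [← alternatizeUncurryFin_curryLeft_one α]
  rw [lieWedge]
  rw [← alternatizeUncurryFin_angle_left (m := 0) (lieMap 𝔤) (by omega : 0 + q + 2 * 0 = q)]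
  congr 1
  ext1 v
  rw [ContinuousLinearMap.comp_apply, angleLeft_apply]
  refine (lieWedge_zero_left (α.curryLeft v) Z (by omega)).trans ?_
  rw [adForm_apply, curryLeft_apply_apply]
  congr 2
  exact funext fun i => by rw [Subsingleton.elim i 0]; rfl

/-- Invariance of `⟨a b F^m⟩`. -/
theorem IsInvariantPolynomial.angle_adj (hP : IsInvariantPolynomial P) (h : p + q + 2 * m = N)
    (x : 𝔤) (a : E [⋀^Fin p]→L[ℝ] 𝔤) (b : E [⋀^Fin q]→L[ℝ] 𝔤) (F : E [⋀^Fin 2]→L[ℝ] 𝔤) :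
    angle P h (adj x a) b F + angle P h a (adj x b) F + angleVar P h a b F (adj x F) = 0 := by
  rw [← sum_polyForm_update_triple]
  have h1 : ∀ i, triple m (adj x a) (adj x b) (adj x F) i = adj x (triple m a b F i) :=
    Fin.cases rfl (Fin.cases rfl fun i => rfl)
  ext v
  simp only [ContinuousAlternatingMap.sum_apply, polyForm_apply, h1, apply_update_form, adj_apply]
  -- Invariance of `P` is applied to each permutation separately.
  rw [← Finset.smul_sum, Finset.sum_comm]
  simp_rw [← Finset.smul_sum, hP.invariant x]
  simp

variable {G : Type*} [NormedAddCommGroup G] [NormedSpace ℝ G]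

/-- The covariant Leibniz rule at a point, for the exterior derivative of `⟨a b F^m⟩`. -/
theorem IsInvariantPolynomial.alternatizeUncurryFin_angleDeriv (hP : IsInvariantPolynomial P)
    (h : p + q + 2 * m = N) (h₁ : p + 1 + q + 2 * m = N + 1) (h₂ : p + (q + 1) + 2 * m = N + 1)
    (α : E [⋀^Fin 1]→L[ℝ] 𝔤)
    (a : E [⋀^Fin p]→L[ℝ] 𝔤) (b : E [⋀^Fin q]→L[ℝ] 𝔤) (F : E [⋀^Fin 2]→L[ℝ] 𝔤)
    (a' : E →L[ℝ] E [⋀^Fin p]→L[ℝ] 𝔤) (b' : E →L[ℝ] E [⋀^Fin q]→L[ℝ] 𝔤)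
    (F' : E →L[ℝ] E [⋀^Fin 2]→L[ℝ] 𝔤)
    (hF : alternatizeUncurryFin F' + alternatizeUncurryFin (adForm α F) = 0) :
    alternatizeUncurryFin (angleDeriv P h a b F a' b' F')
      = angle P h₁ (alternatizeUncurryFin a' + alternatizeUncurryFin (adForm α a)) b F
        + (-1 : ℝ) ^ p •
          angle P h₂ a (alternatizeUncurryFin b' + alternatizeUncurryFin (adForm α b)) F := by
  -- By `hF`, the variation of ⟨a b F^m⟩ along F' + [α, F] alternatizes to zero; it is inserted on
  -- the right so that both sides become alternatizations of linear maps to be compared at each v.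
  rw [← alternatizeUncurryFin_add] at hF
  rw [← alternatizeUncurryFin_add, ← alternatizeUncurryFin_add,
    ← alternatizeUncurryFin_angle_left P h, ← alternatizeUncurryFin_angle_mid P h,
    ← alternatizeUncurryFin_add, ← add_zero (alternatizeUncurryFin (_ + _)),
    ← alternatizeUncurryFin_angleVar P h a b F _ hF, ← alternatizeUncurryFin_add]
  congr 1
  ext1 v
  -- Invariance with x = α(v) supplies precisely the bracket terms that turn the three partial
  -- derivatives into covariant ones.
  have := hP.angle_adj h (α fun _ => v) a b F
  rw [angleDeriv_apply]
  simp only [_root_.add_apply, ContinuousLinearMap.comp_apply, map_add,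
    angleLeft_apply, angleMid_apply, angleVarCLM_apply, adForm_apply]
  rw [← sub_eq_zero, ← neg_eq_zero, ← this]
  abel

end Bracket

end

section
open ContinuousAlternatingMap

/-! ### Exchanging entries of ⟨⋯⟩. -/

section Symmetry

variable {E : Type*} [NormedAddCommGroup E] [NormedSpace ℝ E]
variable {𝔤 : Type*} [NormedAddCommGroup 𝔤] [NormedSpace ℝ 𝔤]
variable {V : Type*} [NormedAddCommGroup V] [NormedSpace ℝ V]
variable {p q m N : ℕ} {P : ContinuousMultilinearMap ℝ (fun _ : Fin (m + 2) => 𝔤) V}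

theorem blockStart_degs_zero : blockStart (degs p q m) 0 = 0 := by
  simp [blockStart]

theorem blockStart_degs_succ_succ (j : Fin m) :
    blockStart (degs p q m) j.succ.succ = p + (q + ∑ k : Fin m, if k < j then 2 else 0) := by
  simp only [blockStart, Fin.sum_univ_succ]
  simp only [degs, Fin.succ_pos, Fin.cons_zero, Fin.cons_succ, Fin.succ_lt_succ_iff, ite_true]

/-- A 0-form occupies no argument positions, so the exchange moves none and only the symmetry of `P`
is needed. -/
theorem angle_zero_swap (hP : ∀ (σ : Equiv.Perm (Fin (m + 2))) (z : Fin (m + 2) → 𝔤), P (z ∘ σ) = P z)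
    (h : 0 + q + 2 * m = N) (h' : q + 0 + 2 * m = N)
    (z : E [⋀^Fin 0]→L[ℝ] 𝔤) (b : E [⋀^Fin q]→L[ℝ] 𝔤) (F : E [⋀^Fin 2]→L[ℝ] 𝔤) :
    angle P h z b F = angle P h' b z F := by
  ext v
  rw [angle, angle, polyForm_apply, polyForm_apply]
  congr 1
  · congr 1
    rw [Fin.prod_univ_succ, Fin.prod_univ_succ, Fin.prod_univ_succ, Fin.prod_univ_succ]
    simp [degs]
  refine Finset.sum_congr rfl fun σ _ => ?_
  congr 1
  rw [← hP (Equiv.swap 0 (Fin.succ 0))]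
  congr 1
  refine funext (Fin.cases ?_ (Fin.cases ?_ fun j => ?_))
  · rw [Function.comp_apply, Equiv.swap_apply_left]
    refine congrArg b (funext fun j => congrArg v (congrArg σ (Fin.ext ?_)))
    refine (val_blockPos (sum_degs h) (Fin.succ 0) j).trans
      (Eq.trans ?_ (val_blockPos (sum_degs h') 0 j).symm)
    rw [blockStart_degs_one, blockStart_degs_zero]
  · rw [Function.comp_apply, Equiv.swap_apply_right]
    exact congrArg z (Subsingleton.elim (α := Fin 0 → E) _ _)
  · rw [Function.comp_apply, Equiv.swap_apply_of_ne_of_ne (Fin.succ_ne_zero _)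
      (fun h => Fin.succ_ne_zero j (Fin.succ_injective _ h))]
    refine congrArg F (funext fun x => congrArg v (congrArg σ (Fin.ext ?_)))
    refine (val_blockPos (sum_degs h) j.succ.succ x).trans
      (Eq.trans ?_ (val_blockPos (sum_degs h') j.succ.succ x).symm)
    rw [blockStart_degs_succ_succ, blockStart_degs_succ_succ]
    simp

/-- Both sides are alternatizations in the vector fed to `a`, and the integrands agree by the 0-form
case. The sign is that of alternatizing in the second slot, behind a q-form. -/
theorem angle_one_swap
    (hP : ∀ (σ : Equiv.Perm (Fin (m + 2))) (z : Fin (m + 2) → 𝔤), P (z ∘ σ) = P z)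
    (h : 1 + q + 2 * m = N) (h' : q + 1 + 2 * m = N)
    (a : E [⋀^Fin 1]→L[ℝ] 𝔤) (b : E [⋀^Fin q]→L[ℝ] 𝔤) (F : E [⋀^Fin 2]→L[ℝ] 𝔤) :
    angle P h a b F = (-1 : ℝ) ^ q • angle P h' b a F := by
  obtain ⟨n, rfl⟩ : ∃ n, N = n + 1 := ⟨q + 2 * m, by omega⟩
  have e1 := alternatizeUncurryFin_angle_left P (by omega : 0 + q + 2 * m = n) h a.curryLeft b F
  have e2 := alternatizeUncurryFin_angle_mid P (by omega : q + 0 + 2 * m = n) h' b a.curryLeft F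
  rw [alternatizeUncurryFin_curryLeft_one] at e1 e2
  rw [← e1, ← e2]
  congr 1
  ext1 v
  simp only [ContinuousLinearMap.comp_apply, angleLeft_apply, angleMid_apply]
  exact angle_zero_swap hP _ _ _ _ _

theorem angle_two_swap
    (hP : ∀ (σ : Equiv.Perm (Fin (m + 2))) (z : Fin (m + 2) → 𝔤), P (z ∘ σ) = P z)
    (h : 2 + 2 + 2 * m = N) (a b F : E [⋀^Fin 2]→L[ℝ] 𝔤) :
    angle P h a b F = angle P h b a F := by
  refine polyForm_swap_two hP (sum_degs h) (Fin.succ_ne_zero 0).symm rfl rfl _ _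
    (fun w => rfl) (fun w => rfl) ?_
  exact Fin.cases (fun h _ => absurd rfl h) (Fin.cases (fun _ h => absurd rfl h) fun j _ _ => rfl)

/-- As the second entry is also F, the F' in any of the m last slots can be exchanged with it. -/
theorem angleVar_eq_smul_angle
    (hP : ∀ (σ : Equiv.Perm (Fin (m + 2))) (z : Fin (m + 2) → 𝔤), P (z ∘ σ) = P z)
    (h : p + 2 + 2 * m = N) (a : E [⋀^Fin p]→L[ℝ] 𝔤) (F F' : E [⋀^Fin 2]→L[ℝ] 𝔤) :
    angleVar P h a F F F' = (m : ℝ) • angle P h a F' F := by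
  rw [angleVar, Finset.sum_congr rfl (g := fun _ => angle P h a F' F)]
  · simp [← Nat.cast_smul_eq_nsmul ℝ]
  intro j _
  let Y : ∀ i, E [⋀^Fin (degs p 2 m i)]→L[ℝ] 𝔤 :=
    Function.update (triple m a F F) j.succ.succ F'
  have hY : Y j.succ.succ = F' := Function.update_self _ _ _
  have hY' : ∀ i, i ≠ j.succ.succ → Y i = triple m a F F i :=
    fun i hi => Function.update_of_ne hi _ _
  have hne : (Fin.succ 0 : Fin (m + 2)) ≠ j.succ.succ :=
    fun h => Fin.succ_ne_zero j (Fin.succ_injective _ h).symm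
  refine polyForm_swap_two hP (sum_degs h) hne rfl rfl (triple m a F' F) Y
    (fun w => ?_) (fun w => ?_) ?_
  · exact congrArg (fun G : E [⋀^Fin 2]→L[ℝ] 𝔤 => G w) (hY' _ hne)
  · exact congrArg (fun G : E [⋀^Fin 2]→L[ℝ] 𝔤 => G w) hY
  · intro k hk hk'
    rw [hY' k hk']
    revert k
    exact Fin.cases (fun _ _ => rfl) (Fin.cases (fun h _ => absurd rfl h) fun j _ _ => rfl)

end Symmetry

/-! ### Contraction with a vector, as an infinitesimal pullback. -/

section Contraction

variable {E : Type*} [NormedAddCommGroup E] [NormedSpace ℝ E]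
variable {𝔤 : Type*} [NormedAddCommGroup 𝔤] [NormedSpace ℝ 𝔤]
variable {V : Type*} [NormedAddCommGroup V] [NormedSpace ℝ V]
variable {W : Type*} [NormedAddCommGroup W] [NormedSpace ℝ W]
variable {p q m N : ℕ} {P : ContinuousMultilinearMap ℝ (fun _ : Fin (m + 2) => 𝔤) V}

/-- The action of the endomorphism `L` on forms as a derivation. -/
def derivation (L : E →L[ℝ] E) (Z : E [⋀^Fin p]→L[ℝ] W) : E [⋀^Fin p]→L[ℝ] W :=
  Z.fderivCompContinuousLinearMap (ContinuousLinearMap.id ℝ E) L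

theorem hasDerivAt_compContinuousLinearMap (L : E →L[ℝ] E) (Z : E [⋀^Fin p]→L[ℝ] W) :
    HasDerivAt (fun s : ℝ => Z.compContinuousLinearMap (ContinuousLinearMap.id ℝ E + s • L))
      (derivation L Z) 0 := by
  have h1 : HasFDerivAt (fun s : ℝ => ContinuousLinearMap.id ℝ E + s • L)
      (ContinuousLinearMap.toSpanSingleton ℝ L) 0 :=
    (ContinuousLinearMap.toSpanSingleton ℝ L).hasFDerivAt.const_add _
  have h2 := (hasFDerivAt_const Z (0 : ℝ)).continuousAlternatingMapCompContinuousLinearMap h1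
  have h3 := h2.hasDerivAt
  simpa [derivation] using h3

/-- Pullback by 1 + sL commutes with ⟨⋯⟩; differentiating at s = 0 gives a Leibniz rule without
signs, since the derivation preserves degrees. -/
theorem derivation_angle (P : ContinuousMultilinearMap ℝ (fun _ : Fin (m + 2) => 𝔤) V)
    (h : p + q + 2 * m = N) (L : E →L[ℝ] E) (a : E [⋀^Fin p]→L[ℝ] 𝔤)
    (b : E [⋀^Fin q]→L[ℝ] 𝔤) (F : E [⋀^Fin 2]→L[ℝ] 𝔤) :
    derivation L (angle P h a b F) = angle P h (derivation L a) b F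
      + angle P h a (derivation L b) F + angleVar P h a b F (derivation L F) := by
  have h1 := hasDerivAt_compContinuousLinearMap L (angle P h a b F)
  have h2 := hasDerivAt_angle P h (hasDerivAt_compContinuousLinearMap L a)
    (hasDerivAt_compContinuousLinearMap L b) (hasDerivAt_compContinuousLinearMap L F)
  simp only [← angle_compContinuousLinearMap] at h2
  have h3 := h1.unique h2
  simp only [zero_smul, add_zero] at h3
  exact h3

/-- `θ ∧ Z` for a linear form `θ`. -/
def wedgeLeft (θ : E →L[ℝ] ℝ) (Z : E [⋀^Fin p]→L[ℝ] W) : E [⋀^Fin (p + 1)]→L[ℝ] W :=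
  alternatizeUncurryFin (θ.smulRight Z)

/-- The derivation replaces one argument v at a time by θ(v)ξ; moving that ξ to the front is the
alternatization defining θ ∧ I_ξZ. This expresses contraction through a derivation of degree 0. -/
theorem derivation_smulRight (θ : E →L[ℝ] ℝ) (ξ : E) (Z : E [⋀^Fin (p + 1)]→L[ℝ] W) :
    derivation (θ.smulRight ξ) Z = wedgeLeft θ (Z.curryLeft ξ) := by
  rw [derivation, fderivCompContinuousLinearMap_eq_alternatizeUncurryFin, wedgeLeft]
  change alternatizeUncurryFin _ = alternatizeUncurryFin _
  congr 1
  ext v w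
  simp

theorem wedgeLeft_add (θ : E →L[ℝ] ℝ) (Z Z' : E [⋀^Fin p]→L[ℝ] W) :
    wedgeLeft θ (Z + Z') = wedgeLeft θ Z + wedgeLeft θ Z' := by
  rw [wedgeLeft, wedgeLeft, wedgeLeft, ← alternatizeUncurryFin_add]
  congr 1
  ext v w
  simp

theorem wedgeLeft_smul (θ : E →L[ℝ] ℝ) (c : ℝ) (Z : E [⋀^Fin p]→L[ℝ] W) :
    wedgeLeft θ (c • Z) = c • wedgeLeft θ Z := by
  rw [wedgeLeft, wedgeLeft, ← alternatizeUncurryFin_smul]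
  congr 1
  ext v w
  simp [mul_comm, smul_smul]

theorem angle_wedgeLeft (P : ContinuousMultilinearMap ℝ (fun _ : Fin (m + 2) => 𝔤) V)
    (h : p + q + 2 * m = N) (h' : p + 1 + q + 2 * m = N + 1) (θ : E →L[ℝ] ℝ)
    (a : E [⋀^Fin p]→L[ℝ] 𝔤) (b : E [⋀^Fin q]→L[ℝ] 𝔤) (F : E [⋀^Fin 2]→L[ℝ] 𝔤) :
    angle P h' (wedgeLeft θ a) b F = wedgeLeft θ (angle P h a b F) := by
  rw [wedgeLeft, ← alternatizeUncurryFin_angle_left P h, wedgeLeft]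
  congr 1
  ext1 v
  simp [angleLeft_apply]

theorem angle_wedgeLeft_mid (P : ContinuousMultilinearMap ℝ (fun _ : Fin (m + 2) => 𝔤) V)
    (h : p + q + 2 * m = N) (h' : p + (q + 1) + 2 * m = N + 1) (θ : E →L[ℝ] ℝ)
    (a : E [⋀^Fin p]→L[ℝ] 𝔤) (b : E [⋀^Fin q]→L[ℝ] 𝔤) (F : E [⋀^Fin 2]→L[ℝ] 𝔤) :
    angle P h' a (wedgeLeft θ b) F = (-1 : ℝ) ^ p • wedgeLeft θ (angle P h a b F) := by
  have h1 : ((-1 : ℝ) ^ p) * (-1 : ℝ) ^ p = 1 := by rw [← pow_add, ← two_mul, pow_mul]; simp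
  have h2 : (-1 : ℝ) ^ p • angle P h' a (wedgeLeft θ b) F = wedgeLeft θ (angle P h a b F) := by
    rw [wedgeLeft, ← alternatizeUncurryFin_angle_mid P h, wedgeLeft]
    congr 1
    ext1 v
    simp [angleMid_apply]
  rw [← h2, smul_smul, h1, one_smul]

/-- The pullback of a form to `E × ℝ`. -/
def prodPullback (Z : E [⋀^Fin p]→L[ℝ] W) : (E × ℝ) [⋀^Fin p]→L[ℝ] W :=
  Z.compContinuousLinearMap (ContinuousLinearMap.fst ℝ E ℝ)

/-- Evaluate with (0, 1) first: the remaining vectors have last coordinate 0, so only the leading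
term survives. On E itself multiplication by a linear form need not be injective, hence the extra
factor ℝ. -/
theorem eq_of_wedgeLeft_prodPullback {Z Z' : E [⋀^Fin p]→L[ℝ] W}
    (h : wedgeLeft (ContinuousLinearMap.snd ℝ E ℝ) (prodPullback Z)
      = wedgeLeft (ContinuousLinearMap.snd ℝ E ℝ) (prodPullback Z')) : Z = Z' := by
  have key : ∀ (Y : E [⋀^Fin p]→L[ℝ] W) (v : Fin p → E),
      wedgeLeft (ContinuousLinearMap.snd ℝ E ℝ) (prodPullback Y)
        (Fin.cons (0, 1) (fun i => (v i, 0))) = Y v := by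
    intro Y v
    rw [wedgeLeft, alternatizeUncurryFin_apply_real, Fin.sum_univ_succ]
    simp [prodPullback]
    rfl
  ext v
  rw [← key Z v, h, key]

theorem curryLeft_prodPullback (Z : E [⋀^Fin (p + 1)]→L[ℝ] W) (ξ : E) :
    (prodPullback Z).curryLeft (ξ, 0) = prodPullback (Z.curryLeft ξ) := by
  rw [prodPullback, curryLeft_compContinuousLinearMap]
  rfl

theorem wedgeLeft_prodPullback_curryLeft (Z : E [⋀^Fin (p + 1)]→L[ℝ] W) (ξ : E) :
    wedgeLeft (ContinuousLinearMap.snd ℝ E ℝ) (prodPullback (Z.curryLeft ξ))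
      = derivation ((ContinuousLinearMap.snd ℝ E ℝ).smulRight (ξ, 0)) (prodPullback Z) := by
  rw [derivation_smulRight, curryLeft_prodPullback]

theorem prodPullback_angle (P : ContinuousMultilinearMap ℝ (fun _ : Fin (m + 2) => 𝔤) V)
    (h : p + q + 2 * m = N)
    (a : E [⋀^Fin p]→L[ℝ] 𝔤) (b : E [⋀^Fin q]→L[ℝ] 𝔤) (F : E [⋀^Fin 2]→L[ℝ] 𝔤) :
    prodPullback (angle P h a b F) = angle P h (prodPullback a) (prodPullback b) (prodPullback F) :=
  angle_compContinuousLinearMap P h a b F _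

/-- After multiplication by the extra differential θ, the Leibniz rule of the derivation applies.
The minus sign comes from moving θ past the 1-form a, and m + 1 counts the equal contributions of
the 2-forms. -/
theorem curryLeft_angle_one
    (hP : ∀ (σ : Equiv.Perm (Fin (m + 2))) (z : Fin (m + 2) → 𝔤), P (z ∘ σ) = P z)
    (h : 1 + 2 + 2 * m = N + 1) (h₀ : 0 + 2 + 2 * m = N) (h₁ : 1 + 1 + 2 * m = N)
    (a : E [⋀^Fin 1]→L[ℝ] 𝔤) (F : E [⋀^Fin 2]→L[ℝ] 𝔤) (ξ : E) :
    (angle P h a F F).curryLeft ξ = angle P h₀ (a.curryLeft ξ) F F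
      + (-(m + 1) : ℝ) • angle P h₁ a (F.curryLeft ξ) F := by
  apply eq_of_wedgeLeft_prodPullback
  rw [wedgeLeft_prodPullback_curryLeft, prodPullback_angle, derivation_angle,
    angleVar_eq_smul_angle hP]
  have e : prodPullback (angle P h₀ (a.curryLeft ξ) F F
      + (-(m + 1) : ℝ) • angle P h₁ a (F.curryLeft ξ) F)
      = prodPullback (angle P h₀ (a.curryLeft ξ) F F)
        + (-(m + 1) : ℝ) • prodPullback (angle P h₁ a (F.curryLeft ξ) F) := rfl
  rw [e, wedgeLeft_add, wedgeLeft_smul, prodPullback_angle, prodPullback_angle,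
    ← wedgeLeft_prodPullback_curryLeft, ← wedgeLeft_prodPullback_curryLeft,
    angle_wedgeLeft P h₀, angle_wedgeLeft_mid P h₁]
  module

/-- All m + 2 slots contribute equally, and θ comes out of the first one without a sign. -/
theorem curryLeft_angle_two
    (hP : ∀ (σ : Equiv.Perm (Fin (m + 2))) (z : Fin (m + 2) → 𝔤), P (z ∘ σ) = P z)
    (h : 2 + 2 + 2 * m = N + 1) (h₀ : 1 + 2 + 2 * m = N)
    (F : E [⋀^Fin 2]→L[ℝ] 𝔤) (ξ : E) :
    (angle P h F F F).curryLeft ξ = (m + 2 : ℝ) • angle P h₀ (F.curryLeft ξ) F F := by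
  apply eq_of_wedgeLeft_prodPullback
  rw [wedgeLeft_prodPullback_curryLeft, prodPullback_angle, derivation_angle,
    angleVar_eq_smul_angle hP, angle_two_swap hP h (prodPullback F)]
  have e : prodPullback ((m + 2 : ℝ) • angle P h₀ (F.curryLeft ξ) F F)
      = (m + 2 : ℝ) • prodPullback (angle P h₀ (F.curryLeft ξ) F F) := rfl
  rw [e, wedgeLeft_smul, prodPullback_angle, ← wedgeLeft_prodPullback_curryLeft,
    angle_wedgeLeft P h₀]
  module

end Contraction

end

section
open ContinuousAlternatingMap Filter Topology

/-! ### Smooth dependence of a pullback on the form and on the linear map. -/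

section SmoothPullback

variable {E E' W : Type*} [NormedAddCommGroup E] [NormedSpace ℝ E] [NormedAddCommGroup E']
  [NormedSpace ℝ E'] [NormedAddCommGroup W] [NormedSpace ℝ W]

/-- The projection of multilinear maps onto alternating ones. -/
def alternatizationCLM (k : ℕ) :
    ContinuousMultilinearMap ℝ (fun _ : Fin k => E) W →L[ℝ] E [⋀^Fin k]→L[ℝ] W :=
  LinearMap.mkContinuous
    { toFun := fun g => ((k.factorial : ℝ)⁻¹) • ContinuousMultilinearMap.alternatization g
      map_add' := fun g g' => by rw [map_add, smul_add]
      map_smul' := fun c g => by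
        ext v
        simp only [ContinuousAlternatingMap.smul_apply,
          ContinuousMultilinearMap.alternatization_apply_apply, _root_.smul_apply,
          RingHom.id_apply, Finset.smul_sum]
        refine Finset.sum_congr rfl fun σ _ => ?_
        rw [smul_comm _ c, smul_comm _ c] } 1 (by
    intro g
    refine opNorm_le_bound _ (by positivity) fun v => ?_
    change ‖((k.factorial : ℝ)⁻¹) • ContinuousMultilinearMap.alternatization g v‖ ≤ _
    rw [ContinuousMultilinearMap.alternatization_apply_apply, norm_smul,
      Real.norm_of_nonneg (by positivity), inv_mul_le_iff₀ (by positivity)]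
    refine (norm_sum_le_of_le (f := fun σ : Equiv.Perm (Fin k) => Equiv.Perm.sign σ • g (v ∘ σ)) _
      (n := fun _ => ‖g‖ * ∏ i, ‖v i‖) fun σ _ => ?_).trans ?_
    · have h1 : ‖Equiv.Perm.sign σ • g (v ∘ σ)‖ = ‖g (v ∘ σ)‖ := by
        rcases Int.units_eq_one_or (Equiv.Perm.sign σ) with h | h <;> simp [h]
      rw [h1]
      refine (g.le_opNorm _).trans_eq ?_
      congr 1
      exact Equiv.prod_comp σ fun i => ‖v i‖
    · simp [Finset.card_univ, Fintype.card_perm])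

theorem alternatizationCLM_toContinuousMultilinearMap {k : ℕ} (Z : E [⋀^Fin k]→L[ℝ] W) :
    alternatizationCLM k Z.toContinuousMultilinearMap = Z := by
  ext v
  change ((k.factorial : ℝ)⁻¹) •
    ContinuousMultilinearMap.alternatization Z.toContinuousMultilinearMap v = _
  rw [ContinuousMultilinearMap.alternatization_apply_apply]
  have : ∀ σ : Equiv.Perm (Fin k), Equiv.Perm.sign σ • Z.toContinuousMultilinearMap (v ∘ σ) = Z v := by
    intro σ
    have : Z.toContinuousMultilinearMap (v ∘ σ) = Equiv.Perm.sign σ • Z v :=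
      Z.toAlternatingMap.map_perm v σ
    rw [this]
    rcases Int.units_eq_one_or (Equiv.Perm.sign σ) with h | h <;> simp [h]
  rw [Finset.sum_congr rfl fun σ _ => this σ]
  simp only [Finset.sum_const, Finset.card_univ, Fintype.card_perm, Fintype.card_fin]
  rw [← Nat.cast_smul_eq_nsmul ℝ, smul_smul, inv_mul_cancel₀ (by positivity), one_smul]

/-- For multilinear maps the pullback is multilinear in the linear maps substituted, hence smooth.
The alternating case follows because `alternatizationCLM` is a continuous linear projection that
fixes alternating maps. -/
theorem contDiff_compContinuousLinearMap {k : ℕ} {n : WithTop ℕ∞} :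
    ContDiff ℝ n (fun p : (E' [⋀^Fin k]→L[ℝ] W) × (E →L[ℝ] E') =>
      p.1.compContinuousLinearMap p.2) := by
  have h : (fun p : (E' [⋀^Fin k]→L[ℝ] W) × (E →L[ℝ] E') => p.1.compContinuousLinearMap p.2)
      = fun p => alternatizationCLM k
        (ContinuousMultilinearMap.compContinuousLinearMapContinuousMultilinear ℝ
          (fun _ : Fin k => E) (fun _ => E') W (fun _ => p.2)
          (toContinuousMultilinearMapCLM ℝ p.1)) := by
    funext p
    rw [← alternatizationCLM_toContinuousMultilinearMap (p.1.compContinuousLinearMap p.2)]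
    rfl
  rw [h]
  refine (alternatizationCLM (E := E) (W := W) k).contDiff.comp (ContDiff.clm_apply ?_ ?_)
  · exact (ContinuousMultilinearMap.contDiff _).comp (contDiff_pi.2 fun _ => contDiff_snd)
  · exact (toContinuousMultilinearMapCLM ℝ : (E' [⋀^Fin k]→L[ℝ] W) →L[ℝ]
      ContinuousMultilinearMap ℝ (fun _ : Fin k => E') W).contDiff.comp contDiff_fst

end SmoothPullback

/-! ### Forms in charts, with tangent spaces identified with the model space. -/

section Charts

variable {E : Type*} [NormedAddCommGroup E] [NormedSpace ℝ E]
variable {H : Type*} [TopologicalSpace H] {I : ModelWithCorners ℝ E H}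
variable {M : Type*} [TopologicalSpace M] [ChartedSpace H M]
variable {W : Type*} [NormedAddCommGroup W] [NormedSpace ℝ W]
variable {E' : Type*} [NormedAddCommGroup E'] [NormedSpace ℝ E']
variable {H' : Type*} [TopologicalSpace H'] {J : ModelWithCorners ℝ E' H'}
variable {S : Type*} [TopologicalSpace S] [ChartedSpace H' S]

variable (I) in
/-- The derivative of the preferred chart at `x`. -/
def dChart (x p : M) : E →L[ℝ] E := mfderiv I 𝓘(ℝ, E) (extChartAt I x) p

variable (I) in
/-- The derivative of the inverse of the preferred chart at `x`. -/
def dChartSymm (x : M) (y : E) : E →L[ℝ] E :=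
  mfderivWithin 𝓘(ℝ, E) I (extChartAt I x).symm (range I) y

variable (I J) in
/-- The derivative of a map between manifolds. -/
def dMap (f : S → M) (p : S) : E' →L[ℝ] E := mfderiv J I f p

theorem dMap_id (p : M) : dMap I I id p = ContinuousLinearMap.id ℝ E := mfderiv_id

theorem pullback_id {k : ℕ} (α : M → E [⋀^Fin k]→L[ℝ] W) :
    pullback I I (id : M → M) α = α := by
  funext p
  exact (congrArg (α p).compContinuousLinearMap (dMap_id p)).trans rfl

section

variable [IsManifold I 1 M]

theorem dChartSymm_comp_dChart {x p : M} (hp : p ∈ (extChartAt I x).source) :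
    (dChartSymm I x (extChartAt I x p)).comp (dChart I x p) = ContinuousLinearMap.id ℝ E :=
  mfderivWithin_extChartAt_symm_comp_mfderiv_extChartAt' hp

theorem dChart_self (x : M) : dChart I x x = ContinuousLinearMap.id ℝ E :=
  mfderiv_extChartAt_self

theorem dChartSymm_self (x : M) :
    dChartSymm I x (extChartAt I x x) = ContinuousLinearMap.id ℝ E :=
  mfderivWithin_range_extChartAt_symm

theorem chartRep_self {k : ℕ} (α : M → E [⋀^Fin k]→L[ℝ] W) (x : M) :
    chartRep I α x (extChartAt I x x) = α x := by
  change (α ((extChartAt I x).symm (extChartAt I x x))).compContinuousLinearMap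
    (dChartSymm I x (extChartAt I x x)) = _
  rw [dChartSymm_self, extChartAt_to_inv]
  rfl

theorem eq_chartRep_comp_dChart {k : ℕ} (α : M → E [⋀^Fin k]→L[ℝ] W) {x p : M}
    (hp : p ∈ (extChartAt I x).source) :
    α p = (chartRep I α x (extChartAt I x p)).compContinuousLinearMap (dChart I x p) := by
  change _ = ((α ((extChartAt I x).symm (extChartAt I x p))).compContinuousLinearMap
    (dChartSymm I x (extChartAt I x p))).compContinuousLinearMap (dChart I x p)
  rw [(extChartAt I x).left_inv hp]
  change _ = (α p).compContinuousLinearMap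
    ((dChartSymm I x (extChartAt I x p)).comp (dChart I x p))
  rw [dChartSymm_comp_dChart hp]
  rfl

variable [IsManifold J 1 S]

theorem hasFDerivWithinAt_chart_comp {f : S → M} {x : S} {p : M} {y : E'}
    (hy : y ∈ (extChartAt J x).target) (hf : MDifferentiableAt J I f ((extChartAt J x).symm y))
    (hp : f ((extChartAt J x).symm y) ∈ (extChartAt I p).source) :
    HasFDerivWithinAt (extChartAt I p ∘ f ∘ (extChartAt J x).symm)
      ((dChart I p (f ((extChartAt J x).symm y))).comp
        ((dMap I J f ((extChartAt J x).symm y)).comp (dChartSymm J x y))) (range J) y := by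
  have h1 : HasMFDerivWithinAt 𝓘(ℝ, E') J (extChartAt J x).symm (range J) y _ :=
    (mdifferentiableWithinAt_extChartAt_symm hy).hasMFDerivWithinAt
  have h2 := hf.hasMFDerivAt
  have h3 := (mdifferentiableAt_extChartAt (I := I) (x := p)
    (y := f ((extChartAt J x).symm y)) (by rwa [← extChartAt_source I])).hasMFDerivAt
  have h4 := HasMFDerivAt.comp_hasMFDerivWithinAt y h3
    (HasMFDerivAt.comp_hasMFDerivWithinAt y h2 h1)
  exact hasMFDerivWithinAt_iff_hasFDerivWithinAt.1 h4

theorem fderivWithin_chart_comp {f : S → M} {x : S} {p : M} {y : E'}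
    (hy : y ∈ (extChartAt J x).target) (hf : MDifferentiableAt J I f ((extChartAt J x).symm y))
    (hp : f ((extChartAt J x).symm y) ∈ (extChartAt I p).source) :
    fderivWithin ℝ (extChartAt I p ∘ f ∘ (extChartAt J x).symm) (range J) y
      = (dChart I p (f ((extChartAt J x).symm y))).comp
        ((dMap I J f ((extChartAt J x).symm y)).comp (dChartSymm J x y)) :=
  (hasFDerivWithinAt_chart_comp hy hf hp).fderivWithin
    (J.uniqueDiffOn y (extChartAt_target_subset_range x hy))

/-- The chain rule. For f the identity this is the transformation law under change of charts, and it
is used in that form as well. -/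
theorem chartRep_pullback {k : ℕ} (α : M → E [⋀^Fin k]→L[ℝ] W) {f : S → M} {x : S} {p : M}
    {y : E'} (hy : y ∈ (extChartAt J x).target)
    (hf : MDifferentiableAt J I f ((extChartAt J x).symm y))
    (hp : f ((extChartAt J x).symm y) ∈ (extChartAt I p).source) :
    chartRep J (pullback I J f α) x y
      = (chartRep I α p ((extChartAt I p ∘ f ∘ (extChartAt J x).symm) y)).compContinuousLinearMap
        (fderivWithin ℝ (extChartAt I p ∘ f ∘ (extChartAt J x).symm) (range J) y) := by
  rw [fderivWithin_chart_comp hy hf hp]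
  change ((α (f ((extChartAt J x).symm y))).compContinuousLinearMap
    (dMap I J f ((extChartAt J x).symm y))).compContinuousLinearMap (dChartSymm J x y) = _
  rw [eq_chartRep_comp_dChart α hp]
  rfl

end

end Charts

end

section
open ContinuousAlternatingMap Filter Topology

/-! ### Smooth forms and the exterior derivative on manifolds with corners. -/

section SmoothForms

variable {E : Type*} [NormedAddCommGroup E] [NormedSpace ℝ E]
variable {H : Type*} [TopologicalSpace H] {I : ModelWithCorners ℝ E H}
variable {M : Type*} [TopologicalSpace M] [ChartedSpace H M]
variable {W : Type*} [NormedAddCommGroup W] [NormedSpace ℝ W]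

/-- The chart target is a neighbourhood of `y` within `range I`, and derivatives are taken within
the latter, where they are unique. -/
theorem IsSmoothForm.contDiffWithinAt {k : ℕ} {α : M → E [⋀^Fin k]→L[ℝ] W}
    (h : IsSmoothForm I α) {x : M} {y : E} (hy : y ∈ (extChartAt I x).target) :
    ContDiffWithinAt ℝ ∞ (chartRep I α x) (range I) y :=
  (h x y hy).mono_of_mem_nhdsWithin (extChartAt_target_mem_nhdsWithin_of_mem hy)

theorem IsSmoothForm.of_contDiffWithinAt {k : ℕ} {α : M → E [⋀^Fin k]→L[ℝ] W}
    (h : ∀ x, ∀ y ∈ (extChartAt I x).target, ContDiffWithinAt ℝ ∞ (chartRep I α x) (range I) y) :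
    IsSmoothForm I α :=
  fun x y hy => (h x y hy).mono (extChartAt_target_subset_range x)

theorem extChartAt_target_subset_closure_interior_range {x : M} {y : E}
    (hy : y ∈ (extChartAt I x).target) : y ∈ closure (interior (range I)) :=
  I.range_subset_closure_interior (extChartAt_target_subset_range x hy)

theorem uniqueDiffWithinAt_range {x : M} {y : E}
    (hy : y ∈ (extChartAt I x).target) : UniqueDiffWithinAt ℝ (range I) y :=
  I.uniqueDiffOn y (extChartAt_target_subset_range x hy)

theorem chartRep_add {k : ℕ} (α β : M → E [⋀^Fin k]→L[ℝ] W) (x : M) :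
    chartRep I (α + β) x = chartRep I α x + chartRep I β x := rfl

theorem chartRep_smul {k : ℕ} (c : ℝ) (α : M → E [⋀^Fin k]→L[ℝ] W) (x : M) :
    chartRep I (c • α) x = c • chartRep I α x := rfl

theorem IsSmoothForm.add {k : ℕ} {α β : M → E [⋀^Fin k]→L[ℝ] W} (hα : IsSmoothForm I α)
    (hβ : IsSmoothForm I β) : IsSmoothForm I (α + β) :=
  fun x => (hα x).add (hβ x)

theorem IsSmoothForm.const_smul {k : ℕ} {α : M → E [⋀^Fin k]→L[ℝ] W} (c : ℝ)
    (hα : IsSmoothForm I α) : IsSmoothForm I (c • α) :=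
  fun x => (contDiffOn_const (c := c)).smul (hα x)

theorem IsSmoothForm.sub {k : ℕ} {α β : M → E [⋀^Fin k]→L[ℝ] W} (hα : IsSmoothForm I α)
    (hβ : IsSmoothForm I β) : IsSmoothForm I (α - β) :=
  fun x => (hα x).sub (hβ x)

theorem IsSmoothForm.zero {k : ℕ} : IsSmoothForm I (0 : M → E [⋀^Fin k]→L[ℝ] W) :=
  fun _ => contDiffOn_const (c := (0 : E [⋀^Fin k]→L[ℝ] W))

theorem IsSmoothForm.sum {ι : Type*} {k : ℕ} (s : Finset ι) {α : ι → M → E [⋀^Fin k]→L[ℝ] W}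
    (hα : ∀ i ∈ s, IsSmoothForm I (α i)) : IsSmoothForm I (∑ i ∈ s, α i) := by
  classical
  induction s using Finset.induction_on with
  | empty => simpa using IsSmoothForm.zero
  | insert a s ha ih =>
    rw [Finset.sum_insert ha]
    exact (hα a (Finset.mem_insert_self a s)).add
      (ih fun i hi => hα i (Finset.mem_insert_of_mem hi))

variable [IsManifold I ∞ M]
variable {E' : Type*} [NormedAddCommGroup E'] [NormedSpace ℝ E']
variable {H' : Type*} [TopologicalSpace H'] {J : ModelWithCorners ℝ E' H'}
variable {S : Type*} [TopologicalSpace S] [ChartedSpace H' S] [IsManifold J ∞ S]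

theorem two_le_infty : minSmoothness ℝ 2 ≤ (∞ : WithTop ℕ∞) := by
  rw [minSmoothness_of_isRCLikeNormedField]
  exact WithTop.coe_le_coe.2 (le_top : (2 : ℕ∞) ≤ ⊤)

theorem contDiffWithinAt_chart_comp {f : S → M} {x : S} {p : M} {y : E'}
    (hy : y ∈ (extChartAt J x).target) (hf : ContMDiffAt J I ∞ f ((extChartAt J x).symm y))
    (hp : f ((extChartAt J x).symm y) ∈ (extChartAt I p).source) :
    ContDiffWithinAt ℝ ∞ (extChartAt I p ∘ f ∘ (extChartAt J x).symm) (range J) y := by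
  have h1 : ContMDiffWithinAt 𝓘(ℝ, E') J ∞ (extChartAt J x).symm (range J) y :=
    contMDiffWithinAt_extChartAt_symm_range x hy
  have h3 : ContMDiffAt I 𝓘(ℝ, E) ∞ (extChartAt I p) (f ((extChartAt J x).symm y)) :=
    contMDiffAt_extChartAt' (by rwa [← extChartAt_source I])
  exact (ContMDiffAt.comp_contMDiffWithinAt y h3
    (ContMDiffAt.comp_contMDiffWithinAt y hf h1)).contDiffWithinAt

theorem contDiffWithinAt_comp_chart_symm {f : M → W} {x : M} {y : E}
    (hy : y ∈ (extChartAt I x).target) (hf : ContMDiffAt I 𝓘(ℝ, W) ∞ f ((extChartAt I x).symm y)) :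
    ContDiffWithinAt ℝ ∞ (f ∘ (extChartAt I x).symm) (range I) y :=
  (ContMDiffAt.comp_contMDiffWithinAt y hf
    (contMDiffWithinAt_extChartAt_symm_range x hy)).contDiffWithinAt

theorem eventually_chartRep_pullback {k : ℕ} (α : M → E [⋀^Fin k]→L[ℝ] W) {f : S → M} {x : S}
    {p : M} {y : E'} (hy : y ∈ (extChartAt J x).target) (hf : ContMDiff J I ∞ f)
    (hp : f ((extChartAt J x).symm y) ∈ (extChartAt I p).source) :
    chartRep J (pullback I J f α) x =ᶠ[𝓝[range J] y] fun y =>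
      (chartRep I α p ((extChartAt I p ∘ f ∘ (extChartAt J x).symm) y)).compContinuousLinearMap
        (fderivWithin ℝ (extChartAt I p ∘ f ∘ (extChartAt J x).symm) (range J) y) := by
  have h1 : ContinuousWithinAt (f ∘ (extChartAt J x).symm) (range J) y :=
    hf.continuous.continuousAt.comp_continuousWithinAt
      (continuousAt_extChartAt_symm'' hy).continuousWithinAt
  have h2 := h1 ((isOpen_extChartAt_source (I := I) p).mem_nhds hp)
  filter_upwards [h2, extChartAt_target_mem_nhdsWithin_of_mem hy] with z hz hz'
  exact chartRep_pullback α hz' (hf.mdifferentiable (by simp) _) hz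

theorem contDiffWithinAt_chartRep_pullback {k : ℕ} {α : M → E [⋀^Fin k]→L[ℝ] W} {f : S → M} {x : S}
    {p : M} {y : E'} (hy : y ∈ (extChartAt J x).target) (hf : ContMDiff J I ∞ f)
    (hp : f ((extChartAt J x).symm y) ∈ (extChartAt I p).source)
    (hα : ContDiffWithinAt ℝ ∞ (chartRep I α p) (range I)
      (extChartAt I p (f ((extChartAt J x).symm y)))) :
    ContDiffWithinAt ℝ ∞ (chartRep J (pullback I J f α) x) (range J) y := by
  have hyr := extChartAt_target_subset_range x hy
  have hg := contDiffWithinAt_chart_comp hy hf.contMDiffAt hp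
  refine ContDiffWithinAt.congr_of_eventuallyEq_of_mem ?_
    (eventually_chartRep_pullback α hy hf hp) hyr
  have h1 : ContDiffWithinAt ℝ ∞
      (fun z => chartRep I α p ((extChartAt I p ∘ f ∘ (extChartAt J x).symm) z)) (range J) y :=
    ContDiffWithinAt.comp (g := chartRep I α p) y (t := range I) hα hg fun z _ => mem_range_self _
  have h2 := hg.fderivWithin_right (m := ∞) J.uniqueDiffOn (by simp) hyr
  exact contDiff_compContinuousLinearMap.contDiffAt.comp_contDiffWithinAt y (h1.prodMk h2)

/-- A form is smooth if each of its local expressions is smooth at the centre of the chart. -/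
theorem IsSmoothForm.of_center {k : ℕ} {α : M → E [⋀^Fin k]→L[ℝ] W}
    (h : ∀ x, ContDiffWithinAt ℝ ∞ (chartRep I α x) (range I) (extChartAt I x x)) :
    IsSmoothForm I α := by
  refine IsSmoothForm.of_contDiffWithinAt fun x y hy => ?_
  -- Pulling back by the identity compares the chart at `x` with the chart centred at the point in
  -- question.
  have := contDiffWithinAt_chartRep_pullback (α := α) (f := (id : M → M)) hy contMDiff_id
    (p := (extChartAt I x).symm y) (mem_extChartAt_source _) (h _)
  rwa [pullback_id] at this

theorem IsSmoothForm.pullback {k : ℕ} {α : M → E [⋀^Fin k]→L[ℝ] W} (hα : IsSmoothForm I α)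
    {f : S → M} (hf : ContMDiff J I ∞ f) : IsSmoothForm J (pullback I J f α) :=
  IsSmoothForm.of_contDiffWithinAt fun x y hy =>
    contDiffWithinAt_chartRep_pullback hy hf (p := f ((extChartAt J x).symm y))
      (mem_extChartAt_source _) (hα.contDiffWithinAt (mem_extChartAt_target _))

/-- Naturality of d in the model spaces, applied to the coordinate expression of f. Taking f = id
gives chart independence of d, and taking y at the centre gives d f^* = f^* d. -/
theorem extDerivWithin_chartRep_pullback {k : ℕ} {α : M → E [⋀^Fin k]→L[ℝ] W}
    (hα : IsSmoothForm I α) {f : S → M} (hf : ContMDiff J I ∞ f) {x : S} {y : E'}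
    (hy : y ∈ (extChartAt J x).target) :
    extDerivWithin (chartRep J (pullback I J f α) x) (range J) y
      = chartRep J (pullback I J f (extD I α)) x y := by
  have hyr := extChartAt_target_subset_range x hy
  set p := f ((extChartAt J x).symm y) with hp
  have hps : f ((extChartAt J x).symm y) ∈ (extChartAt I p).source := mem_extChartAt_source _
  rw [(eventually_chartRep_pullback α hy hf hps).extDerivWithin_eq_of_mem hyr]
  have hg := contDiffWithinAt_chart_comp hy hf.contMDiffAt hps
  have hd : DifferentiableWithinAt ℝ (chartRep I α p) (range I)
      ((extChartAt I p ∘ f ∘ (extChartAt J x).symm) y) :=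
    (hα.contDiffWithinAt (mem_extChartAt_target p)).differentiableWithinAt (by simp)
  rw [extDerivWithin_pullback hd hg two_le_infty J.uniqueDiffOn
    (extChartAt_target_subset_closure_interior_range hy) hyr
    (fun z _ => mem_range_self _),
    fderivWithin_chart_comp hy (hf.mdifferentiable (by simp) _) hps]
  rfl

/-- The exterior derivative does not depend on the chart. -/
theorem chartRep_extD {k : ℕ} {α : M → E [⋀^Fin k]→L[ℝ] W}
    (hα : IsSmoothForm I α) {x : M} {y : E} (hy : y ∈ (extChartAt I x).target) :
    chartRep I (extD I α) x y = extDerivWithin (chartRep I α x) (range I) y := by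
  have := extDerivWithin_chartRep_pullback hα (contMDiff_id (I := I) (M := M)) hy
  rw [pullback_id, pullback_id] at this
  exact this.symm

theorem extD_eq {k : ℕ} (α : M → E [⋀^Fin k]→L[ℝ] W) (x : M) :
    extD I α x = extDerivWithin (chartRep I α x) (range I) (extChartAt I x x) := by
  change (extDerivWithin (chartRep I α x) (range I) (extChartAt I x x)).compContinuousLinearMap
    (dChart I x x) = _
  rw [dChart_self]
  rfl

theorem extD_pullback {k : ℕ} {α : M → E [⋀^Fin k]→L[ℝ] W}
    (hα : IsSmoothForm I α) {f : S → M} (hf : ContMDiff J I ∞ f) :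
    extD J (pullback I J f α) = pullback I J f (extD I α) := by
  funext x
  rw [extD_eq, extDerivWithin_chartRep_pullback hα hf (mem_extChartAt_target x), chartRep_self]

/-- By definition `extD` uses a different chart at every point; chart independence lets a single
chart describe it on its whole target. -/
theorem IsSmoothForm.extD {k : ℕ} {α : M → E [⋀^Fin k]→L[ℝ] W} (hα : IsSmoothForm I α) :
    IsSmoothForm I (extD I α) := by
  refine IsSmoothForm.of_contDiffWithinAt fun x y hy => ?_
  have hyr := extChartAt_target_subset_range x hy
  have h1 := (hα.contDiffWithinAt hy).fderivWithin_right (m := ∞) I.uniqueDiffOn (by simp) hyr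
  have h2 : ContDiff ℝ ∞ (fun L : E →L[ℝ] E [⋀^Fin k]→L[ℝ] W => alternatizeUncurryFin L) := by
    let L : (E →L[ℝ] E [⋀^Fin k]→L[ℝ] W) →L[ℝ] E [⋀^Fin (k + 1)]→L[ℝ] W :=
      alternatizeUncurryFinCLM ℝ E W
    exact ContinuousLinearMap.contDiff (𝕜 := ℝ) (E := E →L[ℝ] E [⋀^Fin k]→L[ℝ] W)
      (F := E [⋀^Fin (k + 1)]→L[ℝ] W) L
  have h2 : ContDiffWithinAt ℝ ∞ (fun z => extDerivWithin (chartRep I α x) (range I) z)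
      (range I) y := h2.contDiffAt.comp_contDiffWithinAt y h1
  refine h2.congr_of_eventuallyEq_of_mem ?_ hyr
  filter_upwards [extChartAt_target_mem_nhdsWithin_of_mem hy] with z hz
  exact chartRep_extD hα hz

theorem extD_extD {k : ℕ} {α : M → E [⋀^Fin k]→L[ℝ] W} (hα : IsSmoothForm I α) :
    extD I (extD I α) = 0 := by
  funext x
  have hy := mem_extChartAt_target (I := I) x
  have hyr := extChartAt_target_subset_range x hy
  have h : chartRep I (Transgression.extD I α) x =ᶠ[𝓝[range I] (extChartAt I x x)]
      extDerivWithin (chartRep I α x) (range I) := by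
    filter_upwards [extChartAt_target_mem_nhdsWithin_of_mem hy] with z hz
    exact chartRep_extD hα hz
  rw [extD_eq, h.extDerivWithin_eq_of_mem hyr]
  exact extDerivWithin_extDerivWithin_apply (hα.contDiffWithinAt hy) two_le_infty I.uniqueDiffOn
    (extChartAt_target_subset_closure_interior_range hy) hyr

/-! ### Pointwise operations -/

theorem IsSmoothForm.fun_smul {k : ℕ} {α : M → E [⋀^Fin k]→L[ℝ] W} (hα : IsSmoothForm I α)
    {f : M → ℝ} (hf : ContMDiff I 𝓘(ℝ, ℝ) ∞ f) : IsSmoothForm I (fun x => f x • α x) := by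
  refine IsSmoothForm.of_contDiffWithinAt fun x y hy => ?_
  exact (contDiffWithinAt_comp_chart_symm hy hf.contMDiffAt).smul (hα.contDiffWithinAt hy)

theorem IsSmoothForm.zeroForm {f : M → W} (hf : ContMDiff I 𝓘(ℝ, W) ∞ f) :
    IsSmoothForm I (zeroForm (E := E) f) := by
  refine IsSmoothForm.of_contDiffWithinAt fun x y hy => ?_
  exact (constOfIsEmptyLIE ℝ E W (Fin 0)).contDiff.contDiffAt.comp_contDiffWithinAt y
    (contDiffWithinAt_comp_chart_symm hy hf.contMDiffAt)

theorem extD_add {k : ℕ} {α β : M → E [⋀^Fin k]→L[ℝ] W} (hα : IsSmoothForm I α)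
    (hβ : IsSmoothForm I β) : extD I (α + β) = extD I α + extD I β := by
  funext x
  have hy := mem_extChartAt_target (I := I) x
  rw [Pi.add_apply, extD_eq, extD_eq, extD_eq, chartRep_add]
  exact extDerivWithin_add (uniqueDiffWithinAt_range hy)
    ((hα.contDiffWithinAt hy).differentiableWithinAt (by simp))
    ((hβ.contDiffWithinAt hy).differentiableWithinAt (by simp))

theorem extD_smul {k : ℕ} (c : ℝ) (α : M → E [⋀^Fin k]→L[ℝ] W) :
    extD I (c • α) = c • extD I α := by
  funext x
  have hy := mem_extChartAt_target (I := I) x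
  rw [Pi.smul_apply, extD_eq, extD_eq, chartRep_smul]
  exact extDerivWithin_smul c _ (uniqueDiffWithinAt_range hy)

theorem extD_sub {k : ℕ} {α β : M → E [⋀^Fin k]→L[ℝ] W} (hα : IsSmoothForm I α)
    (hβ : IsSmoothForm I β) : extD I (α - β) = extD I α - extD I β := by
  rw [show α - β = α + (-1 : ℝ) • β by rw [neg_one_smul, sub_eq_add_neg],
    extD_add hα (hβ.const_smul _), extD_smul, neg_one_smul, sub_eq_add_neg]

theorem extD_zero {k : ℕ} : extD I (0 : M → E [⋀^Fin k]→L[ℝ] W) = 0 := by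
  have := extD_smul (I := I) 0 (0 : M → E [⋀^Fin k]→L[ℝ] W)
  simpa using this

theorem extD_sum {ι : Type*} {k : ℕ} (s : Finset ι) {α : ι → M → E [⋀^Fin k]→L[ℝ] W}
    (hα : ∀ i ∈ s, IsSmoothForm I (α i)) :
    extD I (∑ i ∈ s, α i) = ∑ i ∈ s, extD I (α i) := by
  classical
  induction s using Finset.induction_on with
  | empty => simpa using extD_zero
  | insert a s ha ih =>
    rw [Finset.sum_insert ha, Finset.sum_insert ha, extD_add (hα a (Finset.mem_insert_self a s))
      (IsSmoothForm.sum s fun i hi => hα i (Finset.mem_insert_of_mem hi)),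
      ih fun i hi => hα i (Finset.mem_insert_of_mem hi)]

/-! ### Contraction with a vector field -/

variable {ξ : ∀ x : M, TangentSpace I x}

theorem chartRep_contract {k : ℕ} (α : M → E [⋀^Fin (k + 1)]→L[ℝ] W) {x : M} {y : E}
    (hy : y ∈ (extChartAt I x).target) :
    chartRep I (contract I ξ α) x y = (chartRep I α x y).curryLeft
      (dChart I x ((extChartAt I x).symm y) (ξ ((extChartAt I x).symm y))) := by
  ext v
  set p := (extChartAt I x).symm y with hp
  have hps : p ∈ (extChartAt I x).source := (extChartAt I x).map_target hy
  have hxy : extChartAt I x p = y := (extChartAt I x).right_inv hy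
  change α p (Matrix.vecCons (ξ p) (dChartSymm I x y ∘ v))
    = α p (dChartSymm I x y ∘ Matrix.vecCons (dChart I x p (ξ p)) v)
  have h1 := DFunLike.congr_fun (dChartSymm_comp_dChart (I := I) hps) (ξ p)
  rw [hxy] at h1
  congr 1
  funext i
  refine Fin.cases ?_ (fun j => rfl) i
  exact h1.symm

/-- Smoothness of a section of the tangent bundle means smoothness in the trivialization at `x`,
whose fibre maps are the derivatives of the chart at `x`. -/
theorem contDiffWithinAt_dChart_section
    (hξ : ContMDiff I I.tangent ∞ (fun x => (⟨x, ξ x⟩ : TangentBundle I M))) (x : M) :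
    ContDiffWithinAt ℝ ∞ (fun y => dChart I x ((extChartAt I x).symm y)
      (ξ ((extChartAt I x).symm y))) (range I) (extChartAt I x x) := by
  have hy := mem_extChartAt_target (I := I) x
  have h1 := (Bundle.contMDiffAt_section x).1 (hξ x)
  have h2 : ContMDiffAt I 𝓘(ℝ, E) ∞ (fun p => dChart I x p (ξ p)) x := by
    refine h1.congr_of_eventuallyEq ?_
    filter_upwards [(isOpen_extChartAt_source (I := I) x).mem_nhds (mem_extChartAt_source x)]
      with p hp
    have hp' : p ∈ (chartAt H x).source := by rwa [← extChartAt_source I]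
    have h3 := TangentBundle.continuousLinearMapAt_trivializationAt (I := I) hp'
    change (mfderiv I 𝓘(ℝ, E) (extChartAt I x) p : E →L[ℝ] E) (ξ p) = _
    rw [← h3]
    exact Bundle.Trivialization.continuousLinearMapAt_apply_of_mem (R := ℝ)
      (trivializationAt E (TangentSpace I) x) (by simpa using hp') (ξ p)
  have h3 : ContMDiffAt I 𝓘(ℝ, E) ∞ (fun p => dChart I x p (ξ p))
      ((extChartAt I x).symm (extChartAt I x x)) := by rwa [extChartAt_to_inv]
  exact contDiffWithinAt_comp_chart_symm hy h3

theorem IsSmoothForm.contract {k : ℕ} {α : M → E [⋀^Fin (k + 1)]→L[ℝ] W} (hα : IsSmoothForm I α)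
    (hξ : ContMDiff I I.tangent ∞ (fun x => (⟨x, ξ x⟩ : TangentBundle I M))) :
    IsSmoothForm I (contract I ξ α) := by
  refine IsSmoothForm.of_center fun x => ?_
  have hy := mem_extChartAt_target (I := I) x
  have h0 : ContDiff ℝ ∞ (fun Z : E [⋀^Fin (k + 1)]→L[ℝ] W => Z.curryLeft) := by
    let L : (E [⋀^Fin (k + 1)]→L[ℝ] W) →ₗᵢ[ℝ] (E →L[ℝ] E [⋀^Fin k]→L[ℝ] W) := curryLeftLI
    exact LinearIsometry.contDiff (𝕜 := ℝ) (E := E [⋀^Fin (k + 1)]→L[ℝ] W)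
      (F := E →L[ℝ] E [⋀^Fin k]→L[ℝ] W) L
  have h1 := h0.contDiffAt.comp_contDiffWithinAt (extChartAt I x x) (hα.contDiffWithinAt hy)
  have h2 := h1.clm_apply (contDiffWithinAt_dChart_section hξ x)
  refine h2.congr_of_eventuallyEq_of_mem ?_ (extChartAt_target_subset_range x hy)
  filter_upwards [extChartAt_target_mem_nhdsWithin_of_mem hy] with z hz
  exact chartRep_contract α hz

/-! ### Functions -/

theorem extD_zeroForm_apply {f : M → W} (hf : ContMDiff I 𝓘(ℝ, W) ∞ f) (x : M) (v : Fin 1 → E) :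
    extD I (zeroForm f) x v = (mfderiv I 𝓘(ℝ, W) f x : E →L[ℝ] W) (v 0) := by
  have hy := mem_extChartAt_target (I := I) x
  rw [extD_eq]
  have h1 : chartRep I (zeroForm f) x
      = fun y => constOfIsEmpty ℝ E (Fin 0) ((f ∘ (extChartAt I x).symm) y) := rfl
  rw [h1, extDerivWithin_constOfIsEmpty _ (uniqueDiffWithinAt_range hy)]
  have h2 := (hf.mdifferentiable (by simp) x).mfderiv
  rw [h2]
  rfl

end SmoothForms

end

section
open ContinuousAlternatingMap Filter Topology

/-! ### Bianchi, Ricci and Cartan identities at a point. -/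

section LowDegree

variable {E : Type*} [NormedAddCommGroup E] [NormedSpace ℝ E]
variable {W : Type*} [NormedAddCommGroup W] [NormedSpace ℝ W]
variable {𝔤 : Type*} [NormedAddCommGroup 𝔤] [NormedSpace ℝ 𝔤] [FiniteDimensional ℝ 𝔤]
  [NormedLieAlg 𝔤]
variable {p : ℕ}

theorem apply_fin_one (β : E [⋀^Fin 1]→L[ℝ] W) (w : Fin 1 → E) : β w = β fun _ => w 0 :=
  congrArg β (funext fun i => by rw [Subsingleton.elim i 0])

theorem alternatizeUncurryFin_one (f : E →L[ℝ] E [⋀^Fin 0]→L[ℝ] W) (v : Fin 1 → E) :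
    alternatizeUncurryFin f v = f (v 0) 0 := by
  rw [alternatizeUncurryFin_apply_real]
  simp [Subsingleton.elim (Fin.removeNth 0 v) 0]

theorem alternatizeUncurryFin_two (f : E →L[ℝ] E [⋀^Fin 1]→L[ℝ] W) (v : Fin 2 → E) :
    alternatizeUncurryFin f v = f (v 0) (fun _ => v 1) - f (v 1) (fun _ => v 0) := by
  rw [alternatizeUncurryFin_apply_real, Fin.sum_univ_two, apply_fin_one (f (v 0)),
    apply_fin_one (f (v 1))]
  simp [Fin.removeNth, sub_eq_add_neg]

theorem alternatizeUncurryFin_three (f : E →L[ℝ] E [⋀^Fin 2]→L[ℝ] W) (v : Fin 3 → E) :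
    alternatizeUncurryFin f v
      = f (v 0) ![v 1, v 2] - f (v 1) ![v 0, v 2] + f (v 2) ![v 0, v 1] := by
  rw [alternatizeUncurryFin_apply_real, Fin.sum_univ_three]
  have h0 : Fin.removeNth 0 v = ![v 1, v 2] := by ext i; fin_cases i <;> rfl
  have h1 : Fin.removeNth 1 v = ![v 0, v 2] := by ext i; fin_cases i <;> rfl
  have h2 : Fin.removeNth 2 v = ![v 0, v 1] := by ext i; fin_cases i <;> rfl
  rw [h0, h1, h2]
  simp [sub_eq_add_neg]

theorem adForm_add_left (α β : E [⋀^Fin 1]→L[ℝ] 𝔤) (Z : E [⋀^Fin p]→L[ℝ] 𝔤) :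
    adForm (α + β) Z = adForm α Z + adForm β Z := by
  ext v w
  simp [adForm_apply]

theorem adForm_smul_left (c : ℝ) (α : E [⋀^Fin 1]→L[ℝ] 𝔤) (Z : E [⋀^Fin p]→L[ℝ] 𝔤) :
    adForm (c • α) Z = c • adForm α Z := by
  ext v w
  simp [adForm_apply]

theorem adForm_add_right (α : E [⋀^Fin 1]→L[ℝ] 𝔤) (Z Z' : E [⋀^Fin p]→L[ℝ] 𝔤) :
    adForm α (Z + Z') = adForm α Z + adForm α Z' := by
  ext v w
  simp [adForm_apply]

theorem adForm_smul_right (c : ℝ) (α : E [⋀^Fin 1]→L[ℝ] 𝔤) (Z : E [⋀^Fin p]→L[ℝ] 𝔤) :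
    adForm α (c • Z) = c • adForm α Z := by
  ext v w
  simp [adForm_apply]

theorem alternatizeUncurryFin_adForm_comm (α β : E [⋀^Fin 1]→L[ℝ] 𝔤) :
    alternatizeUncurryFin (adForm α β) = alternatizeUncurryFin (adForm β α) := by
  ext v
  simp only [alternatizeUncurryFin_two, adForm_apply, adj_apply]
  rw [← lie_skew (β _) (α fun _ => v 0), ← lie_skew (β _) (α fun _ => v 1)]
  abel

/-- The Bianchi identity at a point. -/
theorem bianchi_aux (α : E [⋀^Fin 1]→L[ℝ] 𝔤) (α' : E →L[ℝ] E [⋀^Fin 1]→L[ℝ] 𝔤)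
    (f : E →L[ℝ] E [⋀^Fin 2]→L[ℝ] 𝔤)
    (hf : ∀ v, f v = alternatizeUncurryFin (adForm α (α' v))) :
    alternatizeUncurryFin f + alternatizeUncurryFin (adForm α (alternatizeUncurryFin α'
      + (1 / 2 : ℝ) • alternatizeUncurryFin (adForm α α))) = 0 := by
  ext v
  change _ = (0 : 𝔤)
  simp only [ContinuousAlternatingMap.add_apply, ContinuousAlternatingMap.smul_apply,
    alternatizeUncurryFin_three, alternatizeUncurryFin_two, hf, adForm_apply, adj_apply,
    Matrix.cons_val_zero, Matrix.cons_val_one, lie_add,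
    lie_sub, lie_smul]
  -- The derivative terms cancel between the two summands. What is left is the Jacobi identity for
  -- the three values of α; the other relations only reorder brackets.
  have h1 := leibniz_lie (α fun _ => v 0) (α fun _ => v 1) (α fun _ => v 2)
  have h2 := lie_skew (α fun _ => v 2) ⁅α fun _ => v 0, α fun _ => v 1⁆
  have h3 := congrArg (fun z => ⁅α fun _ => v 0, z⁆) (lie_skew (α fun _ => v 2) (α fun _ => v 1))
  have h4 := congrArg (fun z => ⁅α fun _ => v 1, z⁆) (lie_skew (α fun _ => v 2) (α fun _ => v 0))
  have h5 := congrArg (fun z => ⁅α fun _ => v 2, z⁆) (lie_skew (α fun _ => v 1) (α fun _ => v 0))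
  simp only [lie_neg] at h3 h4 h5
  linear_combination (norm := module) (1 : ℝ) • h1 - (1 : ℝ) • h2 + (1 / 2 : ℝ) • h3 - (1 / 2 : ℝ) • h4
    + (1 / 2 : ℝ) • h5

/-- The identity `D_A D_A z = [F, z]` at a point. -/
theorem ricci_aux (α : E [⋀^Fin 1]→L[ℝ] 𝔤) (α' : E →L[ℝ] E [⋀^Fin 1]→L[ℝ] 𝔤)
    (z : E [⋀^Fin 0]→L[ℝ] 𝔤) (z' : E →L[ℝ] E [⋀^Fin 0]→L[ℝ] 𝔤)
    (f : E →L[ℝ] E [⋀^Fin 1]→L[ℝ] 𝔤)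
    (hf : ∀ v, f v = alternatizeUncurryFin (adForm (α' v) z)
      + alternatizeUncurryFin (adForm α (z' v))) :
    alternatizeUncurryFin f + alternatizeUncurryFin (adForm α (alternatizeUncurryFin z'
      + alternatizeUncurryFin (adForm α z)))
      = -adj (z 0) (alternatizeUncurryFin α'
        + (1 / 2 : ℝ) • alternatizeUncurryFin (adForm α α)) := by
  ext v
  simp only [ContinuousAlternatingMap.add_apply, ContinuousAlternatingMap.smul_apply,
    alternatizeUncurryFin_one, alternatizeUncurryFin_two, hf, adForm_apply, adj_apply,
    ContinuousAlternatingMap.neg_apply, lie_add, lie_sub, lie_smul]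
  -- Jacobi for two values of α and z handles the quadratic terms; the terms with z' cancel and
  -- those with α' need only skew-symmetry.
  have h1 := leibniz_lie (α fun _ => v 0) (α fun _ => v 1) (z 0)
  have h2 := lie_skew (z 0) ⁅α fun _ => v 0, α fun _ => v 1⁆
  have h3 := congrArg (fun y => ⁅z 0, y⁆) (lie_skew (α fun _ => v 1) (α fun _ => v 0))
  have h4 := lie_skew (z 0) (α' (v 0) fun _ => v 1)
  have h5 := lie_skew (z 0) (α' (v 1) fun _ => v 0)
  simp only [lie_neg] at h3
  linear_combination (norm := module) (1 : ℝ) • h1 - (1 : ℝ) • h2 + (1 / 2 : ℝ) • h3 - (1 : ℝ) • h4 + (1 : ℝ) • h5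

/-- Cartan's formula at a point. -/
theorem cartan_aux (α : E [⋀^Fin 1]→L[ℝ] 𝔤) (β : E [⋀^Fin 2]→L[ℝ] 𝔤) (u : E) :
    β.curryLeft u = alternatizeUncurryFin (adForm α (α.curryLeft u))
      + (β + (1 / 2 : ℝ) • alternatizeUncurryFin (adForm α α)).curryLeft u := by
  ext v
  have e1 : Matrix.vecCons u (0 : Fin 0 → E) = fun _ => u :=
    funext fun i => by rw [Subsingleton.elim i 0]; rfl
  have e2 : Matrix.vecCons u v 1 = v 0 := rfl
  simp only [ContinuousAlternatingMap.add_apply, ContinuousAlternatingMap.smul_apply,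
    curryLeft_apply_apply, alternatizeUncurryFin_one, alternatizeUncurryFin_two,
    adForm_apply, adj_apply, Matrix.cons_val_zero, e1, e2]
  have h1 := lie_skew (α fun _ => v 0) (α fun _ => u)
  linear_combination (norm := module) (1 / 2 : ℝ) • h1

end LowDegree

/-! ### Covariant exterior calculus on the manifold. -/

section Calculus

variable {E : Type*} [NormedAddCommGroup E] [NormedSpace ℝ E]
variable {H : Type*} [TopologicalSpace H] {I : ModelWithCorners ℝ E H}
variable {M : Type*} [TopologicalSpace M] [ChartedSpace H M] 
variable {W : Type*} [NormedAddCommGroup W] [NormedSpace ℝ W]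
variable {𝔤 : Type*} [NormedAddCommGroup 𝔤] [NormedSpace ℝ 𝔤] 
variable {V : Type*} [NormedAddCommGroup V] [NormedSpace ℝ V]
variable {p q m N : ℕ} {P : ContinuousMultilinearMap ℝ (fun _ : Fin (m + 2) => 𝔤) V}

theorem chartRep_angle (h : p + q + 2 * m = N) (a : M → E [⋀^Fin p]→L[ℝ] 𝔤)
    (b : M → E [⋀^Fin q]→L[ℝ] 𝔤) (F : M → E [⋀^Fin 2]→L[ℝ] 𝔤) (x : M) :
    chartRep I (fun x => angle P h (a x) (b x) (F x)) x
      = fun y => angle P h (chartRep I a x y) (chartRep I b x y) (chartRep I F x y) :=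
  funext fun _ => angle_compContinuousLinearMap P h _ _ _ _

theorem IsSmoothForm.angle (h : p + q + 2 * m = N) {a : M → E [⋀^Fin p]→L[ℝ] 𝔤}
    {b : M → E [⋀^Fin q]→L[ℝ] 𝔤} {F : M → E [⋀^Fin 2]→L[ℝ] 𝔤} (ha : IsSmoothForm I a)
    (hb : IsSmoothForm I b) (hF : IsSmoothForm I F) :
    IsSmoothForm I (fun x => angle P h (a x) (b x) (F x)) := by
  intro x
  rw [chartRep_angle]
  have h1 : ContDiffOn ℝ ∞ (fun y => triple m (chartRep I a x y) (chartRep I b x y)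
      (chartRep I F x y)) (extChartAt I x).target := by
    rw [contDiffOn_pi]
    exact Fin.cases (ha x) (Fin.cases (hb x) fun i => hF x)
  exact (polyFormCMM (E := E) P (sum_degs h)).contDiff.comp_contDiffOn h1

variable (I) in
/-- The derivative at `x` of the local expression of `α` in the preferred chart at `x`. -/
def jet {k : ℕ} (α : M → E [⋀^Fin k]→L[ℝ] W) (x : M) : E →L[ℝ] E [⋀^Fin k]→L[ℝ] W :=
  fderivWithin ℝ (chartRep I α x) (range I) (extChartAt I x x)

theorem IsSmoothForm.hasFDerivWithinAt {k : ℕ} {α : M → E [⋀^Fin k]→L[ℝ] W}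
    (h : IsSmoothForm I α) (x : M) :
    HasFDerivWithinAt (chartRep I α x) (jet I α x) (range I) (extChartAt I x x) :=
  ((h.contDiffWithinAt (mem_extChartAt_target x)).differentiableWithinAt
    (by simp)).hasFDerivWithinAt

section Lie

variable [FiniteDimensional ℝ 𝔤] [NormedLieAlg 𝔤]

variable (I) in
/-- The covariant exterior derivative `D_A Z = dZ + [A, Z]`. -/
def covDer (A : M → E [⋀^Fin 1]→L[ℝ] 𝔤) (Z : M → E [⋀^Fin p]→L[ℝ] 𝔤) (x : M) :
    E [⋀^Fin (p + 1)]→L[ℝ] 𝔤 :=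
  extD I Z x + alternatizeUncurryFin (adForm (A x) (Z x))

theorem IsSmoothForm.lieWedge {N : ℕ} (h : p + q = N) {a : M → E [⋀^Fin p]→L[ℝ] 𝔤}
    {b : M → E [⋀^Fin q]→L[ℝ] 𝔤} (ha : IsSmoothForm I a) (hb : IsSmoothForm I b) :
    IsSmoothForm I (fun x => lieWedge h (a x) (b x)) :=
  IsSmoothForm.angle _ ha hb IsSmoothForm.zero

theorem curvature_eq (A : M → E [⋀^Fin 1]→L[ℝ] 𝔤) (x : M) :
    curvature I A x = extD I A x + (1 / 2 : ℝ) • alternatizeUncurryFin (adForm (A x) (A x)) := by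
  rw [curvature, lieWedge_one_left]

theorem covD_eq (A : M → E [⋀^Fin 1]→L[ℝ] 𝔤) (l : M → 𝔤) :
    covD I A l = covDer I A (zeroForm l) := by
  funext x
  rw [covD, lieWedge_one_left]
  rfl

variable {ξ : ∀ x : M, TangentSpace I x}

theorem lieD_eq (A : M → E [⋀^Fin 1]→L[ℝ] 𝔤) (x : M) :
    lieD I ξ A x = covDer I A (contract I ξ A) x + (curvature I A x).curryLeft (ξ x) := by
  rw [lieD, Pi.add_apply, covDer, curvature_eq, add_assoc]
  exact congrArg _ (cartan_aux (A x) (extD I A x) (ξ x))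

end Lie

variable [IsManifold I ∞ M]

theorem extD_eq_jet {k : ℕ} (α : M → E [⋀^Fin k]→L[ℝ] W) (x : M) :
    extD I α x = alternatizeUncurryFin (jet I α x) :=
  extD_eq α x

theorem jet_angle (h : p + q + 2 * m = N) {a : M → E [⋀^Fin p]→L[ℝ] 𝔤}
    {b : M → E [⋀^Fin q]→L[ℝ] 𝔤} {F : M → E [⋀^Fin 2]→L[ℝ] 𝔤} (ha : IsSmoothForm I a)
    (hb : IsSmoothForm I b) (hF : IsSmoothForm I F) (x : M) :
    jet I (fun x => Transgression.angle P h (a x) (b x) (F x)) x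
      = angleDeriv P h (a x) (b x) (F x) (jet I a x) (jet I b x) (jet I F x) := by
  have h1 := hasFDerivWithinAt_angle P h (ha.hasFDerivWithinAt x) (hb.hasFDerivWithinAt x)
    (hF.hasFDerivWithinAt x)
  rw [chartRep_self, chartRep_self, chartRep_self] at h1
  rw [jet, chartRep_angle]
  exact h1.fderivWithin (uniqueDiffWithinAt_range (mem_extChartAt_target x))

variable [FiniteDimensional ℝ 𝔤] [NormedLieAlg 𝔤]

variable {A B : M → E [⋀^Fin 1]→L[ℝ] 𝔤}

/-- The bracket is `angle` with m = 0, so its derivative has no terms from 2-form slots. -/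
theorem jet_lieWedge_apply {N : ℕ} (h : p + q = N) {a : M → E [⋀^Fin p]→L[ℝ] 𝔤}
    {b : M → E [⋀^Fin q]→L[ℝ] 𝔤} (ha : IsSmoothForm I a) (hb : IsSmoothForm I b) (x : M) (v : E) :
    jet I (fun x => Transgression.lieWedge h (a x) (b x)) x v
      = Transgression.lieWedge h (jet I a x v) (b x)
        + Transgression.lieWedge h (a x) (jet I b x v) := by
  have := jet_angle (P := lieMap 𝔤) (by omega : p + q + 2 * 0 = N) ha hb
    (IsSmoothForm.zero (I := I)) x
  refine (congrArg (fun f => f v) this).trans ?_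
  rw [angleDeriv_apply]
  simp [angleVar, Transgression.lieWedge]

theorem IsSmoothForm.covDer (hA : IsSmoothForm I A) {Z : M → E [⋀^Fin p]→L[ℝ] 𝔤}
    (hZ : IsSmoothForm I Z) : IsSmoothForm I (covDer I A Z) := by
  have h1 := IsSmoothForm.lieWedge (by omega : 1 + p = p + 1) hA hZ
  simp only [lieWedge_one_left] at h1
  exact hZ.extD.add h1

theorem IsSmoothForm.curvature (hA : IsSmoothForm I A) : IsSmoothForm I (curvature I A) :=
  hA.extD.add ((IsSmoothForm.lieWedge _ hA hA).const_smul _)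

/-- As d²A = 0, only the derivative of ½[A, A] remains; the bracket of 1-forms is symmetric, so this
is [A, ∂A], the shape handled by `bianchi_aux`. -/
theorem covDer_curvature (hA : IsSmoothForm I A) (x : M) :
    covDer I A (Transgression.curvature I A) x = 0 := by
  have h1 := IsSmoothForm.lieWedge (by norm_num : 1 + 1 = 2) hA hA
  have h2 : Transgression.curvature I A = Transgression.extD I A + (1 / 2 : ℝ) •
      fun x => Transgression.lieWedge (by norm_num : 1 + 1 = 2) (A x) (A x) := rfl
  have h3 : extD I (Transgression.curvature I A) x = alternatizeUncurryFin ((1 / 2 : ℝ) • jet I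
      (fun x => Transgression.lieWedge (by norm_num : 1 + 1 = 2) (A x) (A x)) x) := by
    rw [h2, extD_add hA.extD (h1.const_smul _), extD_extD hA, zero_add, extD_smul, Pi.smul_apply,
      extD_eq_jet, alternatizeUncurryFin_smul]
  rw [covDer, h3, curvature_eq, extD_eq_jet A]
  refine bianchi_aux _ _ _ fun v => ?_
  rw [_root_.smul_apply, jet_lieWedge_apply _ hA hA, lieWedge_one_left, lieWedge_one_left,
    alternatizeUncurryFin_adForm_comm (jet I A x v)]
  module

/-- Here D_A D_A z = [F, z] = -[z, F]. This is the variation of the curvature under the gauge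
transformation with parameter z. -/
theorem covDer_covDer (hA : IsSmoothForm I A) {z : M → E [⋀^Fin 0]→L[ℝ] 𝔤}
    (hz : IsSmoothForm I z) (x : M) :
    covDer I A (covDer I A z) x = -adj (z x 0) (Transgression.curvature I A x) := by
  have h1 := IsSmoothForm.lieWedge (by norm_num : 1 + 0 = 1) hA hz
  have h2 : covDer I A z = Transgression.extD I z +
      fun x => Transgression.lieWedge (by norm_num : 1 + 0 = 1) (A x) (z x) := by
    funext x
    rw [Pi.add_apply, lieWedge_one_left]
    rfl
  have h3 : extD I (covDer I A z) x = alternatizeUncurryFin (jet I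
      (fun x => Transgression.lieWedge (by norm_num : 1 + 0 = 1) (A x) (z x)) x) := by
    rw [h2, extD_add hz.extD h1, extD_extD hz, Pi.add_apply, Pi.zero_apply]
    exact (zero_add _).trans (extD_eq_jet _ x)
  rw [covDer, h3, curvature_eq, extD_eq_jet A]
  conv_lhs => rw [covDer, extD_eq_jet z]
  refine ricci_aux _ _ _ _ _ fun v => ?_
  rw [jet_lieWedge_apply _ hA hz, lieWedge_one_left, lieWedge_one_left]

/-- The covariant Leibniz rule for `⟨a b F^m⟩` with `D_A F = 0`. -/
theorem extD_angle (hP : IsInvariantPolynomial P) (h : p + q + 2 * m = N)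
    (h₁ : p + 1 + q + 2 * m = N + 1) (h₂ : p + (q + 1) + 2 * m = N + 1)
    {a : M → E [⋀^Fin p]→L[ℝ] 𝔤} {b : M → E [⋀^Fin q]→L[ℝ] 𝔤} (hA : IsSmoothForm I A)
    (ha : IsSmoothForm I a) (hb : IsSmoothForm I b) (x : M) :
    extD I (fun x => angle P h (a x) (b x) (curvature I A x)) x
      = angle P h₁ (covDer I A a x) (b x) (curvature I A x)
        + (-1 : ℝ) ^ p • angle P h₂ (a x) (covDer I A b x) (curvature I A x) := by
  have hF := covDer_curvature hA x
  rw [covDer, extD_eq_jet] at hF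
  rw [extD_eq_jet, jet_angle h ha hb hA.curvature,
    hP.alternatizeUncurryFin_angleDeriv h h₁ h₂ (A x) _ _ _ _ _ _ hF, covDer, covDer,
    extD_eq_jet, extD_eq_jet]

/-- Curvature is quadratic in the connection; the two mixed brackets are equal and combine with the
factor ½ into the covariant derivative. -/
theorem curvature_add_smul (hA : IsSmoothForm I A) (hB : IsSmoothForm I B) (s : ℝ) (x : M) :
    curvature I (A + s • B) x = curvature I A x + s • covDer I A B x
      + s ^ 2 • (1 / 2 : ℝ) • alternatizeUncurryFin (adForm (B x) (B x)) := by
  rw [curvature_eq, curvature_eq, covDer, extD_add hA (hB.const_smul s), extD_smul]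
  simp only [Pi.add_apply, Pi.smul_apply, adForm_add_left, adForm_add_right, adForm_smul_left,
    adForm_smul_right, alternatizeUncurryFin_add, alternatizeUncurryFin_smul,
    alternatizeUncurryFin_adForm_comm (B x) (A x)]
  module

end Calculus

end

/-! ### Separable families: parameter integrals and derivatives as finite sums. -/

section
open ContinuousAlternatingMap Filter Topology

theorem integral_sum_smul {U : Type*} [NormedAddCommGroup U] [NormedSpace ℝ U] [CompleteSpace U]
    {ι : Type*} [Fintype ι] (r : ι → ℝ) {g : ι → ℝ → ℝ} (hg : ∀ i, Continuous (g i)) (c : ι → U) :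
    (∫ t in (0 : ℝ)..1, ∑ i, (r i * g i t) • c i)
      = ∑ i, (r i * ∫ t in (0 : ℝ)..1, g i t) • c i := by
  have h : ∀ i ∈ Finset.univ, IntervalIntegrable (fun t => (r i * g i t) • c i) volume 0 1 :=
    fun i _ => ((continuous_const.mul (hg i)).smul continuous_const).intervalIntegrable _ _
  rw [intervalIntegral.integral_finsetSum h]
  simp [intervalIntegral.integral_smul_const, intervalIntegral.integral_const_mul]

theorem hasDerivAt_sum_smul {U : Type*} [NormedAddCommGroup U] [NormedSpace ℝ U]
    {ι : Type*} [Fintype ι] {f : ι → ℝ → ℝ} (hf : ∀ i, Differentiable ℝ (f i)) (c : ι → U) (s : ℝ) :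
    HasDerivAt (fun s => ∑ i, f i s • c i) (∑ i, deriv (f i) s • c i) s :=
  HasDerivAt.fun_sum fun i _ => (hf i s).hasDerivAt.smul_const _

theorem integral_add_smul {U : Type*} [NormedAddCommGroup U] [NormedSpace ℝ U] {f g : ℝ → U}
    (hf : Continuous f) (hg : Continuous g) (r : ℝ) :
    (∫ t in (0 : ℝ)..1, (f t + r • g t))
      = (∫ t in (0 : ℝ)..1, f t) + r • ∫ t in (0 : ℝ)..1, g t := by
  have h : IntervalIntegrable (fun t => r • g t) volume 0 1 :=
    (hg.const_smul r).intervalIntegrable _ _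
  rw [intervalIntegral.integral_add (hf.intervalIntegrable _ _) h, intervalIntegral.integral_smul]

theorem curryLeft_sum_smul {E W ι : Type*} [NormedAddCommGroup E] [NormedSpace ℝ E]
    [NormedAddCommGroup W] [NormedSpace ℝ W] [Fintype ι] {k : ℕ} (r : ι → ℝ)
    (c : ι → E [⋀^Fin (k + 1)]→L[ℝ] W) (u : E) :
    (∑ i, r i • c i).curryLeft u = ∑ i, r i • (c i).curryLeft u := by
  ext v
  simp [ContinuousAlternatingMap.sum_apply]

section Families

variable {E : Type*} [NormedAddCommGroup E] [NormedSpace ℝ E]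
variable {H : Type*} [TopologicalSpace H] {I : ModelWithCorners ℝ E H}
variable {M : Type*} [TopologicalSpace M] [ChartedSpace H M]
variable {W : Type*} [NormedAddCommGroup W] [NormedSpace ℝ W]
variable {k : ℕ}

variable (I) in
/-- Families `G s t = ∑ᵢ fᵢ(s) gᵢ(t) cᵢ` of forms, with smooth `fᵢ`, continuous `gᵢ` and smooth
forms `cᵢ`. -/
def IsSeparable (G : ℝ → ℝ → M → E [⋀^Fin k]→L[ℝ] W) : Prop :=
  ∃ (ι : Type) (_ : Fintype ι) (f g : ι → ℝ → ℝ) (c : ι → M → E [⋀^Fin k]→L[ℝ] W),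
    (∀ i, Differentiable ℝ (f i)) ∧ (∀ i, Continuous (g i)) ∧ (∀ i, IsSmoothForm I (c i)) ∧
      ∀ s t x, G s t x = ∑ i, (f i s * g i t) • c i x

namespace IsSeparable

variable {G G' : ℝ → ℝ → M → E [⋀^Fin k]→L[ℝ] W}

theorem const {α : M → E [⋀^Fin k]→L[ℝ] W} (hα : IsSmoothForm I α) :
    IsSeparable I (fun _ _ => α) :=
  ⟨Unit, inferInstance, fun _ _ => 1, fun _ _ => 1, fun _ => α, fun _ => differentiable_const _,
    fun _ => continuous_const, fun _ => hα, fun s t x => by simp⟩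

theorem add (hG : IsSeparable I G) (hG' : IsSeparable I G') :
    IsSeparable I (fun s t => G s t + G' s t) := by
  obtain ⟨ι, _, f, g, c, hf, hg, hc, h⟩ := hG
  obtain ⟨ι', _, f', g', c', hf', hg', hc', h'⟩ := hG'
  refine ⟨ι ⊕ ι', inferInstance, Sum.elim f f', Sum.elim g g', Sum.elim c c', ?_, ?_, ?_, ?_⟩
  · exact Sum.rec hf hf'
  · exact Sum.rec hg hg'
  · exact Sum.rec hc hc'
  · intro s t x
    simp [h, h']

theorem fun_smul (hG : IsSeparable I G) {f₀ g₀ : ℝ → ℝ} (hf₀ : Differentiable ℝ f₀)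
    (hg₀ : Continuous g₀) : IsSeparable I (fun s t => (f₀ s * g₀ t) • G s t) := by
  obtain ⟨ι, _, f, g, c, hf, hg, hc, h⟩ := hG
  refine ⟨ι, inferInstance, fun i s => f₀ s * f i s, fun i t => g₀ t * g i t, c,
    fun i => hf₀.mul (hf i), fun i => hg₀.mul (hg i), hc, fun s t x => ?_⟩
  change (f₀ s * g₀ t) • G s t x = _
  rw [h, Finset.smul_sum]
  refine Finset.sum_congr rfl fun i _ => ?_
  rw [smul_smul, mul_mul_mul_comm]

theorem smul_left (hG : IsSeparable I G) : IsSeparable I (fun s t => s • G s t) := by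
  simpa using hG.fun_smul (f₀ := fun s => s) (g₀ := fun _ => 1) differentiable_id continuous_const

theorem smul_right (hG : IsSeparable I G) : IsSeparable I (fun s t => t • G s t) := by
  simpa using hG.fun_smul (f₀ := fun _ => 1) (g₀ := fun t => t) (differentiable_const _)
    continuous_id

theorem const_smul (r : ℝ) (hG : IsSeparable I G) : IsSeparable I (fun s t => r • G s t) := by
  simpa using hG.fun_smul (f₀ := fun _ => r) (g₀ := fun _ => 1) (differentiable_const _)
    continuous_const

theorem sub (hG : IsSeparable I G) (hG' : IsSeparable I G') :
    IsSeparable I (fun s t => G s t - G' s t) := by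
  simpa [sub_eq_add_neg] using hG.add (hG'.const_smul (-1))

theorem contract {G : ℝ → ℝ → M → E [⋀^Fin (k + 1)]→L[ℝ] W} [IsManifold I ∞ M]
    {ξ : ∀ x : M, TangentSpace I x}
    (hξ : ContMDiff I I.tangent ∞ (fun x => (⟨x, ξ x⟩ : TangentBundle I M)))
    (hG : IsSeparable I G) : IsSeparable I (fun s t => contract I ξ (G s t)) := by
  obtain ⟨ι, _, f, g, c, hf, hg, hc, h⟩ := hG
  refine ⟨ι, inferInstance, f, g, fun i => Transgression.contract I ξ (c i), hf, hg,
    fun i => (hc i).contract hξ, fun s t x => ?_⟩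
  change (G s t x).curryLeft (ξ x) = ∑ i, (f i s * g i t) • (c i x).curryLeft (ξ x)
  have e : G s t x = ∑ i, (f i s * g i t) • c i x := h s t x
  rw [e]
  exact curryLeft_sum_smul _ _ _

theorem extD [IsManifold I ∞ M] (hG : IsSeparable I G) :
    IsSeparable I (fun s t => extD I (G s t)) := by
  obtain ⟨ι, _, f, g, c, hf, hg, hc, h⟩ := hG
  refine ⟨ι, inferInstance, f, g, fun i => Transgression.extD I (c i), hf, hg,
    fun i => (hc i).extD, fun s t x => ?_⟩
  have h1 : G s t = ∑ i, (f i s * g i t) • c i := by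
    funext x
    simp [h]
  change Transgression.extD I (G s t) x = _
  rw [h1, extD_sum _ fun i _ => (hc i).const_smul _]
  simp [extD_smul]

/-- Multilinear expansion: the new index set is the product of the old ones and the coefficients
multiply. -/
theorem polyForm {𝔤 : Type*} [NormedAddCommGroup 𝔤] [NormedSpace ℝ 𝔤] {r N : ℕ}
    (P : ContinuousMultilinearMap ℝ (fun _ : Fin r => 𝔤) W) {d : Fin r → ℕ} (h : ∑ i, d i = N)
    {Z : ∀ i, ℝ → ℝ → M → E [⋀^Fin (d i)]→L[ℝ] 𝔤} (hZ : ∀ i, IsSeparable I (Z i)) :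
    IsSeparable I (fun s t x => polyForm P h fun i => Z i s t x) := by
  choose ι hι f g c hf hg hc hZ using hZ
  classical
  refine ⟨∀ i, ι i, inferInstance, fun j s => ∏ i, f i (j i) s, fun j t => ∏ i, g i (j i) t,
    fun j x => Transgression.polyForm P h fun i => c i (j i) x, fun j => ?_, fun j => ?_,
    fun j => ?_, fun s t x => ?_⟩
  · exact Differentiable.fun_finsetProd fun i _ => hf i (j i)
  · exact continuous_finsetProd _ fun i _ => hg i (j i)
  · intro x
    have h1 : ContDiffOn ℝ ∞ (fun y i => chartRep I (c i (j i)) x y) (extChartAt I x).target := by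
      rw [contDiffOn_pi]
      exact fun i => hc i (j i) x
    refine ((polyFormCMM (E := E) P h).contDiff.comp_contDiffOn h1).congr fun y _ => ?_
    exact polyForm_compContinuousLinearMap P h _ _
  · have h1 : (fun i => Z i s t x) = fun i => ∑ j, (f i j s * g i j t) • c i j x :=
      funext fun i => hZ i s t x
    change Transgression.polyForm P h (fun i => Z i s t x) = _
    rw [h1]
    refine ((polyFormCMM (E := E) P h).map_sum _).trans (Finset.sum_congr rfl fun j _ => ?_)
    rw [ContinuousMultilinearMap.map_smul_univ, Finset.prod_mul_distrib]
    rfl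

section Angle

variable {𝔤 : Type*} [NormedAddCommGroup 𝔤] [NormedSpace ℝ 𝔤] {p q m N : ℕ}
variable {a : ℝ → ℝ → M → E [⋀^Fin p]→L[ℝ] 𝔤} {b : ℝ → ℝ → M → E [⋀^Fin q]→L[ℝ] 𝔤}
  {F : ℝ → ℝ → M → E [⋀^Fin 2]→L[ℝ] 𝔤}

theorem angle (P : ContinuousMultilinearMap ℝ (fun _ : Fin (m + 2) => 𝔤) W)
    (h : p + q + 2 * m = N) (ha : IsSeparable I a) (hb : IsSeparable I b) (hF : IsSeparable I F) :
    IsSeparable I (fun s t x => angle P h (a s t x) (b s t x) (F s t x)) := by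
  let Z (i : Fin (m + 2)) (s t : ℝ) (x : M) := triple m (a s t x) (b s t x) (F s t x) i
  exact polyForm P (sum_degs h) (Z := Z) (Fin.cases ha (Fin.cases hb fun _ => hF))

theorem lieWedge [FiniteDimensional ℝ 𝔤] [NormedLieAlg 𝔤] (h : p + q = N)
    (ha : IsSeparable I a) (hb : IsSeparable I b) :
    IsSeparable I (fun s t x => lieWedge h (a s t x) (b s t x)) :=
  angle _ _ ha hb (const IsSmoothForm.zero)

theorem covDer [IsManifold I ∞ M] [FiniteDimensional ℝ 𝔤] [NormedLieAlg 𝔤]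
    {A : ℝ → ℝ → M → E [⋀^Fin 1]→L[ℝ] 𝔤} (hA : IsSeparable I A) (ha : IsSeparable I a) :
    IsSeparable I (fun s t => covDer I (A s t) (a s t)) := by
  have h1 := lieWedge (by omega : 1 + p = p + 1) hA ha
  simp only [lieWedge_one_left] at h1
  exact ha.extD.add h1

theorem curvature [IsManifold I ∞ M] [FiniteDimensional ℝ 𝔤] [NormedLieAlg 𝔤]
    {A : ℝ → ℝ → M → E [⋀^Fin 1]→L[ℝ] 𝔤} (hA : IsSeparable I A) :
    IsSeparable I (fun s t => curvature I (A s t)) :=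
  hA.extD.add ((lieWedge _ hA hA).const_smul _)

theorem interp [FiniteDimensional ℝ 𝔤] [NormedLieAlg 𝔤] {A Ab : ℝ → ℝ → M → E [⋀^Fin 1]→L[ℝ] 𝔤} (hA : IsSeparable I A)
    (hAb : IsSeparable I Ab) : IsSeparable I (fun s t => interp (A s t) (Ab s t) t) :=
  hAb.add (hA.sub hAb).smul_right

end Angle

theorem isSmoothForm (hG : IsSeparable I G) (s t : ℝ) : IsSmoothForm I (G s t) := by
  obtain ⟨ι, _, f, g, c, hf, hg, hc, h⟩ := hG
  have h1 : G s t = ∑ i, (f i s * g i t) • c i := by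
    funext x
    simp [h]
  rw [h1]
  exact IsSmoothForm.sum _ fun i _ => (hc i).const_smul _

theorem continuous (hG : IsSeparable I G) (s : ℝ) (x : M) : Continuous (fun t => G s t x) := by
  obtain ⟨ι, _, f, g, c, hf, hg, hc, h⟩ := hG
  simp only [h]
  exact continuous_finsetSum _ fun i _ => (continuous_const.mul (hg i)).smul continuous_const

theorem intervalIntegrable (hG : IsSeparable I G) (s : ℝ) (x : M) :
    IntervalIntegrable (fun t => G s t x) volume 0 1 :=
  (hG.continuous s x).intervalIntegrable _ _

variable [CompleteSpace W]

/-- The integral of a separable family over `t`. -/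
theorem exists_integral_eq (hG : IsSeparable I G) :
    ∃ (ι : Type) (_ : Fintype ι) (f : ι → ℝ → ℝ) (c : ι → M → E [⋀^Fin k]→L[ℝ] W),
      (∀ i, Differentiable ℝ (f i)) ∧ (∀ i, IsSmoothForm I (c i)) ∧
        ∀ s, (fun x => ∫ t in (0 : ℝ)..1, G s t x) = ∑ i, f i s • c i := by
  obtain ⟨ι, _, f, g, c, hf, hg, hc, h⟩ := hG
  refine ⟨ι, inferInstance, f, fun i => (∫ t in (0 : ℝ)..1, g i t) • c i, hf,
    fun i => (hc i).const_smul _, fun s => funext fun x => ?_⟩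
  simp only [h, integral_sum_smul _ hg]
  simp [smul_smul]

theorem isSmoothForm_integral (hG : IsSeparable I G) (s : ℝ) :
    IsSmoothForm I (fun x => ∫ t in (0 : ℝ)..1, G s t x) := by
  obtain ⟨ι, _, f, c, hf, hc, h⟩ := hG.exists_integral_eq
  rw [h s]
  exact IsSmoothForm.sum _ fun i _ => (hc i).const_smul _

/-- Integration over t touches only finitely many scalar coefficients, so the exchange is linearity
of d. -/
theorem extD_integral [IsManifold I ∞ M] (hG : IsSeparable I G) (s : ℝ) (x : M) :
    Transgression.extD I (fun x => ∫ t in (0 : ℝ)..1, G s t x) x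
      = ∫ t in (0 : ℝ)..1, Transgression.extD I (G s t) x := by
  obtain ⟨ι, _, f, g, c, hf, hg, hc, h⟩ := hG
  have h1 : ∀ t, G s t = ∑ i, (f i s * g i t) • c i := fun t => by
    funext x
    simp [h]
  have h4 : (fun x => ∫ t in (0 : ℝ)..1, G s t x)
      = ∑ i, (f i s * ∫ t in (0 : ℝ)..1, g i t) • c i := by
    funext x
    simp only [h, integral_sum_smul _ hg]
    simp
  have h5 : ∀ t, Transgression.extD I (G s t) x
      = ∑ i, (f i s * g i t) • Transgression.extD I (c i) x := fun t => by
    rw [h1, extD_sum _ fun i _ => (hc i).const_smul _]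
    simp [extD_smul]
  rw [h4, extD_sum _ fun i _ => (hc i).const_smul _]
  simp only [h5, integral_sum_smul _ hg]
  simp [extD_smul]

/-- By uniqueness of derivatives, G' must be the separable sum with the f_i differentiated; hence no
domination argument is needed. -/
theorem hasDerivAt_integral (hG : IsSeparable I G) {G' : ℝ → E [⋀^Fin k]→L[ℝ] W} (x : M)
    (h' : ∀ t, HasDerivAt (fun s => G s t x) (G' t) 0) :
    HasDerivAt (fun s => ∫ t in (0 : ℝ)..1, G s t x) (∫ t in (0 : ℝ)..1, G' t) 0 := by
  obtain ⟨ι, _, f, g, c, hf, hg, hc, h⟩ := hG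
  have h3 : ∀ t, G' t = ∑ i, (deriv (f i) 0 * g i t) • c i x := fun t => by
    refine (h' t).unique ?_
    simp only [h, mul_smul]
    exact hasDerivAt_sum_smul hf (fun i => g i t • c i x) 0
  simp only [h, h3, integral_sum_smul _ hg]
  simp only [mul_smul]
  exact hasDerivAt_sum_smul hf _ 0

/-- A functional that is linear on smooth forms may be differentiated along a separable family. -/
theorem hasDerivAt_functional (hG : IsSeparable I G) {U : Type*} [NormedAddCommGroup U]
    [NormedSpace ℝ U] (Λ : (M → E [⋀^Fin k]→L[ℝ] W) → U)
    (hadd : ∀ α β, IsSmoothForm I α → IsSmoothForm I β → Λ (α + β) = Λ α + Λ β)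
    (hsmul : ∀ (r : ℝ) (α), IsSmoothForm I α → Λ (r • α) = r • Λ α)
    {Φ : M → E [⋀^Fin k]→L[ℝ] W}
    (hΦ : ∀ x, HasDerivAt (fun s => ∫ t in (0 : ℝ)..1, G s t x) (Φ x) 0) :
    HasDerivAt (fun s => Λ (fun x => ∫ t in (0 : ℝ)..1, G s t x)) (Λ Φ) 0 := by
  obtain ⟨ι, _, f, c, hf, hc, h⟩ := hG.exists_integral_eq
  have hΛ : ∀ r : ι → ℝ, Λ (∑ i, r i • c i) = ∑ i, r i • Λ (c i) := by
    classical
    intro r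
    have hz : Λ 0 = 0 := by simpa using hsmul 0 0 IsSmoothForm.zero
    have : ∀ s : Finset ι, Λ (∑ i ∈ s, r i • c i) = ∑ i ∈ s, r i • Λ (c i) := by
      intro s
      induction s using Finset.induction_on with
      | empty => simpa using hz
      | insert j s hj ih =>
        rw [Finset.sum_insert hj, Finset.sum_insert hj, hadd _ _ ((hc j).const_smul _)
          (IsSmoothForm.sum _ fun i _ => (hc i).const_smul _), ih, hsmul _ _ (hc j)]
    exact this _
  -- The pointwise derivative already determines Φ as a combination of the same smooth forms, so no
  -- topology on the space of forms is involved.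
  have h1 : Φ = ∑ i, deriv (f i) 0 • c i := by
    funext x
    refine (hΦ x).unique ?_
    have h2 : (fun s => ∫ t in (0 : ℝ)..1, G s t x) = fun s => ∑ i, f i s • c i x :=
      funext fun s => by simpa using congrFun (h s) x
    rw [h2, Finset.sum_apply]
    exact hasDerivAt_sum_smul hf _ 0
  simp only [h, h1, hΛ]
  exact hasDerivAt_sum_smul hf _ 0

theorem contract_integral {G : ℝ → ℝ → M → E [⋀^Fin (k + 1)]→L[ℝ] W}
    (hG : IsSeparable I G) (ξ : ∀ x : M, TangentSpace I x) (s : ℝ) (x : M) :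
    Transgression.contract I ξ (fun x => ∫ t in (0 : ℝ)..1, G s t x) x
      = ∫ t in (0 : ℝ)..1, Transgression.contract I ξ (G s t) x := by
  obtain ⟨ι, _, f, g, c, hf, hg, hc, h⟩ := hG
  have h3 : ∀ r : ι → ℝ, (∑ i, r i • c i x).curryLeft (ξ x : E)
      = ∑ i, r i • Transgression.contract I ξ (c i) x := fun r => curryLeft_sum_smul _ _ _
  have h2 : ∀ t, Transgression.contract I ξ (G s t) x
      = ∑ i, (f i s * g i t) • Transgression.contract I ξ (c i) x := fun t => by
    rw [← h3, ← h]
    rfl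
  change (∫ t in (0 : ℝ)..1, G s t x).curryLeft (ξ x : E) = _
  simp only [h, h2, integral_sum_smul _ hg, h3]

end IsSeparable

end Families

end

section
open ContinuousAlternatingMap Filter Topology

/-! ### The transgression identity and the variation of the Lagrangian. -/

section Identities

variable {E : Type*} [NormedAddCommGroup E] [NormedSpace ℝ E]
variable {H : Type*} [TopologicalSpace H] {I : ModelWithCorners ℝ E H}
variable {M : Type*} [TopologicalSpace M] [ChartedSpace H M]
variable {𝔤 : Type*} [NormedAddCommGroup 𝔤] [NormedSpace ℝ 𝔤]
variable {V : Type*} [NormedAddCommGroup V] [NormedSpace ℝ V]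
variable {p q m N : ℕ} {P : ContinuousMultilinearMap ℝ (fun _ : Fin (m + 2) => 𝔤) V}
variable {A Ab a ab B : M → E [⋀^Fin 1]→L[ℝ] 𝔤}

theorem angle_add_left (P : ContinuousMultilinearMap ℝ (fun _ : Fin (m + 2) => 𝔤) V)
    (h : p + q + 2 * m = N) (a a' : E [⋀^Fin p]→L[ℝ] 𝔤)
    (b : E [⋀^Fin q]→L[ℝ] 𝔤) (F : E [⋀^Fin 2]→L[ℝ] 𝔤) :
    angle P h (a + a') b F = angle P h a b F + angle P h a' b F := by
  simp only [← angleLeft_apply, map_add]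

theorem angle_zero_left (P : ContinuousMultilinearMap ℝ (fun _ : Fin (m + 2) => 𝔤) V)
    (h : p + q + 2 * m = N) (b : E [⋀^Fin q]→L[ℝ] 𝔤) (F : E [⋀^Fin 2]→L[ℝ] 𝔤) :
    angle P h 0 b F = 0 := by
  simp only [← angleLeft_apply, _root_.map_zero]

theorem angle_zero_mid (P : ContinuousMultilinearMap ℝ (fun _ : Fin (m + 2) => 𝔤) V)
    (h : p + q + 2 * m = N) (a : E [⋀^Fin p]→L[ℝ] 𝔤) (F : E [⋀^Fin 2]→L[ℝ] 𝔤) :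
    angle P h a 0 F = 0 := by
  simp only [← angleMid_apply, _root_.map_zero]

theorem interp_eq_add {M : Type*} [NormedLieAlg 𝔤] (A Ab : M → E [⋀^Fin 1]→L[ℝ] 𝔤) (t s : ℝ) :
    interp A Ab s = interp A Ab t + (s - t) • (A - Ab) := by
  simp only [interp]
  module

theorem IsSmoothForm.interp [NormedLieAlg 𝔤] (hA : IsSmoothForm I A) (hAb : IsSmoothForm I Ab) (t : ℝ) :
    IsSmoothForm I (interp A Ab t) :=
  hAb.add ((hA.sub hAb).const_smul t)

variable [FiniteDimensional ℝ 𝔤] [NormedLieAlg 𝔤]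

theorem isSeparable_interp (hA : IsSmoothForm I A) (hAb : IsSmoothForm I Ab) :
    IsSeparable I (fun _ t => Transgression.interp A Ab t) :=
  IsSeparable.interp (.const hA) (.const hAb)

variable [IsManifold I ∞ M]

theorem hasDerivAt_curvature_line (hA : IsSmoothForm I A) (hB : IsSmoothForm I B) (x : M) :
    HasDerivAt (fun s : ℝ => curvature I (A + s • B) x) (covDer I A B x) 0 := by
  simp only [curvature_add_smul hA hB]
  have h1 := ((hasDerivAt_id' (0 : ℝ)).smul_const (covDer I A B x)).const_add (curvature I A x)
  have h2 := ((hasDerivAt_id' (0 : ℝ)).fun_pow 2).smul_const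
    ((1 / 2 : ℝ) • alternatizeUncurryFin (adForm (B x) (B x)))
  refine (h1.fun_add h2).congr_deriv ?_
  simp

theorem hasDerivAt_curvature_interp (hA : IsSmoothForm I A) (hAb : IsSmoothForm I Ab) (x : M)
    (t : ℝ) : HasDerivAt (fun t => curvature I (interp A Ab t) x)
      (covDer I (interp A Ab t) (A - Ab) x) t := by
  have h := hasDerivAt_curvature_line (hA.interp hAb t) (hA.sub hAb) x
  have h' : HasDerivAt (fun s : ℝ => curvature I (interp A Ab t + s • (A - Ab)) x)
      (covDer I (interp A Ab t) (A - Ab) x) (t - t) := by rwa [sub_self]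
  refine (h'.comp_sub_const t t).congr_of_eventuallyEq (Eventually.of_forall fun s => ?_)
  exact congrArg (fun B => curvature I B x) (interp_eq_add A Ab t s)

/-- The transgression formula: `⟨z F^n⟩` is integrated along the segment of connections. -/
theorem integral_transgression [CompleteSpace V] (hP : IsInvariantPolynomial P)
    (hA : IsSmoothForm I A) (hAb : IsSmoothForm I Ab)
    {z ζ : ℝ → M → E [⋀^Fin p]→L[ℝ] 𝔤} (hz : IsSeparable I (fun _ => z))
    (hζ : IsSeparable I (fun _ => ζ)) (hd : ∀ t x, HasDerivAt (fun t => z t x) (ζ t x) t)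
    (h : p + 2 + 2 * m = N) (x : M) :
    angle P h (z 1 x) (curvature I A x) (curvature I A x)
        - angle P h (z 0 x) (curvature I Ab x) (curvature I Ab x)
      = (∫ t in (0 : ℝ)..1, angle P h (ζ t x) (curvature I (interp A Ab t) x)
            (curvature I (interp A Ab t) x))
        + (m + 1 : ℝ) • ∫ t in (0 : ℝ)..1, angle P h (z t x)
            (covDer I (interp A Ab t) (A - Ab) x) (curvature I (interp A Ab t) x) := by
  have hF : IsSeparable I (fun _ t => curvature I (interp A Ab t)) :=
    (isSeparable_interp hA hAb).curvature
  have hD : IsSeparable I (fun _ t => covDer I (interp A Ab t) (A - Ab)) :=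
    (isSeparable_interp hA hAb).covDer (.const (hA.sub hAb))
  have s1 := IsSeparable.angle P h hζ hF hF
  have s2 := IsSeparable.angle P h hz hD hF
  have h1 : ∀ t, HasDerivAt (fun t => angle P h (z t x) (curvature I (interp A Ab t) x)
      (curvature I (interp A Ab t) x))
      (angle P h (ζ t x) (curvature I (interp A Ab t) x) (curvature I (interp A Ab t) x)
        + (m + 1 : ℝ) • angle P h (z t x)
            (covDer I (interp A Ab t) (A - Ab) x) (curvature I (interp A Ab t) x)) t := by
    intro t
    have h2 := hasDerivAt_angle P h (hd t x) (hasDerivAt_curvature_interp hA hAb x t)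
      (hasDerivAt_curvature_interp hA hAb x t)
    -- The curvature in the second slot contributes once and those in the other slots m times,
    -- whence m + 1.
    rw [angleVar_eq_smul_angle hP.symm] at h2
    convert h2 using 1
    module
  have i0 : interp A Ab 0 = Ab := by simp [interp]
  have i1 : interp A Ab 1 = A := by simp [interp]
  have h3 := intervalIntegral.integral_eq_sub_of_hasDerivAt (fun t _ => h1 t)
    ((s1.intervalIntegrable 0 x).add ((s2.const_smul (m + 1 : ℝ)).intervalIntegrable 0 x))
  rw [i0, i1] at h3
  rw [← h3, integral_add_smul (s1.continuous 0 x) (s2.continuous 0 x)]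

/-- The exterior derivative of `∫₀¹ dt ⟨z_t Θ F_t^{n-1}⟩`. -/
theorem extD_integral_angle [CompleteSpace V] (hP : IsInvariantPolynomial P)
    (hA : IsSmoothForm I A) (hAb : IsSmoothForm I Ab)
    {z : ℝ → M → E [⋀^Fin p]→L[ℝ] 𝔤} (hz : IsSeparable I (fun _ => z))
    (h : p + 1 + 2 * m = N) (h₁ : p + 1 + 1 + 2 * m = N + 1) (h₂ : p + 2 + 2 * m = N + 1) (x : M) :
    extD I (fun x => ∫ t in (0 : ℝ)..1,
        angle P h (z t x) ((A - Ab) x) (curvature I (interp A Ab t) x)) x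
      = (∫ t in (0 : ℝ)..1, angle P h₁ (covDer I (interp A Ab t) (z t) x) ((A - Ab) x)
            (curvature I (interp A Ab t) x))
        + (-1 : ℝ) ^ p • ∫ t in (0 : ℝ)..1, angle P h₂ (z t x)
            (covDer I (interp A Ab t) (A - Ab) x) (curvature I (interp A Ab t) x) := by
  have hi := isSeparable_interp hA hAb
  have hΘ : IsSeparable I (fun _ _ => A - Ab) := .const (hA.sub hAb)
  have s0 := IsSeparable.angle P h hz hΘ hi.curvature
  have s1 := IsSeparable.angle P h₁ (hi.covDer hz) hΘ hi.curvature
  have s2 := IsSeparable.angle P h₂ hz (hi.covDer hΘ) hi.curvature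
  rw [s0.extD_integral 0 x]
  have h3 : ∀ t : ℝ, extD I (fun x =>
      angle P h (z t x) ((A - Ab) x) (curvature I (interp A Ab t) x)) x
      = angle P h₁ (covDer I (interp A Ab t) (z t) x) ((A - Ab) x) (curvature I (interp A Ab t) x)
        + (-1 : ℝ) ^ p • angle P h₂ (z t x)
            (covDer I (interp A Ab t) (A - Ab) x) (curvature I (interp A Ab t) x) := fun t =>
    extD_angle hP h h₁ h₂ (hA.interp hAb t) (hz.isSmoothForm 0 t) (hA.sub hAb) x
  rw [intervalIntegral.integral_congr fun t _ => h3 t,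
    integral_add_smul (s1.continuous 0 x) (s2.continuous 0 x)]

/-- The two preceding formulas combined. -/
theorem smul_extD_integral_angle [CompleteSpace V] (hP : IsInvariantPolynomial P)
    (hA : IsSmoothForm I A) (hAb : IsSmoothForm I Ab)
    {z ζ : ℝ → M → E [⋀^Fin p]→L[ℝ] 𝔤} (hz : IsSeparable I (fun _ => z))
    (hζ : IsSeparable I (fun _ => ζ)) (hd : ∀ t x, HasDerivAt (fun t => z t x) (ζ t x) t)
    (h : p + 1 + 2 * m = N) (h₁ : p + 1 + 1 + 2 * m = N + 1) (h₂ : p + 2 + 2 * m = N + 1)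
    (k : ℝ) (x : M) :
    (k * (m + 1) * (m + 2)) • extD I (fun x => ∫ t in (0 : ℝ)..1,
        angle P h (z t x) ((A - Ab) x) (curvature I (interp A Ab t) x)) x
      = (k * (m + 1) * (m + 2)) • (∫ t in (0 : ℝ)..1,
          angle P h₁ (covDer I (interp A Ab t) (z t) x) ((A - Ab) x)
            (curvature I (interp A Ab t) x))
        + (-1 : ℝ) ^ p • ((k * (m + 2)) •
          (angle P h₂ (z 1 x) (curvature I A x) (curvature I A x)
            - angle P h₂ (z 0 x) (curvature I Ab x) (curvature I Ab x))
          - (k * (m + 2)) • ∫ t in (0 : ℝ)..1, angle P h₂ (ζ t x)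
              (curvature I (interp A Ab t) x) (curvature I (interp A Ab t) x)) := by
  -- The integral of ⟨z_t D_tΘ F_t^m⟩ occurs in both formulas and is eliminated.
  rw [extD_integral_angle hP hA hAb hz h h₁ h₂, integral_transgression hP hA hAb hz hζ hd h₂]
  module

/-- The variation of the transgression Lagrangian. -/
theorem hasDerivAt_lagrangian [CompleteSpace V] (hP : IsInvariantPolynomial P)
    (hA : IsSmoothForm I A) (hAb : IsSmoothForm I Ab) (ha : IsSmoothForm I a)
    (hab : IsSmoothForm I ab) (k : ℝ) (x : M) :
    HasDerivAt (fun s : ℝ => lagrangian I k P (A + s • a) (Ab + s • ab) x)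
      (eulerLagrange I k P A Ab a ab x + extD I (boundaryTerm I k P A Ab a ab) x) 0 := by
  have hi := isSeparable_interp hA hAb
  have hΘ : IsSeparable I (fun _ _ => A - Ab) := .const (hA.sub hAb)
  have hAs : IsSeparable I (fun s _ => A + s • a) := (IsSeparable.const hA).add
    (IsSeparable.const ha).smul_left
  have hAbs : IsSeparable I (fun s _ => Ab + s • ab) := (IsSeparable.const hAb).add
    (IsSeparable.const hab).smul_left
  have h12 : 1 + 2 + 2 * m = 2 * m + 1 + 1 + 1 := by omega
  have h21 : 1 + 1 + 1 + 2 * m = 2 * m + 1 + 1 + 1 := by omega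
  have h11 : 1 + 1 + 2 * m = 2 * m + 1 + 1 := by omega
  have hG := IsSeparable.angle P h12 (hAs.sub hAbs) (hAs.interp hAbs).curvature
    (hAs.interp hAbs).curvature
  have hint : ∀ s t : ℝ, interp (A + s • a) (Ab + s • ab) t
      = interp A Ab t + s • interp a ab t := fun s t => by
    simp only [interp]
    module
  have hd : ∀ t : ℝ, HasDerivAt (fun s : ℝ => angle P h12
      ((A + s • a - (Ab + s • ab)) x) (curvature I (interp (A + s • a) (Ab + s • ab) t) x)
      (curvature I (interp (A + s • a) (Ab + s • ab) t) x))
      (angle P h12 ((a - ab) x) (curvature I (interp A Ab t) x) (curvature I (interp A Ab t) x)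
        + (m + 1 : ℝ) • angle P h21 (covDer I (interp A Ab t) (interp a ab t) x) ((A - Ab) x)
          (curvature I (interp A Ab t) x)) 0 := by
    intro t
    have d1 : HasDerivAt (fun s : ℝ => (A + s • a - (Ab + s • ab)) x) ((a - ab) x) 0 := by
      have e : (fun s : ℝ => (A + s • a - (Ab + s • ab)) x)
          = fun s : ℝ => (A - Ab) x + s • (a - ab) x := by
        funext s
        simp only [Pi.sub_apply, Pi.add_apply, Pi.smul_apply]
        module
      rw [e]
      simpa using ((hasDerivAt_id (0 : ℝ)).smul_const ((a - ab) x)).const_add ((A - Ab) x)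
    have d2 : HasDerivAt (fun s : ℝ => curvature I (interp (A + s • a) (Ab + s • ab) t) x)
        (covDer I (interp A Ab t) (interp a ab t) x) 0 := by
      simp only [hint]
      exact hasDerivAt_curvature_line (hA.interp hAb t) (ha.interp hab t) x
    have d3 := hasDerivAt_angle P h12 d1 d2 d2
    rw [angleVar_eq_smul_angle hP.symm] at d3
    simp only [zero_smul, add_zero] at d3
    convert d3 using 1
    -- Θ is moved past the 2-form D_t δA_t, so the sign is +1.
    rw [angle_one_swap hP.symm h12 h21 ((A - Ab) x)]
    module
  have h4 := (hG.hasDerivAt_integral x hd).const_smul (k * (m + 2))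
  refine h4.congr_deriv ?_
  have hz : IsSeparable I (fun _ t => interp a ab t) := isSeparable_interp ha hab
  have s1 := IsSeparable.angle P h12 (.const (ha.sub hab)) hi.curvature hi.curvature
  have s2 := IsSeparable.angle P h21 (hi.covDer hz) hΘ hi.curvature
  have hdz : ∀ t x, HasDerivAt (fun t => interp a ab t x) ((a - ab) x) t := fun t x => by
    have := ((hasDerivAt_id t).smul_const ((a - ab) x)).const_add (ab x)
    rw [one_smul] at this
    exact this
  -- Here z_t = δA_t with constant t-derivative δΘ. Since p = 1, the end-point terms enter with a
  -- minus sign, so dB contains -E and the integral of ⟨δΘ F_t^n⟩ with a plus sign.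
  have h5 := smul_extD_integral_angle hP hA hAb hz (.const (ha.sub hab)) hdz h11 h21 h12 k x
  have e0 : interp a ab 0 = ab := by simp [interp]
  have e1 : interp a ab 1 = a := by simp [interp]
  have e2 : boundaryTerm I k P A Ab a ab = (k * (m + 1) * (m + 2)) • fun x =>
    ∫ t in (0 : ℝ)..1, angle P h11 (interp a ab t x) ((A - Ab) x)
      (curvature I (interp A Ab t) x) := rfl
  rw [e2, extD_smul, Pi.smul_apply, h5, e0, e1,
    integral_add_smul (s1.continuous 0 x) (s2.continuous 0 x), eulerLagrange]
  module

end Identities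

end

section
open ContinuousAlternatingMap Filter Topology

/-! ### The gauge and diffeomorphism currents. -/

section Currents

variable {E : Type*} [NormedAddCommGroup E] [NormedSpace ℝ E]
variable {H : Type*} [TopologicalSpace H] {I : ModelWithCorners ℝ E H}
variable {M : Type*} [TopologicalSpace M] [ChartedSpace H M]
variable {𝔤 : Type*} [NormedAddCommGroup 𝔤] [NormedSpace ℝ 𝔤] [FiniteDimensional ℝ 𝔤]
  [NormedLieAlg 𝔤]
variable {V : Type*} [NormedAddCommGroup V] [NormedSpace ℝ V]
variable {p q m N : ℕ} {P : ContinuousMultilinearMap ℝ (fun _ : Fin (m + 2) => 𝔤) V}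
variable {A Ab : M → E [⋀^Fin 1]→L[ℝ] 𝔤} {l : M → 𝔤} {ξ : ∀ x : M, TangentSpace I x}

/-- A form whose degree exceeds the dimension vanishes. -/
theorem eq_zero_of_finrank_lt [FiniteDimensional ℝ E] {W : Type*} [NormedAddCommGroup W]
    [NormedSpace ℝ W] (h : Module.finrank ℝ E < N) (Z : E [⋀^Fin N]→L[ℝ] W) : Z = 0 := by
  ext v
  refine Z.toAlternatingMap.map_linearDependent v fun hv => ?_
  have := hv.fintype_card_le_finrank
  rw [Fintype.card_fin] at this
  omega

/-- The form ⟨F^{n+1}⟩ has degree 2m + 4, one above the dimension, so it vanishes; its contraction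
gives ⟨I_ξF F^n⟩ = 0. Cartan's formula then leaves only D_A(I_ξA). -/
theorem angle_lieD [FiniteDimensional ℝ E] (hdim : Module.finrank ℝ E = 2 * m + 3)
    (hP : IsInvariantPolynomial P) (h : 1 + 2 + 2 * m = N) (A : M → E [⋀^Fin 1]→L[ℝ] 𝔤) (x : M) :
    angle P h (lieD I ξ A x) (curvature I A x) (curvature I A x)
      = angle P h (covDer I A (contract I ξ A) x) (curvature I A x) (curvature I A x) := by
  have h1 := curryLeft_angle_two hP.symm (by omega : 2 + 2 + 2 * m = N + 1) h (curvature I A x)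
    (ξ x)
  rw [eq_zero_of_finrank_lt (by omega) (angle P _ _ _ _)] at h1
  have h2 : (0 : E [⋀^Fin (N + 1)]→L[ℝ] V).curryLeft (ξ x) = 0 := rfl
  rw [h2] at h1
  have h3 : (m + 2 : ℝ) ≠ 0 := by positivity
  rw [lieD_eq, angle_add_left, (smul_eq_zero.1 h1.symm).resolve_left h3, add_zero]

variable [IsManifold I ∞ M]

/-! ### The gauge current -/

/-- D_Aλ is affine in A, so a gauge transformation of both end points induces the gauge
transformation of every A_t with the same parameter. -/
theorem interp_covD (A Ab : M → E [⋀^Fin 1]→L[ℝ] 𝔤) (l : M → 𝔤) (t : ℝ) :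
    interp (covD I A l) (covD I Ab l) t = covDer I (interp A Ab t) (zeroForm l) := by
  funext x
  have h1 : ∀ B Bb : M → E [⋀^Fin 1]→L[ℝ] 𝔤, interp B Bb t x = (1 - t) • Bb x + t • B x := by
    intro B Bb
    simp only [interp, Pi.add_apply, Pi.smul_apply, Pi.sub_apply]
    module
  rw [h1, covD_eq, covD_eq, covDer, covDer, covDer, h1, adForm_add_left, adForm_smul_left,
    adForm_smul_left, alternatizeUncurryFin_add, alternatizeUncurryFin_smul,
    alternatizeUncurryFin_smul]
  module

theorem isSeparable_gaugePotential (P : ContinuousMultilinearMap ℝ (fun _ : Fin (m + 2) => 𝔤) V)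
    (h : 0 + 1 + 2 * m = N)
    (hA : IsSmoothForm I A) (hAb : IsSmoothForm I Ab) (hl : ContMDiff I 𝓘(ℝ, 𝔤) ∞ l) :
    IsSeparable I (fun _ t x => angle P h (zeroForm l x) ((A - Ab) x)
      (curvature I (interp A Ab t) x)) :=
  IsSeparable.angle P h (.const (IsSmoothForm.zeroForm hl)) (.const (hA.sub hAb))
    (isSeparable_interp hA hAb).curvature

theorem isSmoothForm_gaugePotential [CompleteSpace V]
    (P : ContinuousMultilinearMap ℝ (fun _ : Fin (m + 2) => 𝔤) V)
    (hA : IsSmoothForm I A) (hAb : IsSmoothForm I Ab) (hl : ContMDiff I 𝓘(ℝ, 𝔤) ∞ l) :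
    IsSmoothForm I (gaugePotential I P A Ab l) :=
  (isSeparable_gaugePotential P (by omega) hA hAb hl).isSmoothForm_integral 0

/-- The case z_t = λ, p = 0 of the combined identity: the t-derivative vanishes and the end-point
terms are exactly the correction. -/
theorem gaugeOff_eq [CompleteSpace V] (hP : IsInvariantPolynomial P)
    (hA : IsSmoothForm I A) (hAb : IsSmoothForm I Ab) (hl : ContMDiff I 𝓘(ℝ, 𝔤) ∞ l) (k : ℝ) :
    gaugeOff I k P A Ab l
      = (k * (m + 1) * (m + 2)) • extD I (gaugePotential I P A Ab l) := by
  funext x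
  have h11 : 1 + 1 + 2 * m = 2 * m + 1 + 1 := by omega
  have h02 : 0 + 2 + 2 * m = 2 * m + 1 + 1 := by omega
  have hz : IsSeparable I (fun _ _ => zeroForm l) := .const (IsSmoothForm.zeroForm hl)
  have h5 := smul_extD_integral_angle hP hA hAb hz (.const IsSmoothForm.zero)
    (fun t x => hasDerivAt_const t _) (by omega : 0 + 1 + 2 * m = 2 * m + 1) h11 h02 k x
  refine Eq.trans ?_ h5.symm
  have e : ∀ t : ℝ, angle P h02 ((0 : M → E [⋀^Fin 0]→L[ℝ] 𝔤) x) (curvature I (interp A Ab t) x)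
      (curvature I (interp A Ab t) x) = 0 := fun t => angle_zero_left P _ _ _
  simp only [gaugeOff, gaugeOn, gaugeCorrection, boundaryTerm, interp_covD, Pi.add_apply, e,
    intervalIntegral.integral_zero, smul_zero, sub_zero, pow_zero, one_smul]

theorem isSmoothForm_gaugeCorrection (P : ContinuousMultilinearMap ℝ (fun _ : Fin (m + 2) => 𝔤) V)
    (hA : IsSmoothForm I A) (hAb : IsSmoothForm I Ab) (hl : ContMDiff I 𝓘(ℝ, 𝔤) ∞ l) (k : ℝ) :
    IsSmoothForm I (gaugeCorrection I k P A Ab l) :=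
  (((IsSmoothForm.zeroForm hl).angle _ hA.curvature hA.curvature).sub
    ((IsSmoothForm.zeroForm hl).angle _ hAb.curvature hAb.curvature)).const_smul _

/-- In the covariant Leibniz rule the second slot drops out by the Bianchi identity. -/
theorem extD_angle_zero (hP : IsInvariantPolynomial P) (h : 0 + 2 + 2 * m = N)
    (h₁ : 1 + 2 + 2 * m = N + 1) {z : M → E [⋀^Fin 0]→L[ℝ] 𝔤} (hA : IsSmoothForm I A)
    (hz : IsSmoothForm I z) (x : M) :
    extD I (fun x => angle P h (z x) (curvature I A x) (curvature I A x)) x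
      = angle P h₁ (covDer I A z x) (curvature I A x) (curvature I A x) := by
  have h2 := extD_angle hP h h₁ (by omega) hA hz hA.curvature x
  rw [covDer_curvature hA, angle_zero_mid, smul_zero, add_zero] at h2
  exact h2

theorem extD_difference (hP : IsInvariantPolynomial P) (h : 0 + 2 + 2 * m = N)
    (h₁ : 1 + 2 + 2 * m = N + 1) {z zb : M → E [⋀^Fin 0]→L[ℝ] 𝔤} (hA : IsSmoothForm I A)
    (hAb : IsSmoothForm I Ab) (hz : IsSmoothForm I z) (hzb : IsSmoothForm I zb) (r : ℝ) (x : M) :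
    extD I (fun x => r • (angle P h (z x) (curvature I A x) (curvature I A x)
        - angle P h (zb x) (curvature I Ab x) (curvature I Ab x))) x
      = r • (angle P h₁ (covDer I A z x) (curvature I A x) (curvature I A x)
        - angle P h₁ (covDer I Ab zb x) (curvature I Ab x) (curvature I Ab x)) := by
  rw [← extD_angle_zero hP h h₁ hA hz, ← extD_angle_zero hP h h₁ hAb hzb]
  have h2 := extD_smul (I := I) r ((fun x => angle P h (z x) (curvature I A x) (curvature I A x))
    - fun x => angle P h (zb x) (curvature I Ab x) (curvature I Ab x))
  rw [extD_sub (hz.angle _ hA.curvature hA.curvature)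
    (hzb.angle _ hAb.curvature hAb.curvature)] at h2
  exact congrFun h2 x

theorem extD_gaugeCorrection (hP : IsInvariantPolynomial P)
    (hA : IsSmoothForm I A) (hAb : IsSmoothForm I Ab) (hl : ContMDiff I 𝓘(ℝ, 𝔤) ∞ l) (k : ℝ) :
    eulerLagrange I k P A Ab (covD I A l) (covD I Ab l)
      = extD I (gaugeCorrection I k P A Ab l) := by
  funext x
  have hz : IsSmoothForm I (zeroForm (E := E) l) := .zeroForm hl
  refine Eq.trans ?_ (extD_difference hP (by omega) (by omega) hA hAb hz hz _ x).symm
  simp only [eulerLagrange, covD_eq]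

theorem extD_gaugeOff [CompleteSpace V] (hP : IsInvariantPolynomial P)
    (hA : IsSmoothForm I A) (hAb : IsSmoothForm I Ab) (hl : ContMDiff I 𝓘(ℝ, 𝔤) ∞ l) (k : ℝ) :
    extD I (gaugeOff I k P A Ab l) = 0 := by
  rw [gaugeOff_eq hP hA hAb hl, extD_smul, extD_extD (isSmoothForm_gaugePotential P hA hAb hl),
    smul_zero]

/-- The Noether identity is read off from the corrected current: that current is closed, and the
differential of the correction is the Euler–Lagrange term. -/
theorem extD_gaugeOn [CompleteSpace V] (hP : IsInvariantPolynomial P)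
    (hA : IsSmoothForm I A) (hAb : IsSmoothForm I Ab) (hl : ContMDiff I 𝓘(ℝ, 𝔤) ∞ l) (k : ℝ) :
    extD I (gaugeOn I k P A Ab l) + eulerLagrange I k P A Ab (covD I A l) (covD I Ab l) = 0 := by
  have h1 : gaugeOn I k P A Ab l = gaugeOff I k P A Ab l - gaugeCorrection I k P A Ab l := by
    rw [gaugeOff, add_sub_cancel_right]
  have h2 : IsSmoothForm I (gaugeOff I k P A Ab l) := by
    rw [gaugeOff_eq hP hA hAb hl]
    exact (isSmoothForm_gaugePotential P hA hAb hl).extD.const_smul _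
  rw [h1, extD_sub h2 (isSmoothForm_gaugeCorrection P hA hAb hl k), extD_gaugeOff hP hA hAb hl,
    extD_gaugeCorrection hP hA hAb hl, zero_sub, neg_add_cancel]

/-! ### The diffeomorphism current -/

theorem lieD_interp (hξ : ContMDiff I I.tangent ∞ (fun x => (⟨x, ξ x⟩ : TangentBundle I M)))
    (hA : IsSmoothForm I A) (hAb : IsSmoothForm I Ab) (t : ℝ) :
    interp (lieD I ξ A) (lieD I ξ Ab) t = lieD I ξ (interp A Ab t) := by
  have h1 : extD I (Ab + t • (A - Ab)) = extD I Ab + t • (extD I A - extD I Ab) := by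
    rw [extD_add hAb ((hA.sub hAb).const_smul t), extD_smul, extD_sub hA hAb]
  have h2 : extD I (contract I ξ Ab + t • (contract I ξ A - contract I ξ Ab))
      = extD I (contract I ξ Ab) + t • (extD I (contract I ξ A) - extD I (contract I ξ Ab)) := by
    rw [extD_add (hAb.contract hξ) (((hA.contract hξ).sub (hAb.contract hξ)).const_smul t),
      extD_smul, extD_sub (hA.contract hξ) (hAb.contract hξ)]
  have h3 : contract I ξ (Ab + t • (A - Ab))
      = contract I ξ Ab + t • (contract I ξ A - contract I ξ Ab) := rfl
  have h4 : contract I ξ (extD I Ab + t • (extD I A - extD I Ab)) = contract I ξ (extD I Ab)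
      + t • (contract I ξ (extD I A) - contract I ξ (extD I Ab)) := rfl
  simp only [interp, lieD]
  rw [h1, h3, h2, h4]
  module

theorem isSeparable_difPotential (P : ContinuousMultilinearMap ℝ (fun _ : Fin (m + 2) => 𝔤) V)
    (h : 0 + 1 + 2 * m = N)
    (hA : IsSmoothForm I A) (hAb : IsSmoothForm I Ab)
    (hξ : ContMDiff I I.tangent ∞ (fun x => (⟨x, ξ x⟩ : TangentBundle I M))) :
    IsSeparable I (fun _ t x => angle P h (contract I ξ (interp A Ab t) x) ((A - Ab) x)
      (curvature I (interp A Ab t) x)) :=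
  IsSeparable.angle P h ((isSeparable_interp hA hAb).contract hξ) (.const (hA.sub hAb))
    (isSeparable_interp hA hAb).curvature

theorem isSmoothForm_difPotential [CompleteSpace V]
    (P : ContinuousMultilinearMap ℝ (fun _ : Fin (m + 2) => 𝔤) V)
    (hA : IsSmoothForm I A) (hAb : IsSmoothForm I Ab)
    (hξ : ContMDiff I I.tangent ∞ (fun x => (⟨x, ξ x⟩ : TangentBundle I M))) :
    IsSmoothForm I (difPotential I P A Ab ξ) :=
  (isSeparable_difPotential P (by omega) hA hAb hξ).isSmoothForm_integral 0

/-- The case z_t = I_ξA_t, with t-derivative I_ξΘ. Of I_ξL_T, the part with I_ξΘ is the integral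
term of the combined identity, and the part with I_ξF_t cancels the one that Cartan's formula puts
into B. -/
theorem difOff_eq [CompleteSpace V] (hP : IsInvariantPolynomial P)
    (hA : IsSmoothForm I A) (hAb : IsSmoothForm I Ab)
    (hξ : ContMDiff I I.tangent ∞ (fun x => (⟨x, ξ x⟩ : TangentBundle I M))) (k : ℝ) :
    difOff I k P A Ab ξ
      = (k * (m + 1) * (m + 2)) • extD I (difPotential I P A Ab ξ) := by
  funext x
  have hi := isSeparable_interp hA hAb
  have hΘ := IsSeparable.const (hA.sub hAb)
  have h11 : 1 + 1 + 2 * m = 2 * m + 1 + 1 := by omega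
  have h02 : 0 + 2 + 2 * m = 2 * m + 1 + 1 := by omega
  have h12 : 1 + 2 + 2 * m = 2 * m + 1 + 1 + 1 := by omega
  have hz : IsSeparable I (fun _ t => contract I ξ (interp A Ab t)) := hi.contract hξ
  have hζ : IsSeparable I (fun _ _ => contract I ξ (A - Ab)) := hΘ.contract hξ
  have hd : ∀ t x, HasDerivAt (fun t => contract I ξ (interp A Ab t) x)
      (contract I ξ (A - Ab) x) t := fun t x => by
    have := ((hasDerivAt_id t).smul_const (contract I ξ (A - Ab) x)).const_add (contract I ξ Ab x)
    rw [one_smul] at this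
    exact this
  have h5 := smul_extD_integral_angle hP hA hAb hz hζ hd
    (by omega : 0 + 1 + 2 * m = 2 * m + 1) h11 h02 k x
  have e0 : interp A Ab 0 = Ab := by simp [interp]
  have e1 : interp A Ab 1 = A := by simp [interp]
  rw [e0, e1] at h5
  have sF := IsSeparable.angle P h02 hζ hi.curvature hi.curvature
  have hIF : IsSeparable I (fun _ t => contract I ξ (curvature I (interp A Ab t))) :=
    hi.curvature.contract hξ
  have sI := IsSeparable.angle P h11 hIF hΘ hi.curvature
  have sD := IsSeparable.angle P h11 (hi.covDer hz) hΘ hi.curvature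
  have sL := IsSeparable.angle P h12 hΘ hi.curvature hi.curvature
  have c1 : contract I ξ (lagrangian I k P A Ab) x = (k * (m + 2)) •
      ((∫ t in (0 : ℝ)..1, angle P h02 (contract I ξ (A - Ab) x) (curvature I (interp A Ab t) x)
          (curvature I (interp A Ab t) x))
        + (m + 1 : ℝ) • ∫ t in (0 : ℝ)..1, angle P h11
          (contract I ξ (curvature I (interp A Ab t)) x) ((A - Ab) x)
          (curvature I (interp A Ab t) x)) := by
    have c2 := sL.contract_integral ξ 0 x
    have c3 : ∀ t : ℝ, contract I ξ (fun x => angle P h12 ((A - Ab) x)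
        (curvature I (interp A Ab t) x) (curvature I (interp A Ab t) x)) x
        = angle P h02 (contract I ξ (A - Ab) x) (curvature I (interp A Ab t) x)
          (curvature I (interp A Ab t) x)
          + (m + 1 : ℝ) • angle P h11 (contract I ξ (curvature I (interp A Ab t)) x) ((A - Ab) x)
            (curvature I (interp A Ab t) x) := by
      intro t
      refine (curryLeft_angle_one hP.symm h12 h02 h11 _ _ _).trans ?_
      -- Exchanging the 1-forms Θ and I_ξF_t changes -(m + 1) into m + 1.
      rw [angle_one_swap hP.symm h11 h11]
      simp only [contract]
      module
    rw [intervalIntegral.integral_congr fun t _ => c3 t,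
      integral_add_smul (sF.continuous 0 x) (sI.continuous 0 x)] at c2
    rw [← c2]
    rfl
  have c4 : boundaryTerm I k P A Ab (lieD I ξ A) (lieD I ξ Ab) x = (k * (m + 1) * (m + 2)) •
      ((∫ t in (0 : ℝ)..1, angle P h11 (covDer I (interp A Ab t)
          (contract I ξ (interp A Ab t)) x) ((A - Ab) x) (curvature I (interp A Ab t) x))
        + (1 : ℝ) • ∫ t in (0 : ℝ)..1, angle P h11
          (contract I ξ (curvature I (interp A Ab t)) x) ((A - Ab) x)
          (curvature I (interp A Ab t) x)) := by
    rw [← integral_add_smul (sD.continuous 0 x) (sI.continuous 0 x)]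
    simp only [boundaryTerm, lieD_interp hξ hA hAb]
    congr 1
    refine intervalIntegral.integral_congr fun t _ => ?_
    -- Cartan's formula £_ξA_t = D_t(I_ξA_t) + I_ξF_t.
    rw [lieD_eq, one_smul, angle_add_left]
    rfl
  refine Eq.trans ?_ h5.symm
  simp only [difOff, difOn, Pi.add_apply, Pi.sub_apply, c1, c4, difCorrection, pow_zero, one_smul]
  module

theorem isSmoothForm_difCorrection (P : ContinuousMultilinearMap ℝ (fun _ : Fin (m + 2) => 𝔤) V)
    (hA : IsSmoothForm I A) (hAb : IsSmoothForm I Ab)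
    (hξ : ContMDiff I I.tangent ∞ (fun x => (⟨x, ξ x⟩ : TangentBundle I M))) (k : ℝ) :
    IsSmoothForm I (difCorrection I k P A Ab ξ) :=
  (((hA.contract hξ).angle _ hA.curvature hA.curvature).sub
    ((hAb.contract hξ).angle _ hAb.curvature hAb.curvature)).const_smul _

theorem extD_difCorrection [FiniteDimensional ℝ E] (hdim : Module.finrank ℝ E = 2 * m + 3)
    (hP : IsInvariantPolynomial P) (hA : IsSmoothForm I A) (hAb : IsSmoothForm I Ab)
    (hξ : ContMDiff I I.tangent ∞ (fun x => (⟨x, ξ x⟩ : TangentBundle I M))) (k : ℝ) :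
    eulerLagrange I k P A Ab (lieD I ξ A) (lieD I ξ Ab)
      = extD I (difCorrection I k P A Ab ξ) := by
  funext x
  refine Eq.trans ?_ (extD_difference hP (by omega) (by omega) hA hAb (hA.contract hξ)
    (hAb.contract hξ) _ x).symm
  simp only [eulerLagrange, angle_lieD hdim hP]

theorem extD_difOff [CompleteSpace V] (hP : IsInvariantPolynomial P)
    (hA : IsSmoothForm I A) (hAb : IsSmoothForm I Ab)
    (hξ : ContMDiff I I.tangent ∞ (fun x => (⟨x, ξ x⟩ : TangentBundle I M))) (k : ℝ) :
    extD I (difOff I k P A Ab ξ) = 0 := by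
  rw [difOff_eq hP hA hAb hξ, extD_smul, extD_extD (isSmoothForm_difPotential P hA hAb hξ),
    smul_zero]

theorem extD_difOn [CompleteSpace V] [FiniteDimensional ℝ E]
    (hdim : Module.finrank ℝ E = 2 * m + 3) (hP : IsInvariantPolynomial P)
    (hA : IsSmoothForm I A) (hAb : IsSmoothForm I Ab)
    (hξ : ContMDiff I I.tangent ∞ (fun x => (⟨x, ξ x⟩ : TangentBundle I M))) (k : ℝ) :
    extD I (difOn I k P A Ab ξ) + eulerLagrange I k P A Ab (lieD I ξ A) (lieD I ξ Ab) = 0 := by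
  have h1 : difOn I k P A Ab ξ = difOff I k P A Ab ξ - difCorrection I k P A Ab ξ := by
    rw [difOff, add_sub_cancel_right]
  have h2 : IsSmoothForm I (difOff I k P A Ab ξ) := by
    rw [difOff_eq hP hA hAb hξ]
    exact (isSmoothForm_difPotential P hA hAb hξ).extD.const_smul _
  rw [h1, extD_sub h2 (isSmoothForm_difCorrection P hA hAb hξ k), extD_difOff hP hA hAb hξ,
    extD_difCorrection hdim hP hA hAb hξ, zero_sub, neg_add_cancel]

end Currents

end

/-! ### Stokes' theorem on a half space. -/

section
open ContinuousAlternatingMap Filter Topology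

variable {d : ℕ} {V : Type*} [NormedAddCommGroup V] [NormedSpace ℝ V]

/-- The standard frame of Euclidean space. -/
def stdFrame (n : ℕ) (i : Fin n) : EuclideanSpace ℝ (Fin n) := EuclideanSpace.single i 1

/-- A top-degree form is its value on a basis times the determinant in that basis. -/
theorem comp_apply_stdFrame {n : ℕ} (α : EuclideanSpace ℝ (Fin n) [⋀^Fin n]→L[ℝ] V)
    (L : EuclideanSpace ℝ (Fin n) →L[ℝ] EuclideanSpace ℝ (Fin n)) :
    α.compContinuousLinearMap L (stdFrame n) = L.det • α (stdFrame n) := by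
  have hb : ⇑(EuclideanSpace.basisFun (Fin n) ℝ).toBasis = stdFrame n := by
    ext i; simp [stdFrame]
  set b := (EuclideanSpace.basisFun (Fin n) ℝ).toBasis
  have h : α.toAlternatingMap = (LinearMap.toSpanSingleton ℝ V (α b)).compAlternatingMap b.det := by
    refine b.ext_alternating fun v hv => ?_
    obtain ⟨σ, rfl⟩ : ∃ σ : Equiv.Perm (Fin n), ⇑σ = v :=
      ⟨Equiv.ofBijective v (Finite.injective_iff_bijective.1 hv), rfl⟩
    have h1 := α.toAlternatingMap.map_perm b σ
    have h2 := b.det.map_perm b σ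
    simp only [Function.comp_def] at h1 h2
    rw [h1, LinearMap.compAlternatingMap_apply, h2]
    simp [b.det_self]
  have h' : ∀ v, α v = b.det v • α b := fun v => by
    have := congrArg (fun f => f v) h
    simpa using this
  rw [compContinuousLinearMap_apply, ← hb, h']
  congr 1
  have := b.det_comp (L : EuclideanSpace ℝ (Fin n) →ₗ[ℝ] EuclideanSpace ℝ (Fin n)) b
  rw [b.det_self, mul_one] at this
  exact this

/-- Coordinates to Euclidean space. -/
def ofCoord (n : ℕ) : (Fin n → ℝ) →L[ℝ] EuclideanSpace ℝ (Fin n) :=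
  ((PiLp.continuousLinearEquiv 2 ℝ (fun _ : Fin n => ℝ)).symm : _ →L[ℝ] _)

/-- Stokes' theorem on a half space for compactly supported forms. -/
theorem integral_extDerivWithin_halfSpace
    {w : EuclideanSpace ℝ (Fin (d + 1)) → EuclideanSpace ℝ (Fin (d + 1)) [⋀^Fin d]→L[ℝ] V}
    (hw : ContDiffOn ℝ 1 w (range (𝓡∂ (d + 1)))) {K : Set (EuclideanSpace ℝ (Fin (d + 1)))}
    (hK : IsCompact K) (h0 : ∀ y ∈ range (𝓡∂ (d + 1)), y ∉ K → w y = 0) :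
    ∫ y in range (𝓡∂ (d + 1)), extDerivWithin w (range (𝓡∂ (d + 1))) y (stdFrame (d + 1))
      = -∫ z, w (bdryIncl z) (fun i => stdFrame (d + 1) i.succ) := by
  set Hs := range (𝓡∂ (d + 1)) with hHs
  have hmem : ∀ y, y ∈ Hs ↔ 0 ≤ y 0 := fun y => by
    rw [hHs, range_modelWithCornersEuclideanHalfSpace]; rfl
  have hint : ∀ y : EuclideanSpace ℝ (Fin (d + 1)), 0 < y 0 → Hs ∈ 𝓝 y := fun y hy => by
    rw [← mem_interior_iff_mem_nhds, hHs, interior_range_modelWithCornersEuclideanHalfSpace]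
    exact hy
  have huniq : UniqueDiffOn ℝ Hs := (𝓡∂ (d + 1)).uniqueDiffOn
  obtain ⟨R, hR⟩ := hK.isBounded.exists_norm_le
  have hcoord : ∀ y ∈ K, ∀ i, |y i| ≤ R := fun y hy i =>
    (PiLp.norm_apply_le y i).trans (hR y hy)
  -- Strictly larger than every coordinate on `K`, and positive even if `K` is empty.
  set R' : ℝ := |R| + 1 with hR'
  have hRR : R < R' := by rw [hR']; linarith [le_abs_self R]
  have hR'0 : 0 < R' := by positivity
  -- The first coordinate starts at 0, so one face of the box lies in the boundary hyperplane; every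
  -- other face lies outside `K`.
  let a : Fin (d + 1) → ℝ := Fin.cons 0 (fun _ => -R')
  let b : Fin (d + 1) → ℝ := fun _ => R'
  have ha0 : a 0 = 0 := rfl
  have hle : a ≤ b := by
    intro i
    refine Fin.cases ?_ (fun j => ?_) i
    · exact hR'0.le
    · change -R' ≤ R'; linarith
  -- The signed components of w, chosen so that their divergence is dw on the standard frame.
  let f : Fin (d + 1) → (Fin (d + 1) → ℝ) → V := fun i u =>
    (-1 : ℝ) ^ (i : ℕ) • w (ofCoord (d + 1) u) (i.removeNth (stdFrame (d + 1)))
  let f' : Fin (d + 1) → (Fin (d + 1) → ℝ) → (Fin (d + 1) → ℝ) →L[ℝ] V := fun i u =>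
    (-1 : ℝ) ^ (i : ℕ) • ((ContinuousAlternatingMap.apply ℝ (EuclideanSpace ℝ (Fin (d + 1))) V
      (i.removeNth (stdFrame (d + 1)))).comp
        ((fderivWithin ℝ w Hs (ofCoord (d + 1) u)).comp (ofCoord (d + 1))))
  have hsum : ∀ u, ∑ i, f' i u (Pi.single i 1)
      = extDerivWithin w Hs (ofCoord (d + 1) u) (stdFrame (d + 1)) := fun u => by
    rw [extDerivWithin, alternatizeUncurryFin_apply_real]
    rfl
  have hIcc : ∀ u ∈ Icc a b, ofCoord (d + 1) u ∈ Hs := fun u hu => (hmem _).2 (hu.1 0)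
  have hcontD : ContinuousOn (fun y => extDerivWithin w Hs y (stdFrame (d + 1))) Hs := by
    have h1 : ContinuousOn (fun y => fderivWithin ℝ w Hs y) Hs :=
      hw.continuousOn_fderivWithin huniq le_rfl
    have h2 : ContinuousOn (fun y => extDerivWithin w Hs y) Hs :=
      (alternatizeUncurryFinCLM ℝ (EuclideanSpace ℝ (Fin (d + 1))) V).continuous.comp_continuousOn
        h1
    exact (ContinuousAlternatingMap.apply ℝ (EuclideanSpace ℝ (Fin (d + 1))) V
      (stdFrame (d + 1))).continuous.comp_continuousOn h2
  have hdiv := integral_divergence_of_hasFDerivAt_off_countable' a b hle f f' ∅ countable_empty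
    (fun i => by
      have h1 : ContinuousOn (fun u => w (ofCoord (d + 1) u) (i.removeNth (stdFrame (d + 1))))
          (Icc a b) :=
        (ContinuousAlternatingMap.apply ℝ (EuclideanSpace ℝ (Fin (d + 1))) V
          (i.removeNth (stdFrame (d + 1)))).continuous.comp_continuousOn
            (hw.continuousOn.comp (ofCoord (d + 1)).continuous.continuousOn hIcc)
      exact h1.const_smul ((-1 : ℝ) ^ (i : ℕ)))
    (fun u hu i => by
      -- Interior points of the box lie in the open half space, where the derivative within the half
      -- space is a genuine derivative.
      have hu0 : (0 : ℝ) < (ofCoord (d + 1) u) 0 := (hu.1 0 (mem_univ _)).1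
      have hn := hint _ hu0
      have hd : HasFDerivAt w (fderivWithin ℝ w Hs (ofCoord (d + 1) u)) (ofCoord (d + 1) u) := by
        rw [fderivWithin_of_mem_nhds hn]
        exact ((hw.contDiffAt hn).differentiableAt one_ne_zero).hasFDerivAt
      exact (((ContinuousAlternatingMap.apply ℝ (EuclideanSpace ℝ (Fin (d + 1))) V
        (i.removeNth (stdFrame (d + 1)))).hasFDerivAt.comp u
          (hd.comp u (ofCoord (d + 1)).hasFDerivAt)).const_smul _))
    (by
      simp only [hsum]
      exact (hcontD.comp (ofCoord (d + 1)).continuous.continuousOn hIcc).integrableOn_compact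
        isCompact_Icc)
  have hzero : ∀ (i : Fin (d + 1)) (u : Fin (d + 1) → ℝ), ofCoord (d + 1) u ∈ Hs →
      (∃ j, R' ≤ |u j|) → f i u = 0 := fun i u hu ⟨j, hj⟩ => by
    have : w (ofCoord (d + 1) u) = 0 := h0 _ hu fun hk => by
      have h2 : |u j| ≤ R := hcoord _ hk j
      linarith
    simp only [f, this]
    simp
  have hD0 : ∀ y ∈ Hs, y ∉ K → extDerivWithin w Hs y = 0 := fun y hy hk => by
    have : w =ᶠ[𝓝[Hs] y] (fun _ => 0) := by
      filter_upwards [self_mem_nhdsWithin, mem_nhdsWithin_of_mem_nhds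
        (hK.isClosed.isOpen_compl.mem_nhds hk)] with z hz hz'
      exact h0 z hz hz'
    rw [this.extDerivWithin_eq_of_mem hy, extDerivWithin]
    ext v
    simp [alternatizeUncurryFin_apply_real]
  have hlhs : ∫ y in Hs, extDerivWithin w Hs y (stdFrame (d + 1))
      = ∫ u in Icc a b, ∑ i, f' i u (Pi.single i 1) := by
    simp only [hsum]
    rw [← (PiLp.volume_preserving_toLp (Fin (d + 1))).setIntegral_preimage_emb
      (MeasurableEquiv.toLp 2 (Fin (d + 1) → ℝ)).measurableEmbedding]
    refine setIntegral_eq_of_subset_of_forall_sdiff_eq_zero ?_ ?_ ?_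
    · exact ((PiLp.volume_preserving_toLp (Fin (d + 1))).measurable
        ((𝓡∂ (d + 1)).isClosed_range.measurableSet))
    · exact hIcc
    · rintro u ⟨hu, hu'⟩
      have hk : ofCoord (d + 1) u ∉ K := fun hk => hu' ⟨fun i => ?_, fun i => ?_⟩
      · rw [hD0 _ hu hk]; rfl
      · have h3 : |u i| ≤ R := hcoord _ hk i
        revert h3
        refine Fin.cases (fun _ => (hmem _).1 hu) (fun j hj => ?_) i
        change -R' ≤ u j.succ
        linarith [(abs_le.1 hj).1]
      · have h3 : |u i| ≤ R := hcoord _ hk i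
        change u i ≤ R'
        linarith [(abs_le.1 h3).2]
  have hfaces : ∀ (i : Fin (d + 1)) (c : ℝ), a i ≤ c → c ≤ b i → |c| = R' →
      ∫ x in Icc (a ∘ Fin.succAbove i) (b ∘ Fin.succAbove i), f i (i.insertNth c x) = 0 := by
    intro i c h1 h2 h3
    refine setIntegral_eq_zero_of_forall_eq_zero fun x hx => hzero i _ (hIcc _ ?_) ⟨i, ?_⟩
    · exact Fin.insertNth_mem_Icc.2 ⟨⟨h1, h2⟩, hx⟩
    · rw [Fin.insertNth_apply_same, h3]
  -- Only the lower face in direction 0 survives, and the divergence theorem counts lower faces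
  -- negatively.
  rw [hlhs, hdiv, Fin.sum_univ_succ, Finset.sum_eq_zero (fun j _ => ?_), add_zero,
    hfaces 0 (b 0) (hle 0) le_rfl (abs_of_pos hR'0), zero_sub]
  · congr 1
    rw [← (PiLp.volume_preserving_toLp (Fin d)).integral_comp
      (MeasurableEquiv.toLp 2 (Fin d → ℝ)).measurableEmbedding]
    have hb : ∀ x : Fin d → ℝ, f 0 ((0 : Fin (d + 1)).insertNth (a 0) x)
        = w (bdryIncl (WithLp.toLp 2 x)) (fun i => stdFrame (d + 1) i.succ) := fun x => by
      simp only [f, Fin.val_zero, pow_zero, one_smul, Fin.insertNth_zero]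
      rfl
    simp only [hb]
    refine setIntegral_eq_integral_of_forall_compl_eq_zero fun x hx => ?_
    have hk : bdryIncl (WithLp.toLp 2 x) ∉ K := fun hk => hx ⟨fun i => ?_, fun i => ?_⟩
    · rw [h0 _ ((hmem _).2 le_rfl) hk]; rfl
    · have h3 : |x i| ≤ R := hcoord _ hk i.succ
      change -R' ≤ x i
      linarith [(abs_le.1 h3).1]
    · have h3 : |x i| ≤ R := hcoord _ hk i.succ
      change x i ≤ R'
      linarith [(abs_le.1 h3).2]
  · rw [hfaces j.succ (b j.succ) (hle _) le_rfl (abs_of_pos hR'0),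
      hfaces j.succ (a j.succ) le_rfl (hle _) ?_, sub_zero]
    change |-R'| = R'
    rw [abs_neg, abs_of_pos hR'0]

end

/-! ### Integration and Stokes' theorem inside one chart. -/

section
open ContinuousAlternatingMap Filter Topology

variable {d : ℕ} {S : Type*} [TopologicalSpace S] [ChartedSpace (EuclideanHalfSpace (d + 1)) S]
variable {V : Type*} [NormedAddCommGroup V] [NormedSpace ℝ V]

/-- The form `α` in the preferred chart at `z`, extended by zero. -/
def chartExt {k : ℕ} (α : S → EuclideanSpace ℝ (Fin (d + 1)) [⋀^Fin k]→L[ℝ] V) (z : S) :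
    EuclideanSpace ℝ (Fin (d + 1)) → EuclideanSpace ℝ (Fin (d + 1)) [⋀^Fin k]→L[ℝ] V :=
  indicator (extChartAt (𝓡∂ (d + 1)) z).target (chartRep (𝓡∂ (d + 1)) α z)

theorem measurableSet_extChartAt_target (z : S) :
    MeasurableSet (extChartAt (𝓡∂ (d + 1)) z).target := by
  rw [extChartAt_target]
  exact ((chartAt _ z).open_target.preimage (𝓡∂ (d + 1)).continuous_symm).measurableSet.inter
    (𝓡∂ (d + 1)).isClosed_range.measurableSet

theorem continuous_bdryIncl : Continuous (bdryIncl (d := d)) := by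
  refine (ofCoord (d + 1)).continuous.comp (continuous_pi fun i => ?_)
  refine Fin.cases continuous_const (fun j => ?_) i
  exact (EuclideanSpace.proj (𝕜 := ℝ) j).continuous

theorem chartRep_eq_zero {k : ℕ} {α : S → EuclideanSpace ℝ (Fin (d + 1)) [⋀^Fin k]→L[ℝ] V} {z : S}
    {y : EuclideanSpace ℝ (Fin (d + 1))} (h : α ((extChartAt (𝓡∂ (d + 1)) z).symm y) = 0) :
    chartRep (𝓡∂ (d + 1)) α z y = 0 := by
  rw [chartRep, h]; rfl

section Support

variable {k : ℕ} {α : S → EuclideanSpace ℝ (Fin (d + 1)) [⋀^Fin k]→L[ℝ] V} {z : S} {K : Set S}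

theorem chartExt_eq_zero (h0 : ∀ p ∉ K, α p = 0) {y : EuclideanSpace ℝ (Fin (d + 1))}
    (hy : y ∉ extChartAt (𝓡∂ (d + 1)) z '' K) : chartExt α z y = 0 := by
  by_cases h : y ∈ (extChartAt (𝓡∂ (d + 1)) z).target
  · rw [chartExt, indicator_of_mem h]
    refine chartRep_eq_zero (h0 _ fun hk => hy ⟨_, hk, ?_⟩)
    exact (extChartAt (𝓡∂ (d + 1)) z).right_inv h
  · exact indicator_of_notMem h _

theorem isCompact_image_extChartAt [CompactSpace S] (hK : IsClosed K)
    (hKz : K ⊆ (extChartAt (𝓡∂ (d + 1)) z).source) :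
    IsCompact (extChartAt (𝓡∂ (d + 1)) z '' K) :=
  hK.isCompact.image_of_continuousOn ((continuousOn_extChartAt z).mono hKz)

theorem chartExt_eventuallyEq {y : EuclideanSpace ℝ (Fin (d + 1))}
    (hy : y ∈ (extChartAt (𝓡∂ (d + 1)) z).target) :
    chartExt α z =ᶠ[𝓝[range (𝓡∂ (d + 1))] y] chartRep (𝓡∂ (d + 1)) α z := by
  filter_upwards [extChartAt_target_mem_nhdsWithin_of_mem hy] with y' hy'
  exact indicator_of_mem hy' _

/-- On the chart target the extension is locally the chart expression; at any other point it
vanishes nearby, since the image of `K` is compact and hence closed. -/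
theorem contDiffOn_chartExt [CompactSpace S] (hα : IsSmoothForm (𝓡∂ (d + 1)) α) (hK : IsClosed K)
    (hKz : K ⊆ (extChartAt (𝓡∂ (d + 1)) z).source) (h0 : ∀ p ∉ K, α p = 0)
    [IsManifold (𝓡∂ (d + 1)) ∞ S] :
    ContDiffOn ℝ ∞ (chartExt α z) (range (𝓡∂ (d + 1))) := by
  intro y hyr
  by_cases hy : y ∈ (extChartAt (𝓡∂ (d + 1)) z).target
  · exact (hα.contDiffWithinAt hy).congr_of_eventuallyEq_of_mem (chartExt_eventuallyEq hy) hyr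
  · have hn : y ∉ extChartAt (𝓡∂ (d + 1)) z '' K := by
      rintro ⟨p, hp, rfl⟩
      exact hy ((extChartAt (𝓡∂ (d + 1)) z).map_source (hKz hp))
    refine ContDiffWithinAt.congr_of_eventuallyEq_of_mem (f := fun _ => 0) contDiffWithinAt_const
      ?_ hyr
    filter_upwards [mem_nhdsWithin_of_mem_nhds
      ((isCompact_image_extChartAt hK hKz).isClosed.isOpen_compl.mem_nhds hn)] with y' hy'
    exact chartExt_eq_zero h0 hy'

theorem extD_eq_zero_of_notMem {p : S} (hK : IsClosed K) (h0 : ∀ p ∉ K, α p = 0) (hp : p ∉ K)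
    [IsManifold (𝓡∂ (d + 1)) ∞ S] : extD (𝓡∂ (d + 1)) α p = 0 := by
  have h : chartRep (𝓡∂ (d + 1)) α p =ᶠ[𝓝 (extChartAt (𝓡∂ (d + 1)) p p)] fun _ => 0 := by
    have := (continuousAt_extChartAt_symm (I := 𝓡∂ (d + 1)) p).preimage_mem_nhds
      (t := Kᶜ) (hK.isOpen_compl.mem_nhds (by rwa [extChartAt_to_inv]))
    filter_upwards [this] with y hy
    exact chartRep_eq_zero (h0 _ hy)
  rw [extD_eq, (h.filter_mono nhdsWithin_le_nhds).extDerivWithin_eq h.eq_of_nhds, extDerivWithin]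
  ext v
  simp [alternatizeUncurryFin_apply_real]

end Support

/-- The integral of the form `α` over the domain of the preferred chart at `x`. -/
def chartIntegral (x : S)
    (α : S → EuclideanSpace ℝ (Fin (d + 1)) [⋀^Fin (d + 1)]→L[ℝ] V) : V :=
  ∫ y in (extChartAt (𝓡∂ (d + 1)) x).target, chartRep (𝓡∂ (d + 1)) α x y (stdFrame (d + 1))

/-- Integrability of the form `α` in the preferred chart at `x`. -/
def ChartIntegrable (x : S)
    (α : S → EuclideanSpace ℝ (Fin (d + 1)) [⋀^Fin (d + 1)]→L[ℝ] V) : Prop :=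
  IntegrableOn (fun y => chartRep (𝓡∂ (d + 1)) α x y (stdFrame (d + 1)))
    (extChartAt (𝓡∂ (d + 1)) x).target

theorem chartIntegral_add {x : S} {α β : S → EuclideanSpace ℝ (Fin (d + 1)) [⋀^Fin (d + 1)]→L[ℝ] V}
    (hα : ChartIntegrable x α) (hβ : ChartIntegrable x β) :
    chartIntegral x (α + β) = chartIntegral x α + chartIntegral x β :=
  integral_add hα hβ

theorem chartIntegral_sum {ι : Type*} (s : Finset ι) (x : S)
    {α : ι → S → EuclideanSpace ℝ (Fin (d + 1)) [⋀^Fin (d + 1)]→L[ℝ] V}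
    (h : ∀ i ∈ s, ChartIntegrable x (α i)) :
    chartIntegral x (∑ i ∈ s, α i) = ∑ i ∈ s, chartIntegral x (α i) := by
  simp only [chartIntegral]
  rw [← integral_finsetSum s h]
  congr 1
  funext y
  simp only [chartRep, Finset.sum_apply]
  exact ContinuousAlternatingMap.sum_apply _ _

theorem chartIntegral_smul (c : ℝ) (x : S)
    (α : S → EuclideanSpace ℝ (Fin (d + 1)) [⋀^Fin (d + 1)]→L[ℝ] V) :
    chartIntegral x (c • α) = c • chartIntegral x α :=
  integral_smul c _

/-- The chart expression is continuous on the compact image of `K` and zero elsewhere in the target.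
-/
theorem IsSmoothForm.chartIntegrable [IsManifold (𝓡∂ (d + 1)) ∞ S] [CompactSpace S]
    {α : S → EuclideanSpace ℝ (Fin (d + 1)) [⋀^Fin (d + 1)]→L[ℝ] V} {z : S} {K : Set S}
    (hα : IsSmoothForm (𝓡∂ (d + 1)) α) (hK : IsClosed K)
    (hKz : K ⊆ (extChartAt (𝓡∂ (d + 1)) z).source) (h0 : ∀ p ∉ K, α p = 0) :
    ChartIntegrable z α := by
  have hc : ContinuousOn (fun y => chartExt α z y (stdFrame (d + 1)))
      (extChartAt (𝓡∂ (d + 1)) z '' K) :=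
    (ContinuousAlternatingMap.apply ℝ (EuclideanSpace ℝ (Fin (d + 1))) V
      (stdFrame (d + 1))).continuous.comp_continuousOn
        ((contDiffOn_chartExt hα hK hKz h0).continuousOn.mono (by
          rintro _ ⟨p, hp, rfl⟩
          exact extChartAt_target_subset_range z
            ((extChartAt (𝓡∂ (d + 1)) z).map_source (hKz hp))))
  have h1 := (hc.integrableOn_compact (μ := volume)
    (isCompact_image_extChartAt hK hKz)).of_forall_sdiff_eq_zero
    (measurableSet_extChartAt_target z) (fun y hy => by
      rw [chartExt_eq_zero h0 hy.2]; rfl)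
  refine h1.congr_fun (fun y hy => ?_) (measurableSet_extChartAt_target z)
  simp only [chartExt, indicator_of_mem hy]

/-- Stokes' theorem for a form supported in the domain of a chart. -/
theorem chartIntegral_extD [IsManifold (𝓡∂ (d + 1)) ∞ S] [CompactSpace S]
    {α : S → EuclideanSpace ℝ (Fin (d + 1)) [⋀^Fin d]→L[ℝ] V} {z : S} {K : Set S}
    (hα : IsSmoothForm (𝓡∂ (d + 1)) α) (hK : IsClosed K)
    (hKz : K ⊆ (extChartAt (𝓡∂ (d + 1)) z).source) (h0 : ∀ p ∉ K, α p = 0) :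
    chartIntegral z (extD (𝓡∂ (d + 1)) α)
      = -∫ u in {u | bdryIncl u ∈ (extChartAt (𝓡∂ (d + 1)) z).target},
          chartRep (𝓡∂ (d + 1)) α z (bdryIncl u) (fun i => stdFrame (d + 1) i.succ) := by
  have hst := integral_extDerivWithin_halfSpace
    ((contDiffOn_chartExt hα hK hKz h0).of_le (by simp)) (isCompact_image_extChartAt hK hKz)
    (fun y _ hy => chartExt_eq_zero h0 hy)
  have hl : chartIntegral z (extD (𝓡∂ (d + 1)) α)
      = ∫ y in range (𝓡∂ (d + 1)), extDerivWithin (chartExt α z) (range (𝓡∂ (d + 1))) y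
          (stdFrame (d + 1)) := by
    symm
    rw [setIntegral_eq_of_subset_of_forall_sdiff_eq_zero
      (𝓡∂ (d + 1)).isClosed_range.measurableSet (extChartAt_target_subset_range z)]
    · refine setIntegral_congr_fun (measurableSet_extChartAt_target z) fun y hy => ?_
      rw [chartRep_extD hα hy, (chartExt_eventuallyEq hy).extDerivWithin_eq_of_mem
        (extChartAt_target_subset_range z hy)]
    · rintro y ⟨hyr, hy⟩
      have hn : y ∉ extChartAt (𝓡∂ (d + 1)) z '' K := by
        rintro ⟨p, hp, rfl⟩
        exact hy ((extChartAt (𝓡∂ (d + 1)) z).map_source (hKz hp))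
      have h : chartExt α z =ᶠ[𝓝 y] fun _ => 0 := by
        filter_upwards [(isCompact_image_extChartAt hK hKz).isClosed.isOpen_compl.mem_nhds hn]
          with y' hy'
        exact chartExt_eq_zero h0 hy'
      rw [(h.filter_mono nhdsWithin_le_nhds).extDerivWithin_eq h.eq_of_nhds, extDerivWithin,
        alternatizeUncurryFin_apply_real]
      simp
  rw [hl, hst, ← setIntegral_eq_integral_of_forall_compl_eq_zero (s := {u |
    bdryIncl u ∈ (extChartAt (𝓡∂ (d + 1)) z).target}) (fun u hu => by
      rw [chartExt, indicator_of_notMem (by exact hu)]; rfl)]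
  congr 1
  refine setIntegral_congr_fun
    (continuous_bdryIncl.measurable (measurableSet_extChartAt_target z)) fun u hu => ?_
  rw [chartExt, indicator_of_mem (by exact hu)]

/-- The change of variables formula. -/
theorem chartIntegral_eq_of_support [IsManifold (𝓡∂ (d + 1)) ∞ S] (hor : IsOrientedAtlas d S)
    {α : S → EuclideanSpace ℝ (Fin (d + 1)) [⋀^Fin (d + 1)]→L[ℝ] V} {x z : S}
    (h0 : ∀ p, ¬ (p ∈ (extChartAt (𝓡∂ (d + 1)) x).source ∧
      p ∈ (extChartAt (𝓡∂ (d + 1)) z).source) → α p = 0) :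
    chartIntegral x α = chartIntegral z α := by
  set φ := extChartAt (𝓡∂ (d + 1)) x with hφ
  set ψ := extChartAt (𝓡∂ (d + 1)) z with hψ
  set g := ψ ∘ φ.symm with hg
  let U : Set (EuclideanSpace ℝ (Fin (d + 1))) := φ.target ∩ φ.symm ⁻¹' ψ.source
  let U' : Set (EuclideanSpace ℝ (Fin (d + 1))) := ψ.target ∩ ψ.symm ⁻¹' φ.source
  -- `U` is only relatively open in the chart target, which is itself measurable but need not be
  -- open.
  have hU : MeasurableSet U := by
    obtain ⟨O, hO, hO'⟩ := (continuousOn_iff'.1 (continuousOn_extChartAt_symm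
      (I := 𝓡∂ (d + 1)) x)) _ (isOpen_extChartAt_source (I := 𝓡∂ (d + 1)) z)
    have : U = O ∩ φ.target := by rw [← hO', inter_comm]
    rw [this]
    exact hO.measurableSet.inter (measurableSet_extChartAt_target x)
  have himg : g '' U = U' := by
    ext y
    constructor
    · rintro ⟨u, ⟨hu, hu'⟩, rfl⟩
      refine ⟨ψ.map_source hu', ?_⟩
      change ψ.symm (ψ (φ.symm u)) ∈ φ.source
      rw [ψ.left_inv hu']
      exact φ.map_target hu
    · rintro ⟨hy, hy'⟩
      refine ⟨φ (ψ.symm y), ⟨φ.map_source hy', ?_⟩, ?_⟩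
      · change φ.symm (φ (ψ.symm y)) ∈ ψ.source
        rw [φ.left_inv hy']
        exact ψ.map_target hy
      · change ψ (φ.symm (φ (ψ.symm y))) = y
        rw [φ.left_inv hy', ψ.right_inv hy]
  have hinj : InjOn g U := by
    intro u hu v hv huv
    exact φ.symm.injOn hu.1 hv.1 (ψ.injOn hu.2 hv.2 huv)
  have hid : ∀ p, MDifferentiableAt (𝓡∂ (d + 1)) (𝓡∂ (d + 1)) (id : S → S) p :=
    fun p => mdifferentiableAt_id
  have hd : ∀ u ∈ U, HasFDerivWithinAt g (fderivWithin ℝ g (range (𝓡∂ (d + 1))) u) U u := by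
    intro u hu
    have h1 := hasFDerivWithinAt_chart_comp (I := 𝓡∂ (d + 1)) (p := z) hu.1 (hid _) hu.2
    exact h1.differentiableWithinAt.hasFDerivWithinAt.mono
      fun v hv => extChartAt_target_subset_range x hv.1
  have hx : chartIntegral x α = ∫ y in U, chartRep (𝓡∂ (d + 1)) α x y (stdFrame (d + 1)) := by
    refine setIntegral_eq_of_subset_of_forall_sdiff_eq_zero (measurableSet_extChartAt_target x)
      inter_subset_left fun y hy => ?_
    rw [chartRep_eq_zero (h0 _ fun h => hy.2 ⟨hy.1, h.2⟩)]
    rfl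
  have hz : chartIntegral z α = ∫ y in U', chartRep (𝓡∂ (d + 1)) α z y (stdFrame (d + 1)) := by
    refine setIntegral_eq_of_subset_of_forall_sdiff_eq_zero (measurableSet_extChartAt_target z)
      inter_subset_left fun y hy => ?_
    rw [chartRep_eq_zero (h0 _ fun h => hy.2 ⟨hy.1, h.1⟩)]
    rfl
  rw [hx, hz, ← himg, integral_image_eq_integral_abs_det_fderiv_smul volume hU hd hinj]
  refine setIntegral_congr_fun hU fun u hu => ?_
  have h1 := chartRep_pullback (J := 𝓡∂ (d + 1)) (I := 𝓡∂ (d + 1)) α (f := id) (p := z)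
    hu.1 (hid _) hu.2
  rw [pullback_id] at h1
  rw [h1, comp_apply_stdFrame]
  congr 1
  -- Forms transform by the Jacobian and measures by its absolute value; the orientation hypothesis
  -- makes the two agree.
  exact (abs_of_pos (hor x z u hu.1 hu.2)).symm

end

/-! ### Partition of unity and the global Stokes theorem. -/

section
open ContinuousAlternatingMap Filter Topology

variable {d : ℕ} {S : Type*} [TopologicalSpace S] [ChartedSpace (EuclideanHalfSpace (d + 1)) S]
variable {V : Type*} [NormedAddCommGroup V] [NormedSpace ℝ V]
variable [IsManifold (𝓡∂ (d + 1)) ∞ S] [T2Space S] [CompactSpace S]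

/-- The form `ρ_x α`. -/
def cutOff {k : ℕ} (x : S) (α : S → EuclideanSpace ℝ (Fin (d + 1)) [⋀^Fin k]→L[ℝ] V) (p : S) :
    EuclideanSpace ℝ (Fin (d + 1)) [⋀^Fin k]→L[ℝ] V :=
  chartPartition d S x p • α p

theorem tsupport_chartPartition (x : S) :
    tsupport (chartPartition d S x) ⊆ (extChartAt (𝓡∂ (d + 1)) x).source := by
  rw [extChartAt_source]
  exact Classical.choose_spec
    (SmoothPartitionOfUnity.exists_isSubordinate_chartAt_source (𝓡∂ (d + 1)) S) x

variable (d S) in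
/-- The indices of the nonzero functions of the partition of unity. -/
def chartIndices : Finset S :=
  ((chartPartition d S).locallyFinite.finite_nonempty_of_compact).toFinset

theorem chartPartition_eq_zero {x : S} (hx : x ∉ chartIndices d S) (p : S) :
    chartPartition d S x p = 0 := by
  by_contra h
  exact hx ((Set.Finite.mem_toFinset _).2 ⟨p, h⟩)

theorem sum_chartPartition (p : S) : ∑ x ∈ chartIndices d S, chartPartition d S x p = 1 := by
  rw [← (chartPartition d S).sum_eq_one (mem_univ p)]
  refine (finsum_eq_sum_of_support_subset _ fun x hx => ?_).symm
  by_contra h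
  exact hx (chartPartition_eq_zero h p)

section

variable {k : ℕ} {α : S → EuclideanSpace ℝ (Fin (d + 1)) [⋀^Fin k]→L[ℝ] V}

theorem sum_cutOff (α : S → EuclideanSpace ℝ (Fin (d + 1)) [⋀^Fin k]→L[ℝ] V) :
    ∑ x ∈ chartIndices d S, cutOff x α = α := by
  funext p
  rw [Finset.sum_apply]
  simp only [cutOff]
  rw [← Finset.sum_smul, sum_chartPartition, one_smul]

theorem cutOff_eq_zero (x : S) (α : S → EuclideanSpace ℝ (Fin (d + 1)) [⋀^Fin k]→L[ℝ] V) {p : S}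
    (hp : p ∉ tsupport (chartPartition d S x)) : cutOff x α p = 0 := by
  rw [cutOff, image_eq_zero_of_notMem_tsupport hp, zero_smul]

theorem IsSmoothForm.smul_chartPartition (hα : IsSmoothForm (𝓡∂ (d + 1)) α) (x : S) :
    IsSmoothForm (𝓡∂ (d + 1)) (cutOff x α) :=
  hα.fun_smul (chartPartition d S x).contMDiff

end

theorem integrate_eq_sum (α : S → EuclideanSpace ℝ (Fin (d + 1)) [⋀^Fin (d + 1)]→L[ℝ] V) :
    integrate α = ∑ x ∈ chartIndices d S, chartIntegral x (cutOff x α) := by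
  refine finsum_eq_sum_of_support_subset _ fun x hx => ?_
  by_contra h
  refine hx ?_
  simp [chartPartition_eq_zero h]

theorem integrateBoundary_eq_sum (σ : S → EuclideanSpace ℝ (Fin (d + 1)) [⋀^Fin d]→L[ℝ] V) :
    integrateBoundary σ = ∑ x ∈ chartIndices d S,
      -∫ u in {u | bdryIncl u ∈ (extChartAt (𝓡∂ (d + 1)) x).target},
          chartRep (𝓡∂ (d + 1)) (cutOff x σ) x (bdryIncl u) (fun i => stdFrame (d + 1) i.succ) := by
  rw [Finset.sum_neg_distrib]
  refine congrArg Neg.neg (finsum_eq_sum_of_support_subset _ fun x hx => ?_)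
  by_contra h
  refine hx ?_
  simp [chartPartition_eq_zero h]

section

variable {α β : S → EuclideanSpace ℝ (Fin (d + 1)) [⋀^Fin (d + 1)]→L[ℝ] V}

theorem IsSmoothForm.chartIntegrable_cutOff (hα : IsSmoothForm (𝓡∂ (d + 1)) α) (x : S) :
    ChartIntegrable x (cutOff x α) :=
  (hα.smul_chartPartition x).chartIntegrable (isClosed_tsupport _) (tsupport_chartPartition x)
    fun _ => cutOff_eq_zero x α

theorem integrate_add (hα : IsSmoothForm (𝓡∂ (d + 1)) α) (hβ : IsSmoothForm (𝓡∂ (d + 1)) β) :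
    integrate (α + β) = integrate α + integrate β := by
  simp only [integrate_eq_sum]
  rw [← Finset.sum_add_distrib]
  refine Finset.sum_congr rfl fun x _ => ?_
  refine (congrArg (chartIntegral x) ?_).trans
    (chartIntegral_add (hα.chartIntegrable_cutOff x) (hβ.chartIntegrable_cutOff x))
  funext p
  exact smul_add _ _ _

theorem integrate_smul (c : ℝ) (α : S → EuclideanSpace ℝ (Fin (d + 1)) [⋀^Fin (d + 1)]→L[ℝ] V) :
    integrate (c • α) = c • integrate α := by
  simp only [integrate_eq_sum]
  rw [Finset.smul_sum]
  refine Finset.sum_congr rfl fun x _ => ?_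
  refine (congrArg (chartIntegral x) ?_).trans (chartIntegral_smul c x _)
  funext p
  exact smul_comm (chartPartition d S x p) c (α p)

/-- **Stokes' theorem** on compact oriented manifolds with boundary. -/
theorem integrate_extD (hor : IsOrientedAtlas d S)
    {σ : S → EuclideanSpace ℝ (Fin (d + 1)) [⋀^Fin d]→L[ℝ] V}
    (hσ : IsSmoothForm (𝓡∂ (d + 1)) σ) :
    integrate (extD (𝓡∂ (d + 1)) σ) = integrateBoundary σ := by
  have hsm : ∀ z x : S, IsSmoothForm (𝓡∂ (d + 1)) (cutOff x (extD (𝓡∂ (d + 1)) (cutOff z σ))) :=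
    fun z x => (hσ.smul_chartPartition z).extD.smul_chartPartition x
  have hsupp : ∀ z x p, p ∉ tsupport (chartPartition d S z) →
      cutOff x (extD (𝓡∂ (d + 1)) (cutOff z σ)) p = 0 := fun z x p hp => by
    rw [cutOff, extD_eq_zero_of_notMem (isClosed_tsupport _) (fun _ => cutOff_eq_zero z σ) hp,
      smul_zero]
  have hint : ∀ z x, ChartIntegrable z (cutOff x (extD (𝓡∂ (d + 1)) (cutOff z σ))) := fun z x =>
    (hsm z x).chartIntegrable (isClosed_tsupport _) (tsupport_chartPartition z) (hsupp z x)
  have hsum : ∀ x, cutOff x (extD (𝓡∂ (d + 1)) σ)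
      = ∑ z ∈ chartIndices d S, cutOff x (extD (𝓡∂ (d + 1)) (cutOff z σ)) := fun x => by
    conv_lhs => rw [← sum_cutOff σ, extD_sum _ fun z _ => hσ.smul_chartPartition z]
    funext p
    simp only [cutOff, Finset.sum_apply, Finset.smul_sum]
  rw [integrate_eq_sum, integrateBoundary_eq_sum]
  -- Two copies of the partition are used: ρ_x from the definition of the integral, ρ_z to decompose
  -- σ. Each ρ_x d(ρ_zσ) may be integrated in the chart at z instead of x; summing over x there
  -- removes ρ_x and leaves Stokes for ρ_zσ in one chart.
  calc ∑ x ∈ chartIndices d S, chartIntegral x (cutOff x (extD (𝓡∂ (d + 1)) σ))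
      = ∑ x ∈ chartIndices d S, ∑ z ∈ chartIndices d S,
          chartIntegral x (cutOff x (extD (𝓡∂ (d + 1)) (cutOff z σ))) :=
        Finset.sum_congr rfl fun x _ => by
          rw [hsum, chartIntegral_sum]
          exact fun z _ => (hσ.smul_chartPartition z).extD.chartIntegrable_cutOff x
    _ = ∑ x ∈ chartIndices d S, ∑ z ∈ chartIndices d S,
          chartIntegral z (cutOff x (extD (𝓡∂ (d + 1)) (cutOff z σ))) :=
        Finset.sum_congr rfl fun x _ => Finset.sum_congr rfl fun z _ =>
          chartIntegral_eq_of_support hor fun p hp => by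
            by_cases hx : p ∈ tsupport (chartPartition d S x)
            · exact hsupp z x p fun hz =>
                hp ⟨tsupport_chartPartition x hx, tsupport_chartPartition z hz⟩
            · exact cutOff_eq_zero x _ hx
    _ = ∑ z ∈ chartIndices d S, ∑ x ∈ chartIndices d S,
          chartIntegral z (cutOff x (extD (𝓡∂ (d + 1)) (cutOff z σ))) := Finset.sum_comm
    _ = ∑ z ∈ chartIndices d S, chartIntegral z (extD (𝓡∂ (d + 1)) (cutOff z σ)) :=
        Finset.sum_congr rfl fun z _ => by
          rw [← chartIntegral_sum _ _ fun x _ => hint z x, sum_cutOff]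
    _ = _ := Finset.sum_congr rfl fun z _ =>
        chartIntegral_extD (hσ.smul_chartPartition z) (isClosed_tsupport _) (tsupport_chartPartition z)
          fun _ => cutOff_eq_zero z σ

end

end

section
open ContinuousAlternatingMap Filter Topology

/-! ### Charges and their gauge variation. -/

section Charges

variable {E : Type*} [NormedAddCommGroup E] [NormedSpace ℝ E]
variable {H : Type*} [TopologicalSpace H] {I : ModelWithCorners ℝ E H}
variable {M : Type*} [TopologicalSpace M] [ChartedSpace H M]

theorem ContMDiff.of_zeroForm {W : Type*} [NormedAddCommGroup W] [NormedSpace ℝ W] {f : M → W}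
    (hf : IsSmoothForm I (zeroForm (E := E) f)) : ContMDiff I 𝓘(ℝ, W) ∞ f := by
  intro x
  have h1 : ContDiffWithinAt ℝ ∞ (f ∘ (extChartAt I x).symm) (range I) (extChartAt I x x) :=
    (ContinuousAlternatingMap.apply ℝ E W (0 : Fin 0 → E)).contDiff.contDiffAt.comp_contDiffWithinAt
      _ (hf.contDiffWithinAt (mem_extChartAt_target x))
  have h2 : ContMDiffWithinAt I 𝓘(ℝ, W) ∞ ((f ∘ (extChartAt I x).symm) ∘ extChartAt I x) univ x :=
    h1.contMDiffWithinAt.comp x contMDiffAt_extChartAt.contMDiffWithinAt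
      fun p _ => mem_range_self _
  refine (contMDiffWithinAt_univ.1 h2).congr_of_eventuallyEq ?_
  filter_upwards [extChartAt_source_mem_nhds (I := I) x] with p hp
  exact congrArg f ((extChartAt I x).left_inv hp).symm

theorem zeroForm_lieD₀ [IsManifold I ∞ M] {W : Type*} [NormedAddCommGroup W] [NormedSpace ℝ W]
    {ξ : ∀ x : M, TangentSpace I x} {η : M → W} (hη : ContMDiff I 𝓘(ℝ, W) ∞ η) :
    zeroForm (lieD₀ I ξ η) = contract I ξ (extD I (zeroForm η)) := by
  funext x
  ext v
  exact (extD_zeroForm_apply hη x (Matrix.vecCons (ξ x : E) v)).symm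

theorem interp_line {M 𝔤 : Type*} [NormedAddCommGroup 𝔤] [NormedSpace ℝ 𝔤] [NormedLieAlg 𝔤]
    (A Ab a ab : M → E [⋀^Fin 1]→L[ℝ] 𝔤) (s t : ℝ) :
    interp (A + s • a) (Ab + s • ab) t = interp A Ab t + s • interp a ab t := by
  simp only [interp]
  module

variable {𝔤 : Type*} [NormedAddCommGroup 𝔤] [NormedSpace ℝ 𝔤] [FiniteDimensional ℝ 𝔤]
  [NormedLieAlg 𝔤]
variable {V : Type*} [NormedAddCommGroup V] [NormedSpace ℝ V]
variable {m N : ℕ} {P : ContinuousMultilinearMap ℝ (fun _ : Fin (m + 2) => 𝔤) V}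
variable {A Ab : M → E [⋀^Fin 1]→L[ℝ] 𝔤} {η l : M → 𝔤} {ξ : ∀ x : M, TangentSpace I x}

theorem contMDiff_bracket (hη : ContMDiff I 𝓘(ℝ, 𝔤) ∞ η) (hl : ContMDiff I 𝓘(ℝ, 𝔤) ∞ l) :
    ContMDiff I 𝓘(ℝ, 𝔤) ∞ (fun x => ⁅η x, l x⁆) :=
  ((bracketCLM 𝔤).contMDiff.comp hη).clm_apply hl

variable [IsManifold I ∞ M]

/-- As a 0-form £_ξη is the contraction of dη, so its smoothness follows from that of d and of
contraction. -/
theorem contMDiff_lieD₀ (hη : ContMDiff I 𝓘(ℝ, 𝔤) ∞ η)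
    (hξ : ContMDiff I I.tangent ∞ (fun x => (⟨x, ξ x⟩ : TangentBundle I M))) :
    ContMDiff I 𝓘(ℝ, 𝔤) ∞ (lieD₀ I ξ η) := by
  refine ContMDiff.of_zeroForm ?_
  rw [zeroForm_lieD₀ hη]
  exact (IsSmoothForm.zeroForm hη).extD.contract hξ

theorem IsSmoothForm.covD (hA : IsSmoothForm I A) (hη : ContMDiff I 𝓘(ℝ, 𝔤) ∞ η) :
    IsSmoothForm I (covD I A η) := by
  rw [covD_eq]
  exact hA.covDer (.zeroForm hη)

theorem covDer_zeroForm_apply (A : M → E [⋀^Fin 1]→L[ℝ] 𝔤) (η : M → 𝔤) (x : M) (v : Fin 1 → E) :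
    covDer I A (zeroForm η) x v = extD I (zeroForm η) x v - ⁅η x, A x v⁆ := by
  have h1 : alternatizeUncurryFin (adForm (A x) (zeroForm η x)) v = ⁅A x v, η x⁆ := by
    rw [alternatizeUncurryFin_one, apply_fin_one (A x) v]
    rfl
  have h2 : covDer I A (zeroForm η) x v = extD I (zeroForm η) x v
      + alternatizeUncurryFin (adForm (A x) (zeroForm η x)) v := rfl
  rw [h2, h1, ← lie_skew, sub_eq_add_neg]

/-- The inhomogeneous term dη cancels in the difference, so Θ varies in the adjoint representation.
-/
theorem covD_sub_covD (A Ab : M → E [⋀^Fin 1]→L[ℝ] 𝔤) (η : M → 𝔤) (x : M) :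
    (covD I A η - covD I Ab η) x = -adj (η x) ((A - Ab) x) := by
  ext v
  rw [covD_eq, covD_eq, Pi.sub_apply, ContinuousAlternatingMap.sub_apply, covDer_zeroForm_apply,
    covDer_zeroForm_apply, ContinuousAlternatingMap.neg_apply, adj_apply, Pi.sub_apply,
    ContinuousAlternatingMap.sub_apply, lie_sub]
  abel

theorem contract_covDer_zeroForm (A : M → E [⋀^Fin 1]→L[ℝ] 𝔤) (η : M → 𝔤)
    (ξ : ∀ x : M, TangentSpace I x) (x : M) :
    contract I ξ (covDer I A (zeroForm η)) x
      = contract I ξ (extD I (zeroForm η)) x - adj (η x) (contract I ξ A x) := by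
  ext v
  exact covDer_zeroForm_apply A η x (Matrix.vecCons (ξ x : E) v)

/-- Derivative of the potential along an infinitesimal gauge transformation. -/
theorem hasDerivAt_potential [CompleteSpace V] (hP : IsInvariantPolynomial P)
    (hA : IsSmoothForm I A) (hAb : IsSmoothForm I Ab) (hη : ContMDiff I 𝓘(ℝ, 𝔤) ∞ η)
    (h : 0 + 1 + 2 * m = N) {Z : ℝ → ℝ → M → E [⋀^Fin 0]→L[ℝ] 𝔤} (hZ : IsSeparable I Z)
    {w : M → 𝔤}
    (hw : ∀ t x, HasDerivAt (fun s => Z s t x) (zeroForm w x - adj (η x) (Z 0 t x)) 0) :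
    IsSeparable I (fun s t x => angle P h (Z s t x)
        (((A + s • covD I A η) - (Ab + s • covD I Ab η)) x)
        (curvature I (interp (A + s • covD I A η) (Ab + s • covD I Ab η) t) x)) ∧
      ∀ x, HasDerivAt (fun s => ∫ t in (0 : ℝ)..1, angle P h (Z s t x)
          (((A + s • covD I A η) - (Ab + s • covD I Ab η)) x)
          (curvature I (interp (A + s • covD I A η) (Ab + s • covD I Ab η) t) x))
        (∫ t in (0 : ℝ)..1, angle P h (zeroForm w x) ((A - Ab) x)
          (curvature I (interp A Ab t) x)) 0 := by
  have hAs : IsSeparable I (fun s _ => A + s • covD I A η) :=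
    (IsSeparable.const hA).add (IsSeparable.const (hA.covD hη)).smul_left
  have hAbs : IsSeparable I (fun s _ => Ab + s • covD I Ab η) :=
    (IsSeparable.const hAb).add (IsSeparable.const (hAb.covD hη)).smul_left
  have hG := IsSeparable.angle P h hZ (hAs.sub hAbs) (hAs.interp hAbs).curvature
  refine ⟨hG, fun x => hG.hasDerivAt_integral x fun t => ?_⟩
  have dΘ : HasDerivAt (fun s : ℝ => ((A + s • covD I A η) - (Ab + s • covD I Ab η)) x)
      (-adj (η x) ((A - Ab) x)) 0 := by
    rw [← covD_sub_covD (I := I)]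
    have h1 := ((hasDerivAt_id' (0 : ℝ)).smul_const ((covD I A η - covD I Ab η) x)).const_add
      ((A - Ab) x)
    rw [one_smul] at h1
    refine h1.congr_of_eventuallyEq (Eventually.of_forall fun s => ?_)
    simp only [Pi.sub_apply, Pi.add_apply, Pi.smul_apply]
    module
  have dF : HasDerivAt (fun s : ℝ => curvature I (interp (A + s • covD I A η)
      (Ab + s • covD I Ab η) t) x) (-adj (η x) (curvature I (interp A Ab t) x)) 0 := by
    have h1 := hasDerivAt_curvature_line (hA.interp hAb t)
      ((hA.interp hAb t).covDer (.zeroForm hη)) x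
    -- The variation of F_t along D_tη is D_tD_tη, which is homogeneous in F_t.
    rw [covDer_covDer (hA.interp hAb t) (.zeroForm hη)] at h1
    simp only [interp_line, interp_covD]
    exact h1
  have h1 := hasDerivAt_angle P h (hw t x) dΘ dF
  simp only [zero_smul, add_zero] at h1
  refine h1.congr_deriv ?_
  -- All three entries vary by -[η, ·], except for the extra w in the first; invariance removes the
  -- common adjoint part.
  have h2 := hP.angle_adj h (η x) (Z 0 t x) ((A - Ab) x) (curvature I (interp A Ab t) x)
  rw [← angleLeft_apply, ← angleMid_apply, ← angleVarCLM_apply] at h2 ⊢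
  rw [map_sub, map_neg, map_neg, angleMid_apply, angleLeft_apply, angleVarCLM_apply]
  rw [angleMid_apply, angleLeft_apply, angleVarCLM_apply] at h2
  rw [angleLeft_apply]
  linear_combination (norm := module) (-1 : ℝ) • h2

variable {S : Type*} [TopologicalSpace S] [ChartedSpace (EuclideanHalfSpace (2 * m + 1 + 1)) S]
  [IsManifold (𝓡∂ (2 * m + 1 + 1)) ∞ S] [T2Space S] [CompactSpace S] {ι : S → M}

theorem charge_smul_extD (hor : IsOrientedAtlas (2 * m + 1) S)
    (hι : ContMDiff (𝓡∂ (2 * m + 1 + 1)) I ∞ ι) (c : ℝ)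
    {Ψ : M → E [⋀^Fin (2 * m + 1)]→L[ℝ] V} (hΨ : IsSmoothForm I Ψ) :
    charge I ι (c • extD I Ψ)
      = c • integrateBoundary (pullback I (𝓡∂ (2 * m + 1 + 1)) ι Ψ) := by
  have h1 : pullback I (𝓡∂ (2 * m + 1 + 1)) ι (c • extD I Ψ)
      = c • extD (𝓡∂ (2 * m + 1 + 1)) (pullback I (𝓡∂ (2 * m + 1 + 1)) ι Ψ) := by
    rw [extD_pullback hΨ hι]
    rfl
  rw [charge, h1, integrate_smul, integrate_extD hor (hΨ.pullback hι)]

/-- On smooth forms Ψ the charge of c dΨ is linear in Ψ, and linearity suffices to differentiate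
along a separable family. -/
theorem hasDerivAt_charge [CompleteSpace V] (hι : ContMDiff (𝓡∂ (2 * m + 1 + 1)) I ∞ ι) (c : ℝ)
    {G : ℝ → ℝ → M → E [⋀^Fin (2 * m + 1)]→L[ℝ] V} (hG : IsSeparable I G)
    {Φ : M → E [⋀^Fin (2 * m + 1)]→L[ℝ] V}
    (hΦ : ∀ x, HasDerivAt (fun s => ∫ t in (0 : ℝ)..1, G s t x) (Φ x) 0) :
    HasDerivAt (fun s => charge I ι (c • extD I (fun x => ∫ t in (0 : ℝ)..1, G s t x)))
      (charge I ι (c • extD I Φ)) 0 := by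
  refine hG.hasDerivAt_functional (fun Ψ => charge I ι (c • extD I Ψ)) (fun α β hα hβ => ?_)
    (fun r α hα => ?_) hΦ
  · simp only [charge]
    rw [extD_add hα hβ, smul_add, ← integrate_add ((hα.extD.const_smul c).pullback hι)
      ((hβ.extD.const_smul c).pullback hι)]
    rfl
  · simp only [charge]
    rw [extD_smul, smul_comm, ← integrate_smul]
    rfl

/-- Because λ is held fixed, its variation 0 is written as [η,λ] - [η,λ]; thus w = [η,λ], and no
further term is left to form a central extension. -/
theorem hasDerivAt_charge_gaugeOff [CompleteSpace V] (hP : IsInvariantPolynomial P)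
    (hA : IsSmoothForm I A) (hAb : IsSmoothForm I Ab) (hη : ContMDiff I 𝓘(ℝ, 𝔤) ∞ η)
    (hl : ContMDiff I 𝓘(ℝ, 𝔤) ∞ l) (hι : ContMDiff (𝓡∂ (2 * m + 1 + 1)) I ∞ ι) (k : ℝ) :
    HasDerivAt (fun s : ℝ => charge I ι
        (gaugeOff I k P (A + s • covD I A η) (Ab + s • covD I Ab η) l))
      (charge I ι (gaugeOff I k P A Ab (fun x => ⁅η x, l x⁆))) 0 := by
  obtain ⟨h1, h2⟩ := hasDerivAt_potential (N := 2 * m + 1) hP hA hAb hη (by omega)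
    (IsSeparable.const (IsSmoothForm.zeroForm hl)) (w := fun x => ⁅η x, l x⁆) (fun t x => by
      refine (hasDerivAt_const (0 : ℝ) _).congr_deriv ?_
      refine (sub_eq_zero.2 ?_).symm
      ext v
      rfl)
  have h3 := hasDerivAt_charge hι (k * (m + 1) * (m + 2)) h1 h2
  rw [gaugeOff_eq hP hA hAb (contMDiff_bracket hη hl)]
  refine h3.congr_of_eventuallyEq (Eventually.of_forall fun s => ?_)
  simp only
  rw [gaugeOff_eq hP (hA.add ((hA.covD hη).const_smul s)) (hAb.add ((hAb.covD hη).const_smul s)) hl]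
  rfl

/-- The first entry I_ξA_t varies by I_ξD_tη = £_ξη - [η, I_ξA_t], so the inhomogeneous part w =
£_ξη takes the place of a gauge parameter. -/
theorem hasDerivAt_charge_difOff [CompleteSpace V] (hP : IsInvariantPolynomial P)
    (hA : IsSmoothForm I A) (hAb : IsSmoothForm I Ab) (hη : ContMDiff I 𝓘(ℝ, 𝔤) ∞ η)
    (hξ : ContMDiff I I.tangent ∞ (fun x => (⟨x, ξ x⟩ : TangentBundle I M)))
    (hι : ContMDiff (𝓡∂ (2 * m + 1 + 1)) I ∞ ι) (k : ℝ) :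
    HasDerivAt (fun s : ℝ => charge I ι
        (difOff I k P (A + s • covD I A η) (Ab + s • covD I Ab η) ξ))
      (charge I ι (gaugeOff I k P A Ab (lieD₀ I ξ η))) 0 := by
  have hAs : IsSeparable I (fun s _ => A + s • covD I A η) :=
    (IsSeparable.const hA).add (IsSeparable.const (hA.covD hη)).smul_left
  have hAbs : IsSeparable I (fun s _ => Ab + s • covD I Ab η) :=
    (IsSeparable.const hAb).add (IsSeparable.const (hAb.covD hη)).smul_left
  obtain ⟨h1, h2⟩ := hasDerivAt_potential (N := 2 * m + 1) hP hA hAb hη (by omega)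
    ((hAs.interp hAbs).contract hξ) (w := lieD₀ I ξ η) (fun t x => by
      simp only [interp_line, interp_covD]
      have h1 := ((hasDerivAt_id' (0 : ℝ)).smul_const
        (contract I ξ (covDer I (interp A Ab t) (zeroForm η)) x)).const_add
          (contract I ξ (interp A Ab t) x)
      rw [one_smul] at h1
      refine (h1.congr_of_eventuallyEq (Eventually.of_forall fun s => rfl)).congr_deriv ?_
      rw [zeroForm_lieD₀ hη, zero_smul, add_zero, contract_covDer_zeroForm])
  have h3 := hasDerivAt_charge hι (k * (m + 1) * (m + 2)) h1 h2
  rw [gaugeOff_eq hP hA hAb (contMDiff_lieD₀ hη hξ)]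
  refine h3.congr_of_eventuallyEq (Eventually.of_forall fun s => ?_)
  simp only
  rw [difOff_eq hP (hA.add ((hA.covD hη).const_smul s)) (hAb.add ((hAb.covD hη).const_smul s)) hξ]
  rfl

end Charges

end

end Transgression

end

/-! ### Assembly of the theorem. -/

theorem mainTheorem9
    -- the gauge Lie algebra and the target of the invariant polynomial
    {𝔤 : Type*} [NormedAddCommGroup 𝔤] [NormedSpace ℝ 𝔤] [FiniteDimensional ℝ 𝔤] [NormedLieAlg 𝔤]
    {V : Type*} [NormedAddCommGroup V] [NormedSpace ℝ V] [FiniteDimensional ℝ V]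
    -- the base manifold, of dimension `2 n + 1` with `n = m + 1`
    (m : ℕ) {E : Type*} [NormedAddCommGroup E] [NormedSpace ℝ E] [FiniteDimensional ℝ E]
    (hdim : Module.finrank ℝ E = 2 * m + 3)
    {H : Type*} [TopologicalSpace H] (I : ModelWithCorners ℝ E H)
    {M : Type*} [TopologicalSpace M] [ChartedSpace H M] [IsManifold I ∞ M]
    -- the constant and the invariant polynomial of degree `n + 1`
    (k : ℝ) (P : ContinuousMultilinearMap ℝ (fun _ : Fin (m + 2) => 𝔤) V)
    (hP : Transgression.IsInvariantPolynomial P)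
    -- arbitrary gauge connections (no field equations are imposed)
    (A Ab : M → E [⋀^Fin 1]→L[ℝ] 𝔤)
    (hA : Transgression.IsSmoothForm I A) (hAb : Transgression.IsSmoothForm I Ab) :
    -- the variation of the Lagrangian
    (∀ a ab : M → E [⋀^Fin 1]→L[ℝ] 𝔤,
      Transgression.IsSmoothForm I a → Transgression.IsSmoothForm I ab → ∀ x : M,
        HasDerivAt
          (fun s : ℝ => Transgression.lagrangian I k P (A + s • a) (Ab + s • ab) x)
          (Transgression.eulerLagrange I k P A Ab a ab x
            + Transgression.extD I (Transgression.boundaryTerm I k P A Ab a ab) x) 0) ∧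
    -- the gauge current
    (∀ l : M → 𝔤, ContMDiff I 𝓘(ℝ, 𝔤) ∞ l →
      Transgression.extD I (Transgression.gaugeOn I k P A Ab l)
          + Transgression.eulerLagrange I k P A Ab
              (Transgression.covD I A l) (Transgression.covD I Ab l) = 0 ∧
      Transgression.eulerLagrange I k P A Ab
          (Transgression.covD I A l) (Transgression.covD I Ab l)
        = Transgression.extD I (Transgression.gaugeCorrection I k P A Ab l) ∧
      Transgression.IsSmoothForm I (Transgression.gaugePotential I P A Ab l) ∧
      Transgression.gaugeOff I k P A Ab l
        = (k * (m + 1) * (m + 2)) •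
            Transgression.extD I (Transgression.gaugePotential I P A Ab l) ∧
      Transgression.extD I (Transgression.gaugeOff I k P A Ab l) = 0) ∧
    -- the diffeomorphism current
    (∀ ξ : ∀ x : M, TangentSpace I x,
      ContMDiff I I.tangent ∞ (fun x => (⟨x, ξ x⟩ : TangentBundle I M)) →
      Transgression.extD I (Transgression.difOn I k P A Ab ξ)
          + Transgression.eulerLagrange I k P A Ab
              (Transgression.lieD I ξ A) (Transgression.lieD I ξ Ab) = 0 ∧
      Transgression.eulerLagrange I k P A Ab
          (Transgression.lieD I ξ A) (Transgression.lieD I ξ Ab)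
        = Transgression.extD I (Transgression.difCorrection I k P A Ab ξ) ∧
      Transgression.IsSmoothForm I (Transgression.difPotential I P A Ab ξ) ∧
      Transgression.difOff I k P A Ab ξ
        = (k * (m + 1) * (m + 2)) •
            Transgression.extD I (Transgression.difPotential I P A Ab ξ) ∧
      Transgression.extD I (Transgression.difOff I k P A Ab ξ) = 0) ∧
    -- the charges on a compact oriented spatial section `ι : S → M`, `dim S = 2 n`
    (∀ {S : Type*} [TopologicalSpace S] [ChartedSpace (EuclideanHalfSpace (2 * m + 1 + 1)) S]
        [IsManifold (𝓡∂ (2 * m + 1 + 1)) ∞ S] [T2Space S] [CompactSpace S],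
      Transgression.IsOrientedAtlas (2 * m + 1) S →
      ∀ ι : S → M, ContMDiff (𝓡∂ (2 * m + 1 + 1)) I ∞ ι →
      -- they are boundary charges
      (∀ l : M → 𝔤, ContMDiff I 𝓘(ℝ, 𝔤) ∞ l →
        Transgression.charge I ι (Transgression.gaugeOff I k P A Ab l)
          = (k * (m + 1) * (m + 2)) • Transgression.integrateBoundary
              (Transgression.pullback I (𝓡∂ (2 * m + 1 + 1)) ι
                (Transgression.gaugePotential I P A Ab l))) ∧
      (∀ ξ : ∀ x : M, TangentSpace I x,
        ContMDiff I I.tangent ∞ (fun x => (⟨x, ξ x⟩ : TangentBundle I M)) →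
        Transgression.charge I ι (Transgression.difOff I k P A Ab ξ)
          = (k * (m + 1) * (m + 2)) • Transgression.integrateBoundary
              (Transgression.pullback I (𝓡∂ (2 * m + 1 + 1)) ι
                (Transgression.difPotential I P A Ab ξ))) ∧
      -- `{Q(η), Q(l)} = δ_η Q(l) = Q([η, l])`, with no central term
      (∀ η l : M → 𝔤, ContMDiff I 𝓘(ℝ, 𝔤) ∞ η → ContMDiff I 𝓘(ℝ, 𝔤) ∞ l →
        HasDerivAt
          (fun s : ℝ => Transgression.charge I ι
            (Transgression.gaugeOff I k P
              (A + s • Transgression.covD I A η) (Ab + s • Transgression.covD I Ab η) l))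
          (Transgression.charge I ι
            (Transgression.gaugeOff I k P A Ab (fun x => ⁅η x, l x⁆))) 0) ∧
      -- `δ_η Q_dif(ξ) = Q_gauge(£_ξ η)`
      (∀ (η : M → 𝔤) (ξ : ∀ x : M, TangentSpace I x), ContMDiff I 𝓘(ℝ, 𝔤) ∞ η →
        ContMDiff I I.tangent ∞ (fun x => (⟨x, ξ x⟩ : TangentBundle I M)) →
        HasDerivAt
          (fun s : ℝ => Transgression.charge I ι
            (Transgression.difOff I k P
              (A + s • Transgression.covD I A η) (Ab + s • Transgression.covD I Ab η) ξ))
          (Transgression.charge I ι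
            (Transgression.gaugeOff I k P A Ab (Transgression.lieD₀ I ξ η))) 0)) := by
  have : CompleteSpace V := FiniteDimensional.complete ℝ V
  refine ⟨fun a ab ha hab x => Transgression.hasDerivAt_lagrangian hP hA hAb ha hab k x,
    fun l hl => ⟨Transgression.extD_gaugeOn hP hA hAb hl k,
      Transgression.extD_gaugeCorrection hP hA hAb hl k,
      Transgression.isSmoothForm_gaugePotential P hA hAb hl,
      Transgression.gaugeOff_eq hP hA hAb hl k, Transgression.extD_gaugeOff hP hA hAb hl k⟩,
    fun ξ hξ => ⟨Transgression.extD_difOn hdim hP hA hAb hξ k,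
      Transgression.extD_difCorrection hdim hP hA hAb hξ k,
      Transgression.isSmoothForm_difPotential P hA hAb hξ,
      Transgression.difOff_eq hP hA hAb hξ k, Transgression.extD_difOff hP hA hAb hξ k⟩,
    fun {S} _ _ _ _ _ hor ι hι => ⟨fun l hl => ?_, fun ξ hξ => ?_,
      fun η l hη hl => Transgression.hasDerivAt_charge_gaugeOff hP hA hAb hη hl hι k,
      fun η ξ hη hξ => Transgression.hasDerivAt_charge_difOff hP hA hAb hη hξ hι k⟩⟩
  · rw [Transgression.gaugeOff_eq hP hA hAb hl k]
    exact Transgression.charge_smul_extD hor hι _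
      (Transgression.isSmoothForm_gaugePotential P hA hAb hl)
  · rw [Transgression.difOff_eq hP hA hAb hξ k]
    exact Transgression.charge_smul_extD hor hι _
      (Transgression.isSmoothForm_difPotential P hA hAb hξ)
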